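/- Let $\mathcal X$ be the distribution of a random vector $\mathbf x\in\mathbb R^d$, $d\ge 1$, whose second moment matrix $\Sigma=\mathbb E[\mathbf x\mathbf x^\top]$ exists and has full rank. Let $\mathrm{VS}^d_{\mathcal X}$ denote the probability measure on $d\times d$ real matrices given by $$\mathrm{VS}^d_{\mathcal X}(A)=\frac{\mathbb E\big[\det(\mathbf X^\top\mathbf X)\,\mathbf 1_{[\mathbf X\in A]}\big]}{\mathbb E\big[\det(\mathbf X^\top\mathbf X)\big]},$$ where the $d$ rows of $\mathbf X$ are independent and distributed as $\mathcal X$. Let $\widehat\Sigma\in\mathbb R^{d\times d}$ be a symmetric matrix with $$(1-\epsilon)\Sigma\preceq\widehat\Sigma\preceq(1+\epsilon)\Sigma,\qquad \epsilon=\frac1{\sqrt{2d}},$$ and let $\mathrm{Lev}_{\widehat\Sigma,\mathcal X}$ be the probability measure on $\mathbb R^d$ given by $$\mathrm{Lev}_{\widehat\Sigma,\mathcal X}(A)=\mathbb E\bigg[\mathbf 1_{[\mathbf x\in A]}\,\frac{\mathbf x^\top\widehat\Sigma^{-1}\mathbf x}{\mathrm{tr}(\Sigma\widehat\Sigma^{-1})}\bigg].$$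 **Theorem.** There are a randomized algorithm and an absolute constant $C$, neither depending on $d$, $\mathcal X$, $\widehat\Sigma$ or $\delta$, such that the following holds. The algorithm is a program for a real RAM with unit-cost arithmetic, comparisons, memory accesses and draws of uniform random reals from $[0,1]$, where reading one vector sample takes $d$ units of time plus the constant cost of the instruction. Given $d$, $\widehat\Sigma$ and access to i.i.d. samples from $\mathrm{Lev}_{\widehat\Sigma,\mathcal X}$, it terminates almost surely and returns a random matrix distributed exactly as $\mathrm{VS}^d_{\mathcal X}$. For every $\delta\in(0,1)$, with probability at least $1-\delta$ it uses at most $C\,d^2\max\{1,\log\frac1\delta\}$ samples and at most $C\,d^4\max\{1,\log\frac1\delta\}$ units of time. -/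

import Mathlib

open MeasureTheory ProbabilityTheory

/-! ## Second moments, volume-rescaled sampling, leverage score sampling -/

/-- The second moment matrix `E[x xᵀ]` of a distribution `D` of a random vector in `ℝᵈ`
(meaningful when all products `x i * x j` are `D`-integrable). -/
noncomputable def secondMoment {d : ℕ} (D : Measure (Fin d → ℝ)) : Matrix (Fin d) (Fin d) ℝ :=
  Matrix.of fun i j => ∫ x, x i * x j ∂D

/-- The volume weight `det (Xᵀ X)` of a `k × d` matrix `X` given by its rows. -/
noncomputable def volumeWeight {k d : ℕ} (X : Fin k → Fin d → ℝ) : ENNReal :=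
  ENNReal.ofReal ((Matrix.of X).transpose * Matrix.of X).det

/-- Volume-rescaled size `k` sampling from `D`: the law on `k × d` matrices proportional to
`det (Xᵀ X)` with respect to the law of `k` independent rows distributed as `D`. -/
noncomputable def volumeRescaled (k : ℕ) {d : ℕ} (D : Measure (Fin d → ℝ)) :
    Measure (Fin k → Fin d → ℝ) :=
  (∫⁻ X, volumeWeight X ∂(Measure.pi fun _ : Fin k => D))⁻¹ •
    (Measure.pi fun _ : Fin k => D).withDensity volumeWeight

/-- Leverage score sampling from `D` with respect to a matrix `S` that approximates the second
moment matrix: the law with density `xᵀ S⁻¹ x / tr (E[x xᵀ] S⁻¹)` with respect to `D`. -/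
noncomputable def leverageLaw {d : ℕ} (S : Matrix (Fin d) (Fin d) ℝ) (D : Measure (Fin d → ℝ)) :
    Measure (Fin d → ℝ) :=
  D.withDensity fun x =>
    ENNReal.ofReal (x ⬝ᵥ (S⁻¹.mulVec x) / (secondMoment D * S⁻¹).trace)

/-! ## A randomized real RAM with a sampling oracle

Programs are finite syntactic objects.  The memory holds natural-number variables and real
matrices with unbounded index ranges, both named by natural numbers.  Every arithmetic operation,
comparison, memory access and assignment has unit cost.  The only real constants are casts of
natural numbers, and the only real operations are `+`, `-`, `*`, `/` and `<`.  Randomness comes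
from two instructions: drawing a uniform real in `[0, 1]`, and drawing a fresh vector from the
sampling oracle. -/

namespace RealRAM

/-- Expressions for indices and counters, with values in `ℕ`. -/
inductive IdxExpr : Type
  | const (n : ℕ)
  | var (v : ℕ)
  | add (a b : IdxExpr)
  | sub (a b : IdxExpr)
  | mul (a b : IdxExpr)

/-- Expressions with real values; `get m i j` reads entry `(i, j)` of matrix `m`. -/
inductive RealExpr : Type
  | ofIdx (a : IdxExpr)
  | get (m : ℕ) (i j : IdxExpr)
  | add (a b : RealExpr)
  | sub (a b : RealExpr)
  | mul (a b : RealExpr)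
  | div (a b : RealExpr)

/-- Conditions. -/
inductive Test : Type
  | idxLt (a b : IdxExpr)
  | realLt (a b : RealExpr)
  | not (p : Test)
  | and (p q : Test)

/-- Programs. -/
inductive Cmd : Type
  | skip
  /-- assign to the natural-number variable `v` -/
  | setIdx (v : ℕ) (a : IdxExpr)
  /-- assign to entry `(i, j)` of matrix `m` -/
  | setReal (m : ℕ) (i j : IdxExpr) (a : RealExpr)
  /-- store a fresh uniform random real of `[0, 1]` in entry `(i, j)` of matrix `m` -/
  | drawUniform (m : ℕ) (i j : IdxExpr)
  /-- store a fresh vector from the sampling oracle in the row `i` of matrix `m` -/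
  | drawSample (m : ℕ) (i : IdxExpr)
  | seq (c₁ c₂ : Cmd)
  | branch (p : Test) (c₁ c₂ : Cmd)
  | loop (p : Test) (c : Cmd)

/-- Machine states: the memory, the numbers of oracle samples and of uniform reals drawn so far,
and the elapsed time. -/
@[ext] structure State : Type where
  idx : ℕ → ℕ
  mat : ℕ → ℕ → ℕ → ℝ
  samples : ℕ
  uniforms : ℕ
  time : ℕ

/-- Value of an index expression; subtraction is truncated. -/
def IdxExpr.eval (s : State) : IdxExpr → ℕ
  | const n => n
  | var v => s.idx v
  | add a b => a.eval s + b.eval s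
  | sub a b => a.eval s - b.eval s
  | mul a b => a.eval s * b.eval s

/-- Number of unit-cost operations in an index expression. -/
def IdxExpr.cost : IdxExpr → ℕ
  | const _ => 1
  | var _ => 1
  | add a b => a.cost + b.cost + 1
  | sub a b => a.cost + b.cost + 1
  | mul a b => a.cost + b.cost + 1

/-- Value of a real expression; division by zero returns zero. -/
noncomputable def RealExpr.eval (s : State) : RealExpr → ℝ
  | ofIdx a => (a.eval s : ℝ)
  | get m i j => s.mat m (i.eval s) (j.eval s)
  | add a b => a.eval s + b.eval s
  | sub a b => a.eval s - b.eval s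
  | mul a b => a.eval s * b.eval s
  | div a b => a.eval s / b.eval s

/-- Number of unit-cost operations in a real expression. -/
def RealExpr.cost : RealExpr → ℕ
  | ofIdx a => a.cost + 1
  | get _ i j => i.cost + j.cost + 1
  | add a b => a.cost + b.cost + 1
  | sub a b => a.cost + b.cost + 1
  | mul a b => a.cost + b.cost + 1
  | div a b => a.cost + b.cost + 1

/-- Truth of a condition. -/
def Test.holds (s : State) : Test → Prop
  | idxLt a b => a.eval s < b.eval s
  | realLt a b => a.eval s < b.eval s
  | not p => ¬ p.holds s
  | and p q => p.holds s ∧ q.holds s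

/-- Number of unit-cost operations in a condition. -/
def Test.cost : Test → ℕ
  | idxLt a b => a.cost + b.cost + 1
  | realLt a b => a.cost + b.cost + 1
  | not p => p.cost + 1
  | and p q => p.cost + q.cost + 1

/-- Let `n` units of time pass. -/
def State.tick (s : State) (n : ℕ) : State :=
  { s with time := s.time + n }

/-- Store `n` in the natural-number variable `v`. -/
def State.writeIdx (s : State) (v n : ℕ) : State :=
  { s with idx := fun v' => if v' = v then n else s.idx v' }

/-- Store `r` in entry `(i, j)` of matrix `m`. -/
def State.writeReal (s : State) (m i j : ℕ) (r : ℝ) : State :=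
  { s with mat := fun m' i' j' => if m' = m ∧ i' = i ∧ j' = j then r else s.mat m' i' j' }

/-- Store the vector `x` in the first `d` entries of row `i` of matrix `m`. -/
def State.writeRow {d : ℕ} (s : State) (m i : ℕ) (x : Fin d → ℝ) : State :=
  { s with mat := fun m' i' j' =>
      if h : (m' = m ∧ i' = i) ∧ j' < d then x ⟨j', h.2⟩ else s.mat m' i' j' }

/-- Big-step semantics: `Exec xs us c s s'` means that `c`, started in `s`, terminates in `s'`
when the oracle returns the vectors `xs 0, xs 1, …` and the uniform reals drawn are
`us 0, us 1, …`.  Drawing a vector costs `d` units of time for storing its coordinates, besides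
the cost of the instruction. -/
inductive Exec {d : ℕ} (xs : ℕ → Fin d → ℝ) (us : ℕ → ℝ) : Cmd → State → State → Prop
  | skip (s : State) : Exec xs us .skip s (s.tick 1)
  | setIdx (v : ℕ) (a : IdxExpr) (s : State) :
      Exec xs us (.setIdx v a) s ((s.writeIdx v (a.eval s)).tick (a.cost + 1))
  | setReal (m : ℕ) (i j : IdxExpr) (a : RealExpr) (s : State) :
      Exec xs us (.setReal m i j a) s
        ((s.writeReal m (i.eval s) (j.eval s) (a.eval s)).tick (i.cost + j.cost + a.cost + 1))
  | drawUniform (m : ℕ) (i j : IdxExpr) (s : State) :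
      Exec xs us (.drawUniform m i j) s
        { (s.writeReal m (i.eval s) (j.eval s) (us s.uniforms)).tick (i.cost + j.cost + 1) with
          uniforms := s.uniforms + 1 }
  | drawSample (m : ℕ) (i : IdxExpr) (s : State) :
      Exec xs us (.drawSample m i) s
        { (s.writeRow m (i.eval s) (xs s.samples)).tick (i.cost + d + 1) with
          samples := s.samples + 1 }
  | seq {c₁ c₂ : Cmd} {s s' s'' : State} :
      Exec xs us c₁ s s' → Exec xs us c₂ s' s'' → Exec xs us (.seq c₁ c₂) s s''
  | branchTrue {p : Test} {c₁ c₂ : Cmd} {s s' : State} : p.holds s →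
      Exec xs us c₁ (s.tick (p.cost + 1)) s' → Exec xs us (.branch p c₁ c₂) s s'
  | branchFalse {p : Test} {c₁ c₂ : Cmd} {s s' : State} : ¬ p.holds s →
      Exec xs us c₂ (s.tick (p.cost + 1)) s' → Exec xs us (.branch p c₁ c₂) s s'
  | loopStop {p : Test} {c : Cmd} {s : State} : ¬ p.holds s →
      Exec xs us (.loop p c) s (s.tick (p.cost + 1))
  | loopStep {p : Test} {c : Cmd} {s s' s'' : State} : p.holds s →
      Exec xs us c (s.tick (p.cost + 1)) s' → Exec xs us (.loop p c) s' s'' →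
      Exec xs us (.loop p c) s s''

/-- The final state, with its time and sample counts, is determined by the start and the random
inputs. -/
theorem Exec.unique {d : ℕ} {xs : ℕ → Fin d → ℝ} {us : ℕ → ℝ} {c : Cmd} {s s₁ s₂ : State}
    (h₁ : Exec xs us c s s₁) (h₂ : Exec xs us c s s₂) : s₁ = s₂ := by
  induction h₁ generalizing s₂ with
  | skip | setIdx | setReal | drawUniform | drawSample => cases h₂; rfl
  | seq _ _ ih₁ ih₂ =>
    cases h₂ with
    | seq k₁ k₂ => cases ih₁ k₁; exact ih₂ k₂
  | branchTrue hp _ ih =>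
    cases h₂ with
    | branchTrue _ k => exact ih k
    | branchFalse hn _ => exact absurd hp hn
  | branchFalse hp _ ih =>
    cases h₂ with
    | branchTrue hn _ => exact absurd hn hp
    | branchFalse _ k => exact ih k
  | loopStop hp =>
    cases h₂ with
    | loopStop _ => rfl
    | loopStep hn _ _ => exact absurd hn hp
  | loopStep hp _ _ ih₁ ih₂ =>
    cases h₂ with
    | loopStop hn => exact absurd hp hn
    | loopStep _ k₁ k₂ => cases ih₁ k₁; exact ih₂ k₂

/-- The start state for the input `S`: variable `0` holds the dimension `d`, matrix `0` holds `S`,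
everything else is zero. -/
noncomputable def initState {d : ℕ} (S : Matrix (Fin d) (Fin d) ℝ) : State where
  idx v := if v = 0 then d else 0
  mat m i j := if h : m = 0 ∧ i < d ∧ j < d then S ⟨i, h.2.1⟩ ⟨j, h.2.2⟩ else 0
  samples := 0
  uniforms := 0
  time := 0

/-- The output: the upper left `d × d` block of matrix `1`, as a list of rows. -/
def State.output (d : ℕ) (s : State) : Fin d → Fin d → ℝ :=
  fun i j => s.mat 1 i j

end RealRAM

/-!
# Exact volume-rescaled sampling from approximate leverage score samples

The program `RealRAM.Cmd.volumeSampler` is a rejection sampler.  Let `G = S⁻¹`.  One round draws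
`d ^ 2` candidates `x i` from the leverage law, gives them the weights `w i = 1 / (d xᵢᵀ G xᵢ)`,
forms the weighted Gram matrix `H = ∑ w i • xᵢ xᵢᵀ`, accepts with probability `det H / det S`, and
returns `d` of the candidates, where the set `J` is chosen with probability
`det (∑ i ∈ J, w i • xᵢ xᵢᵀ) / det H`; by the Cauchy–Binet formula these probabilities add up to
one.  As `tr (G H) ≤ d`, the inequality of arithmetic and geometric means gives `det H ≤ det S`
(`candidateDet_inv_le`).

Why the output is exact: for each `J` the probability of acceptance and selection of `J` is
`(∏ i ∈ J, w i) * det (Xᵀ X) / det S`, where the rows of `X` are the selected candidates, and the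
density `xᵀ G x / tr (Σ G)` of the leverage law cancels the weights up to a constant.  What is left
is `det (Xᵀ X)` with respect to the product of `d` copies of the original distribution, for each of
the `d ^ 2` choose `d` sets `J` alike (`roundLaw_acceptSet_inter_preimage`).

Why a few rounds suffice: the acceptance probability has a closed form, because
`E [det (Xᵀ X)] = d! det Σ`.  It is at least `1 / 4` (`quarter_le_roundLaw_acceptSet`), one factor
`1 / 2` being a birthday estimate for `d` choices among `d ^ 2` elements and the other a Kantorovich
type inequality for the eigenvalues of `Σ S⁻¹`.  So the number of rounds has geometric tails, and
the output of the first accepted round has the law of a round conditioned on acceptance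
(`hasLaw_apply_firstEntry`).

Why a round takes time `O(d ^ 4)`: the set `J` is selected in a single pass over the candidates, and
each one is decided in time `O(d ^ 2)`.  The conditional probability to include the candidate `i`,
given the set `I` selected before, is `w i * xᵢᵀ A xᵢ`, where `A` is the limit for `t → ∞` of the
inverse of `∑ j ≥ i, w j • xⱼ xⱼᵀ + t • ∑ j ∈ I, w j • xⱼ xⱼᵀ`.  This limit exists and changes by a
rank-one matrix from step to step (`IsTiltedInverse.selection_step`).  The product of the
conditional probabilities telescopes (`completionVolume_mul_prod_stepProbability`), so that for
fixed candidates the uniform reals leading to `J` form a box of the right volume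
(`pi_uniformLaw_selection`).  The inverse and the determinant of `H` come from `d` rank-one updates,
without pivoting since `H` is positive semidefinite (`IsPartialInverse`).

The execution of the program is analysed with a Hoare logic with time bounds
(`RealRAM.Runs`); `RealRAM.exec_volumeSampler` is the resulting deterministic statement.
-/

open scoped Matrix

/-! ### Rank-one updates of inverses and determinants -/

section RankOne

variable {n : Type*} [Fintype n] [DecidableEq n]

/-- The Sherman–Morrison formula, for a left inverse. -/
theorem Matrix.shermanMorrison {G Z : Matrix n n ℝ} (h : G * Z = 1) (a b : n → ℝ)
    (hp : 1 + b ⬝ᵥ (G *ᵥ a) ≠ 0) :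
    (G - (1 + b ⬝ᵥ (G *ᵥ a))⁻¹ • Matrix.vecMulVec (G *ᵥ a) (b ᵥ* G)) *
      (Z + Matrix.vecMulVec a b) = 1 := by
  set s := b ⬝ᵥ (G *ᵥ a)
  have h1 : Matrix.vecMulVec (G *ᵥ a) (b ᵥ* G) * Z = Matrix.vecMulVec (G *ᵥ a) b := by
    rw [Matrix.vecMulVec_mul, Matrix.vecMul_vecMul, h, Matrix.vecMul_one]
  have h2 : Matrix.vecMulVec (G *ᵥ a) (b ᵥ* G) * Matrix.vecMulVec a b =
      s • Matrix.vecMulVec (G *ᵥ a) b := by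
    rw [Matrix.vecMulVec_mul_vecMulVec, ← Matrix.dotProduct_mulVec]
    ext i j
    simp only [Matrix.vecMulVec_apply, Matrix.smul_apply, Pi.smul_apply, smul_eq_mul, s]
    ring
  rw [sub_mul, mul_add, h, Matrix.mul_vecMulVec, Matrix.smul_mul, mul_add, h1, h2]
  ext i j
  simp only [Matrix.sub_apply, Matrix.add_apply, Matrix.smul_apply, smul_eq_mul]
  field_simp
  ring

/-- The matrix determinant lemma, for a given left inverse. -/
theorem Matrix.det_add_vecMulVec {G Z : Matrix n n ℝ} (h : G * Z = 1) (a b : n → ℝ) :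
    (Z + Matrix.vecMulVec a b).det = Z.det * (1 + b ⬝ᵥ (G *ᵥ a)) := by
  have hG : Z⁻¹ = G := Matrix.inv_eq_left_inv h
  have hu : IsUnit Z.det := Matrix.isUnit_det_of_left_inverse h
  have := Matrix.det_add_replicateCol_mul_replicateRow (ι := Unit) hu a b
  rw [hG, Matrix.mul_assoc, ← Matrix.replicateCol_mulVec] at this
  rw [Matrix.vecMulVec_eq Unit, this]
  simp [Matrix.det_unique, Matrix.mul_apply, dotProduct]

/-- The determinant is an affine function along a rank-one direction. -/
theorem Matrix.det_add_smul_vecMulVec (N : Matrix n n ℝ) (a b : n → ℝ) (s : ℝ) :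
    (N + s • Matrix.vecMulVec a b).det =
      s * (N + Matrix.vecMulVec a b).det + (1 - s) * N.det := by
  have key : ∀ s : ℝ, (N + s • Matrix.vecMulVec a b).det =
      (Matrix.fromBlocks N (Matrix.replicateCol Unit (s • a))
        (Matrix.replicateRow Unit (-b)) 1).det := by
    intro s
    rw [Matrix.det_fromBlocks_one₂₂]
    congr 1
    ext i j
    simp [Matrix.vecMulVec_apply, Matrix.mul_apply]
  let col : ℝ → n ⊕ Unit → ℝ := fun s => Sum.elim (s • a) (fun _ => 1)
  have hcol : ∀ s : ℝ, Matrix.fromBlocks N (Matrix.replicateCol Unit (s • a))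
        (Matrix.replicateRow Unit (-b)) 1 =
      (Matrix.fromBlocks N (Matrix.replicateCol Unit (0 : n → ℝ))
        (Matrix.replicateRow Unit (-b)) (1 : Matrix Unit Unit ℝ)).updateCol (Sum.inr ()) (col s) := by
    intro s
    ext i j
    rcases i with i | i <;> rcases j with j | j <;> simp [col]
  have hs : col s = s • col 1 + (1 - s) • col 0 := by
    ext i
    rcases i with i | i <;> simp [col]
  have h1 := key 1
  have h0 := key 0
  rw [one_smul] at h1
  rw [zero_smul, add_zero] at h0
  rw [key s, h1, h0, hcol s, hs, Matrix.det_updateCol_add, Matrix.det_updateCol_smul,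
    Matrix.det_updateCol_smul, ← hcol 1, ← hcol 0]

end RankOne

/-! ### Weighted Gram matrices and their determinants -/

section Gram

variable {d : ℕ}

/-- The weighted Gram matrix `∑ j ∈ J, w j • x j (x j)ᵀ`. -/
noncomputable def gram (x : ℕ → Fin d → ℝ) (w : ℕ → ℝ) (J : Finset ℕ) : Matrix (Fin d) (Fin d) ℝ :=
  ∑ j ∈ J, w j • Matrix.vecMulVec (x j) (x j)

theorem gram_apply (x : ℕ → Fin d → ℝ) (w : ℕ → ℝ) (J : Finset ℕ) (a b : Fin d) :
    gram x w J a b = ∑ j ∈ J, w j * (x j a * x j b) := by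
  simp [gram, Matrix.sum_apply, Matrix.vecMulVec_apply]

theorem gram_insert (x : ℕ → Fin d → ℝ) (w : ℕ → ℝ) {J : Finset ℕ} {i : ℕ} (hi : i ∉ J) :
    gram x w (insert i J) = w i • Matrix.vecMulVec (x i) (x i) + gram x w J :=
  Finset.sum_insert hi

theorem gram_isSymm (x : ℕ → Fin d → ℝ) (w : ℕ → ℝ) (J : Finset ℕ) : (gram x w J).IsSymm := by
  ext a b
  simp only [Matrix.transpose_apply, gram_apply]
  exact Finset.sum_congr rfl fun j _ => by ring

theorem gram_posSemidef (x : ℕ → Fin d → ℝ) {w : ℕ → ℝ} (hw : ∀ j, 0 ≤ w j) (J : Finset ℕ) :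
    (gram x w J).PosSemidef :=
  Matrix.posSemidef_sum _ fun j _ => (by
    simpa using Matrix.posSemidef_vecMulVec_self_star (x j) :
      (Matrix.vecMulVec (x j) (x j)).PosSemidef).smul (hw j)

theorem rank_gram_le (x : ℕ → Fin d → ℝ) (w : ℕ → ℝ) (J : Finset ℕ) :
    (gram x w J).rank ≤ J.card := by
  have h : gram x w J = (Matrix.of fun (a : Fin d) (j : J) => w j * x j a) *
      Matrix.of fun (j : J) (b : Fin d) => x j b := by
    ext a b
    rw [gram_apply, Matrix.mul_apply, ← Finset.sum_coe_sort]
    exact Finset.sum_congr rfl fun j _ => by simp; ring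
  rw [h]
  refine (Matrix.rank_mul_le_left _ _).trans ((Matrix.rank_le_card_width _).trans ?_)
  simp

/-- A Gram matrix of fewer than `d` vectors is singular. -/
theorem det_gram_eq_zero (x : ℕ → Fin d → ℝ) (w : ℕ → ℝ) {J : Finset ℕ} (h : J.card < d) :
    (gram x w J).det = 0 := by
  by_contra hne
  have := Matrix.rank_of_isUnit _ ((Matrix.isUnit_iff_isUnit_det _).2 (isUnit_iff_ne_zero.2 hne))
  have h2 := rank_gram_le x w J
  rw [this, Fintype.card_fin] at h2
  omega

/-- The squared volume of the subset `J` of the weighted vectors: the contribution of `J` to the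
Cauchy–Binet expansion of the determinant of a weighted Gram matrix, which is zero unless `J` has
`d` elements. -/
noncomputable def subsetVolume (x : ℕ → Fin d → ℝ) (w : ℕ → ℝ) (J : Finset ℕ) : ℝ :=
  if J.card = d then (gram x w J).det else 0

theorem subsetVolume_nonneg (x : ℕ → Fin d → ℝ) {w : ℕ → ℝ} (hw : ∀ j, 0 ≤ w j) (J : Finset ℕ) :
    0 ≤ subsetVolume x w J := by
  unfold subsetVolume
  split_ifs
  · exact (gram_posSemidef x hw J).det_nonneg
  · exact le_rfl

/-- In terms of the enumeration of `J`, the squared volume is a weighted squared determinant. -/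
theorem det_gram_eq_prod_mul_det_sq (x : ℕ → Fin d → ℝ) (w : ℕ → ℝ) {J : Finset ℕ}
    (hJ : J.card = d) :
    (gram x w J).det = (∏ c : Fin d, w (J.orderEmbOfFin hJ c)) *
      ((Matrix.of fun c => x (J.orderEmbOfFin hJ c)).transpose *
        Matrix.of fun c => x (J.orderEmbOfFin hJ c)).det := by
  set e := J.orderEmbOfFin hJ
  have hsum : gram x w J = (Matrix.of fun c => x (e c)).transpose *
      (Matrix.diagonal fun c => w (e c)) * Matrix.of fun c => x (e c) := by
    ext a b
    rw [gram_apply, Matrix.mul_apply]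
    have : J = Finset.univ.map e.toEmbedding := by
      simp [e]
    conv_lhs => rw [this, Finset.sum_map]
    refine Finset.sum_congr rfl fun c _ => ?_
    simp [Matrix.mul_diagonal]
    ring
  rw [hsum, Matrix.det_mul, Matrix.det_mul, Matrix.det_mul, Matrix.det_diagonal]
  ring

end Gram

/-! ### Completions of a partial selection -/

section Completion

open Filter Topology

variable {d : ℕ}

/-- The total squared volume of all the subsets that arise from `I` by adding some of the `r`
indices `i, …, i + r - 1`. -/
noncomputable def completionVolume (x : ℕ → Fin d → ℝ) (w : ℕ → ℝ) : ℕ → ℕ → Finset ℕ → ℝ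
  | 0, _, I => subsetVolume x w I
  | r + 1, i, I => completionVolume x w r (i + 1) I + completionVolume x w r (i + 1) (insert i I)

theorem completionVolume_nonneg (x : ℕ → Fin d → ℝ) {w : ℕ → ℝ} (hw : ∀ j, 0 ≤ w j) (r i : ℕ)
    (I : Finset ℕ) : 0 ≤ completionVolume x w r i I := by
  induction r generalizing i I with
  | zero => exact subsetVolume_nonneg x hw I
  | succ r ih => exact add_nonneg (ih _ _) (ih _ _)

/-- The Gram matrix of the undecided indices `i, …, i + r - 1`, plus `t` times that of the selected
indices `I`.  For `t → ∞` its determinant and its inverse describe the selections that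
contain `I`. -/
noncomputable def tiltedGram (x : ℕ → Fin d → ℝ) (w : ℕ → ℝ) (r i : ℕ) (I : Finset ℕ) (t : ℝ) :
    Matrix (Fin d) (Fin d) ℝ :=
  gram x w (Finset.Ico i (i + r)) + t • gram x w I

theorem tiltedGram_isSymm (x : ℕ → Fin d → ℝ) (w : ℕ → ℝ) (r i : ℕ) (I : Finset ℕ) (t : ℝ) :
    (tiltedGram x w r i I t).IsSymm :=
  (gram_isSymm x w _).add ((gram_isSymm x w _).smul t)

theorem tiltedGram_succ (x : ℕ → Fin d → ℝ) (w : ℕ → ℝ) (r i : ℕ) (I : Finset ℕ) (t : ℝ) :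
    tiltedGram x w (r + 1) i I t =
      tiltedGram x w r (i + 1) I t + w i • Matrix.vecMulVec (x i) (x i) := by
  have : Finset.Ico i (i + (r + 1)) = insert i (Finset.Ico (i + 1) (i + 1 + r)) := by
    ext j; simp only [Finset.mem_Ico, Finset.mem_insert]; omega
  rw [tiltedGram, this, gram_insert _ _ (by simp), tiltedGram]
  abel

theorem tiltedGram_insert (x : ℕ → Fin d → ℝ) (w : ℕ → ℝ) (r i : ℕ) {I : Finset ℕ} (hi : i ∉ I)
    (t : ℝ) :
    tiltedGram x w r (i + 1) (insert i I) t =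
      tiltedGram x w r (i + 1) I t + t • (w i • Matrix.vecMulVec (x i) (x i)) := by
  rw [tiltedGram, gram_insert _ _ hi, tiltedGram, smul_add]
  abel

theorem det_tiltedGram_insert (x : ℕ → Fin d → ℝ) (w : ℕ → ℝ) (r i : ℕ) {I : Finset ℕ}
    (hi : i ∉ I) (t : ℝ) :
    (tiltedGram x w r (i + 1) (insert i I) t).det =
      t * (tiltedGram x w (r + 1) i I t).det + (1 - t) * (tiltedGram x w r (i + 1) I t).det := by
  rw [tiltedGram_insert x w r i hi, tiltedGram_succ, ← Matrix.smul_vecMulVec,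
    Matrix.det_add_smul_vecMulVec]

/-- The completion volumes are the leading coefficients of the determinants of the tilted Gram
matrices. -/
theorem tendsto_det_tiltedGram (x : ℕ → Fin d → ℝ) (w : ℕ → ℝ) (r i : ℕ) {I : Finset ℕ}
    (hI : ∀ j ∈ I, j < i) :
    Tendsto (fun t => (tiltedGram x w r i I t).det / t ^ I.card) atTop
      (𝓝 (completionVolume x w r i I)) := by
  induction r generalizing i I with
  | zero =>
    have h : ∀ t, (tiltedGram x w 0 i I t).det = t ^ d * (gram x w I).det := by
      intro t
      simp [tiltedGram, gram]
    simp only [h, completionVolume, subsetVolume]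
    rcases lt_trichotomy I.card d with hc | hc | hc
    · simp [det_gram_eq_zero x w hc, hc.ne]
    · rw [if_pos hc, hc]
      refine tendsto_const_nhds.congr' ?_
      filter_upwards [eventually_gt_atTop 0] with t ht
      field_simp
    · rw [if_neg hc.ne']
      have h0 : Tendsto (fun t : ℝ => (gram x w I).det * (t ^ (I.card - d))⁻¹) atTop
          (𝓝 ((gram x w I).det * 0)) :=
        (tendsto_inv_atTop_zero.comp (tendsto_pow_atTop (by omega))).const_mul _
      rw [mul_zero] at h0
      refine h0.congr' ?_
      filter_upwards [eventually_gt_atTop 0] with t ht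
      have : t ^ I.card = t ^ d * t ^ (I.card - d) := by rw [← pow_add]; congr 1; omega
      rw [this]
      field_simp
  | succ r ih =>
    have hi : i ∉ I := fun h => (hI i h).false
    have h1 := ih (i + 1) (I := I) fun j hj => (hI j hj).trans (Nat.lt_succ_self i)
    have h2 := ih (i + 1) (I := insert i I) fun j hj => by
      rcases Finset.mem_insert.1 hj with rfl | hj
      · exact Nat.lt_succ_self _
      · exact (hI j hj).trans (Nat.lt_succ_self i)
    rw [Finset.card_insert_of_notMem hi] at h2
    have h3 := h1.add (h2.sub (h1.mul tendsto_inv_atTop_zero))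
    rw [mul_zero, sub_zero] at h3
    refine h3.congr' ?_
    filter_upwards [eventually_gt_atTop 0] with t ht
    rw [det_tiltedGram_insert x w r i hi]
    field_simp
    ring

/-- The Cauchy–Binet formula. -/
theorem completionVolume_range (x : ℕ → Fin d → ℝ) (w : ℕ → ℝ) (k : ℕ) :
    completionVolume x w k 0 ∅ = (gram x w (Finset.range k)).det := by
  have h := tendsto_det_tiltedGram x w k 0 (I := ∅) (by simp)
  refine tendsto_nhds_unique h ?_
  have : ∀ t, (tiltedGram x w k 0 ∅ t).det / t ^ (∅ : Finset ℕ).card =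
      (gram x w (Finset.range k)).det := by
    intro t
    simp [tiltedGram, gram]
  simp only [this]
  exact tendsto_const_nhds

/-- `A` is the limit of the inverses of the tilted Gram matrices: the matrix through which the
conditional inclusion probabilities are computed. -/
def IsTiltedInverse (x : ℕ → Fin d → ℝ) (w : ℕ → ℝ) (r i : ℕ) (I : Finset ℕ)
    (A : Matrix (Fin d) (Fin d) ℝ) : Prop :=
  Tendsto (fun t => (tiltedGram x w r i I t)⁻¹) atTop (𝓝 A)

theorem isTiltedInverse_range (x : ℕ → Fin d → ℝ) (w : ℕ → ℝ) (k : ℕ) :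
    IsTiltedInverse x w k 0 ∅ (gram x w (Finset.range k))⁻¹ := by
  have : ∀ t, (tiltedGram x w k 0 ∅ t)⁻¹ = (gram x w (Finset.range k))⁻¹ := by
    intro t
    simp [tiltedGram, gram]
  simp only [IsTiltedInverse, this]
  exact tendsto_const_nhds

theorem IsTiltedInverse.isSymm {x : ℕ → Fin d → ℝ} {w : ℕ → ℝ} {r i : ℕ} {I : Finset ℕ}
    {A : Matrix (Fin d) (Fin d) ℝ} (h : IsTiltedInverse x w r i I A) : A.IsSymm := by
  have hc : Continuous fun M : Matrix (Fin d) (Fin d) ℝ => M.transpose :=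
    Continuous.matrix_transpose continuous_id
  refine tendsto_nhds_unique ((hc.tendsto A).comp h) ?_
  refine Tendsto.congr (fun t => ?_) h
  simp only [Function.comp]
  rw [Matrix.transpose_nonsing_inv, (tiltedGram_isSymm x w r i I t).eq]

theorem eventually_det_tiltedGram_ne_zero (x : ℕ → Fin d → ℝ) (w : ℕ → ℝ) (r i : ℕ) {I : Finset ℕ}
    (hI : ∀ j ∈ I, j < i) (hV : completionVolume x w r i I ≠ 0) :
    ∀ᶠ t in atTop, (tiltedGram x w r i I t).det ≠ 0 := by
  filter_upwards [(tendsto_det_tiltedGram x w r i hI).eventually_ne hV] with t ht h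
  exact ht (by rw [h, zero_div])

/-- The conditional inclusion probability of the index `i` is a quadratic form of the tilted
inverse. -/
theorem IsTiltedInverse.weight_mul_dotProduct {x : ℕ → Fin d → ℝ} {w : ℕ → ℝ} {r i : ℕ}
    {I : Finset ℕ} {A : Matrix (Fin d) (Fin d) ℝ} (h : IsTiltedInverse x w (r + 1) i I A)
    (hI : ∀ j ∈ I, j < i) (hV : completionVolume x w (r + 1) i I ≠ 0) :
    w i * (x i ⬝ᵥ (A *ᵥ x i)) =
      completionVolume x w r (i + 1) (insert i I) / completionVolume x w (r + 1) i I := by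
  have hI' : ∀ j ∈ I, j < i + 1 := fun j hj => (hI j hj).trans (Nat.lt_succ_self i)
  have hq : Continuous fun M : Matrix (Fin d) (Fin d) ℝ => w i * (x i ⬝ᵥ (M *ᵥ x i)) := by fun_prop
  -- Both sides are limits of `1 - det N' / det N`, where `N'` is the tilted Gram matrix `N` without
  -- the term of the index `i`.
  have h1 := (hq.tendsto A).comp h
  have h2 := (tendsto_det_tiltedGram x w r (i + 1) hI').div
    (tendsto_det_tiltedGram x w (r + 1) i hI) hV
  have h3 := (tendsto_const_nhds (x := (1 : ℝ))).sub h2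
  have h4 : (1 : ℝ) - completionVolume x w r (i + 1) I / completionVolume x w (r + 1) i I =
      completionVolume x w r (i + 1) (insert i I) / completionVolume x w (r + 1) i I := by
    rw [eq_div_iff hV, sub_mul, div_mul_cancel₀ _ hV, completionVolume]
    ring
  rw [← h4]
  refine tendsto_nhds_unique h1 (h3.congr' ?_)
  filter_upwards [eventually_det_tiltedGram_ne_zero x w (r + 1) i hI hV,
    eventually_gt_atTop 0] with t ht ht0
  have hinv := Matrix.nonsing_inv_mul (tiltedGram x w (r + 1) i I t) (isUnit_iff_ne_zero.2 ht)
  have hdet := Matrix.det_add_vecMulVec hinv (-(w i) • x i) (x i)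
  have hN : tiltedGram x w (r + 1) i I t + Matrix.vecMulVec (-(w i) • x i) (x i) =
      tiltedGram x w r (i + 1) I t := by
    rw [tiltedGram_succ, Matrix.smul_vecMulVec, neg_smul]
    abel
  rw [hN] at hdet
  simp only [Function.comp, Pi.div_apply]
  rw [hdet, Matrix.mulVec_smul, dotProduct_smul, smul_eq_mul]
  field_simp
  ring

/-- Update of the tilted inverse when the index `i` is selected. -/
theorem IsTiltedInverse.select {x : ℕ → Fin d → ℝ} {w : ℕ → ℝ} {r i : ℕ}
    {I : Finset ℕ} {A : Matrix (Fin d) (Fin d) ℝ} (h : IsTiltedInverse x w (r + 1) i I A)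
    (hI : ∀ j ∈ I, j < i) (hV : completionVolume x w (r + 1) i I ≠ 0)
    (hV' : completionVolume x w r (i + 1) (insert i I) ≠ 0) :
    IsTiltedInverse x w r (i + 1) (insert i I)
      (A - (x i ⬝ᵥ (A *ᵥ x i))⁻¹ • Matrix.vecMulVec (A *ᵥ x i) (x i ᵥ* A)) := by
  -- Selecting `i` raises the factor of `x i (x i)ᵀ` from `w i` to `t * w i`.
  have hi : i ∉ I := fun hh => (hI i hh).false
  have hp := h.weight_mul_dotProduct hI hV
  have hp0 : w i * (x i ⬝ᵥ (A *ᵥ x i)) ≠ 0 := by rw [hp]; exact div_ne_zero hV' hV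
  have hw0 : w i ≠ 0 := left_ne_zero_of_mul hp0
  have ha0 : x i ⬝ᵥ (A *ᵥ x i) ≠ 0 := right_ne_zero_of_mul hp0
  set G : ℝ → Matrix (Fin d) (Fin d) ℝ := fun t => (tiltedGram x w (r + 1) i I t)⁻¹ with hG
  have hq : Continuous fun M : Matrix (Fin d) (Fin d) ℝ => x i ⬝ᵥ (M *ᵥ x i) := by fun_prop
  have ha : Tendsto (fun t => x i ⬝ᵥ (G t *ᵥ x i)) atTop (𝓝 (x i ⬝ᵥ (A *ᵥ x i))) :=
    (hq.tendsto A).comp h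
  have hv : Continuous fun M : Matrix (Fin d) (Fin d) ℝ =>
      Matrix.vecMulVec (M *ᵥ x i) (x i ᵥ* M) := by fun_prop
  have hvv := (hv.tendsto A).comp h
  -- The coefficient `(t - 1) w / (1 + (t - 1) w a)` of the rank-one correction tends to `1 / a`.
  have hcoef : Tendsto (fun t : ℝ => (((t - 1) * w i)⁻¹ + x i ⬝ᵥ (G t *ᵥ x i))⁻¹) atTop
      (𝓝 (x i ⬝ᵥ (A *ᵥ x i))⁻¹) := by
    have h1 : Tendsto (fun t : ℝ => ((t - 1) * w i)⁻¹) atTop (𝓝 0) := by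
      have : Tendsto (fun t : ℝ => (t - 1)⁻¹ * (w i)⁻¹) atTop (𝓝 (0 * (w i)⁻¹)) :=
        (tendsto_inv_atTop_zero.comp (tendsto_atTop_add_const_right _ (-1) tendsto_id)).mul_const _
      simpa [mul_comm] using this
    have h2 := (h1.add ha).inv₀ (by simpa using ha0)
    simpa using h2
  refine (h.sub (hcoef.smul hvv)).congr' ?_
  filter_upwards [eventually_det_tiltedGram_ne_zero x w (r + 1) i hI hV,
    eventually_gt_atTop 1,
    (hcoef.eventually_ne (inv_ne_zero ha0))] with t ht ht1 hne
  have ht1' : (t - 1) * w i ≠ 0 := mul_ne_zero (sub_pos.2 ht1).ne' hw0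
  have hinv := Matrix.nonsing_inv_mul (tiltedGram x w (r + 1) i I t) (isUnit_iff_ne_zero.2 ht)
  have hden : 1 + x i ⬝ᵥ (G t *ᵥ (((t - 1) * w i) • x i)) =
      ((t - 1) * w i) * (((t - 1) * w i)⁻¹ + x i ⬝ᵥ (G t *ᵥ x i)) := by
    rw [Matrix.mulVec_smul, dotProduct_smul, smul_eq_mul, mul_add, mul_inv_cancel₀ ht1']
  have hSM := Matrix.shermanMorrison hinv (((t - 1) * w i) • x i) (x i) (by
    rw [hden]; exact mul_ne_zero ht1' fun h0 => hne (by rw [h0, inv_zero]))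
  have hN : tiltedGram x w (r + 1) i I t + Matrix.vecMulVec (((t - 1) * w i) • x i) (x i) =
      tiltedGram x w r (i + 1) (insert i I) t := by
    rw [tiltedGram_succ, tiltedGram_insert x w r i hi, Matrix.smul_vecMulVec, smul_smul, sub_mul,
      one_mul, sub_smul]
    abel
  rw [hN] at hSM
  rw [Matrix.inv_eq_left_inv hSM, hden, Matrix.mulVec_smul, Matrix.smul_vecMulVec, smul_smul,
    mul_inv_rev ((t - 1) * w i), mul_assoc, inv_mul_cancel₀ ht1', mul_one]
  rfl

/-- Update of the tilted inverse when the index `i` is not selected. -/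
theorem IsTiltedInverse.skip {x : ℕ → Fin d → ℝ} {w : ℕ → ℝ} {r i : ℕ}
    {I : Finset ℕ} {A : Matrix (Fin d) (Fin d) ℝ} (h : IsTiltedInverse x w (r + 1) i I A)
    (hI : ∀ j ∈ I, j < i) (hw : w i ≠ 0) (hV : completionVolume x w (r + 1) i I ≠ 0)
    (hV' : completionVolume x w r (i + 1) I ≠ 0) :
    IsTiltedInverse x w r (i + 1) I
      (A - (x i ⬝ᵥ (A *ᵥ x i) - (w i)⁻¹)⁻¹ • Matrix.vecMulVec (A *ᵥ x i) (x i ᵥ* A)) := by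
  have hp := h.weight_mul_dotProduct hI hV
  have hp1 : x i ⬝ᵥ (A *ᵥ x i) - (w i)⁻¹ ≠ 0 := by
    intro h0
    have : w i * (x i ⬝ᵥ (A *ᵥ x i)) = 1 := by
      rw [sub_eq_zero.1 h0, mul_inv_cancel₀ hw]
    rw [hp, div_eq_one_iff_eq hV, completionVolume] at this
    exact hV' (by linarith)
  set G : ℝ → Matrix (Fin d) (Fin d) ℝ := fun t => (tiltedGram x w (r + 1) i I t)⁻¹ with hG
  have hq : Continuous fun M : Matrix (Fin d) (Fin d) ℝ => x i ⬝ᵥ (M *ᵥ x i) := by fun_prop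
  have ha : Tendsto (fun t => x i ⬝ᵥ (G t *ᵥ x i)) atTop (𝓝 (x i ⬝ᵥ (A *ᵥ x i))) :=
    (hq.tendsto A).comp h
  have hv : Continuous fun M : Matrix (Fin d) (Fin d) ℝ =>
      Matrix.vecMulVec (M *ᵥ x i) (x i ᵥ* M) := by fun_prop
  have hvv := (hv.tendsto A).comp h
  have hcoef := (ha.sub_const (w i)⁻¹).inv₀ hp1
  refine (h.sub (hcoef.smul hvv)).congr' ?_
  filter_upwards [eventually_det_tiltedGram_ne_zero x w (r + 1) i hI hV,
    (hcoef.eventually_ne (inv_ne_zero hp1))] with t ht hne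
  have hinv := Matrix.nonsing_inv_mul (tiltedGram x w (r + 1) i I t) (isUnit_iff_ne_zero.2 ht)
  have hden : 1 + x i ⬝ᵥ (G t *ᵥ (-(w i) • x i)) =
      -(w i) * (x i ⬝ᵥ (G t *ᵥ x i) - (w i)⁻¹) := by
    rw [Matrix.mulVec_smul, dotProduct_smul, smul_eq_mul]
    field_simp
    ring
  have hSM := Matrix.shermanMorrison hinv (-(w i) • x i) (x i) (by
    rw [hden]; exact mul_ne_zero (neg_ne_zero.2 hw) fun h0 => hne (by rw [h0, inv_zero]))
  have hN : tiltedGram x w (r + 1) i I t + Matrix.vecMulVec (-(w i) • x i) (x i) =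
      tiltedGram x w r (i + 1) I t := by
    rw [tiltedGram_succ, Matrix.smul_vecMulVec, neg_smul]
    abel
  rw [hN] at hSM
  rw [Matrix.inv_eq_left_inv hSM, hden, Matrix.mulVec_smul, Matrix.smul_vecMulVec, smul_smul,
    mul_inv_rev, mul_assoc, inv_mul_cancel₀ (neg_ne_zero.2 hw), mul_one]
  rfl

end Completion

/-! ### Inversion by successive row replacement -/

section Inversion

variable {d : ℕ}

/-- The identity matrix with its first `q` rows replaced by those of `M`. -/
def mixRows (M : Matrix (Fin d) (Fin d) ℝ) (q : ℕ) : Matrix (Fin d) (Fin d) ℝ :=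
  Matrix.of fun i => if (i : ℕ) < q then M i else Pi.single i 1

theorem mixRows_zero (M : Matrix (Fin d) (Fin d) ℝ) : mixRows M 0 = 1 := by
  ext i j
  simp [mixRows, Matrix.one_apply, Pi.single_apply, eq_comm]

theorem mixRows_self (M : Matrix (Fin d) (Fin d) ℝ) : mixRows M d = M := by
  ext i j
  simp [mixRows]

theorem mixRows_succ (M : Matrix (Fin d) (Fin d) ℝ) (q : Fin d) :
    mixRows M (q + 1) =
      mixRows M q + Matrix.vecMulVec (Pi.single q 1) (M q - Pi.single q 1) := by
  ext i j
  rcases lt_trichotomy i q with h | rfl | h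
  · simp [mixRows, Matrix.vecMulVec_apply, h.ne, h, h.le]
  · simp [mixRows, Matrix.vecMulVec_apply]
  · simp [mixRows, Matrix.vecMulVec_apply, h.ne', not_le.2 h, h.asymm]

/-- For positive definite `M` no pivot vanishes: a vector `v` in the kernel satisfies `v i = 0` or
`(M v) i = 0` for each `i`, hence `vᵀ M v = 0`. -/
theorem det_mixRows_ne_zero {M : Matrix (Fin d) (Fin d) ℝ} (hM : M.PosDef) (q : ℕ) :
    (mixRows M q).det ≠ 0 := by
  intro h0
  obtain ⟨v, hv, hv0⟩ := Matrix.exists_mulVec_eq_zero_iff.2 h0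
  have h1 : ∀ i : Fin d, v i * (M *ᵥ v) i = 0 := by
    intro i
    have := congrFun hv0 i
    by_cases hi : (i : ℕ) < q
    · have h2 : (mixRows M q *ᵥ v) i = (M *ᵥ v) i := by
        simp [mixRows, Matrix.mulVec, hi]
      rw [← h2, this]; simp
    · have h2 : (mixRows M q *ᵥ v) i = v i := by
        simp [mixRows, Matrix.mulVec, hi]
      rw [← h2, this]; simp
  have h3 := hM.dotProduct_mulVec_pos hv
  simp only [star_trivial, dotProduct, h1, Finset.sum_const_zero, lt_self_iff_false] at h3

/-- State of the inversion of `M` after `q` row replacements: `G` is the inverse of the current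
matrix and `p` its determinant, unless a pivot vanished, in which case `M` is singular. -/
def IsPartialInverse (M : Matrix (Fin d) (Fin d) ℝ) (q : ℕ) (G : Matrix (Fin d) (Fin d) ℝ)
    (p : ℝ) : Prop :=
  (p ≠ 0 ∧ G * mixRows M q = 1 ∧ p = (mixRows M q).det) ∨ (p = 0 ∧ M.det = 0)

theorem isPartialInverse_zero (M : Matrix (Fin d) (Fin d) ℝ) : IsPartialInverse M 0 1 1 := by
  left
  simp [mixRows_zero]

/-- The replacement of row `q` is a rank-one change with pivot `(M q - e_q)ᵀ G e_q + 1`. -/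
theorem IsPartialInverse.step {M G : Matrix (Fin d) (Fin d) ℝ} {p : ℝ} (hM : M.PosSemidef)
    (q : Fin d) (h : IsPartialInverse M q G p) :
    IsPartialInverse M (q + 1)
      (G - (((M q - Pi.single q 1) ᵥ* G) q + 1)⁻¹ •
        Matrix.vecMulVec (fun i => G i q) ((M q - Pi.single q 1) ᵥ* G))
      (p * (((M q - Pi.single q 1) ᵥ* G) q + 1)) := by
  rcases h with ⟨hp, hG, hdet⟩ | ⟨hp, h0⟩
  · have hcol : G *ᵥ (Pi.single q 1) = fun i => G i q := by
      ext i; simp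
    have hs : (M q - Pi.single q 1) ⬝ᵥ (G *ᵥ Pi.single q 1) =
        ((M q - Pi.single q 1) ᵥ* G) q := by
      rw [Matrix.dotProduct_mulVec]; simp
    have hd := Matrix.det_add_vecMulVec hG (Pi.single q 1) (M q - Pi.single q 1)
    rw [← mixRows_succ, hs, ← hdet, add_comm 1] at hd
    by_cases hz : ((M q - Pi.single q 1) ᵥ* G) q + 1 = 0
    · right
      refine ⟨by rw [hz, mul_zero], ?_⟩
      by_contra hne
      have hPD : M.PosDef := hM.posDef_iff_isUnit.2
        ((Matrix.isUnit_iff_isUnit_det _).2 (isUnit_iff_ne_zero.2 hne))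
      exact det_mixRows_ne_zero hPD (q + 1) (by rw [hd, hz, mul_zero])
    · left
      refine ⟨mul_ne_zero hp hz, ?_, hd.symm⟩
      have := Matrix.shermanMorrison hG (Pi.single q 1) (M q - Pi.single q 1)
        (by rw [hs, add_comm]; exact hz)
      rwa [← mixRows_succ, hs, hcol, add_comm 1] at this
  · right
    exact ⟨by rw [hp, zero_mul], h0⟩

theorem IsPartialInverse.det_eq {M G : Matrix (Fin d) (Fin d) ℝ} {p : ℝ}
    (h : IsPartialInverse M d G p) : p = M.det := by
  rcases h with ⟨-, -, h⟩ | ⟨h, h'⟩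
  · rwa [mixRows_self] at h
  · rw [h, h']

theorem IsPartialInverse.eq_inv {M G : Matrix (Fin d) (Fin d) ℝ} {p : ℝ}
    (h : IsPartialInverse M d G p) (hM : M.det ≠ 0) : G = M⁻¹ := by
  rcases h with ⟨-, h, -⟩ | ⟨-, h'⟩
  · rw [mixRows_self] at h
    exact (Matrix.inv_eq_left_inv h).symm
  · exact absurd h' hM

end Inversion

/-! ### Sequential selection of a subset -/

section Selection

variable {d : ℕ}

open Classical in
/-- The set of indices below `i` selected when each index `i < k` is included if the number `u i`
is below the conditional probability of its inclusion. -/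
noncomputable def selection (x : ℕ → Fin d → ℝ) (w u : ℕ → ℝ) (k : ℕ) : ℕ → Finset ℕ
  | 0 => ∅
  | i + 1 =>
    if u i * completionVolume x w (k - i) i (selection x w u k i) <
        completionVolume x w (k - i - 1) (i + 1) (insert i (selection x w u k i))
    then insert i (selection x w u k i) else selection x w u k i

theorem lt_of_mem_selection (x : ℕ → Fin d → ℝ) (w u : ℕ → ℝ) (k i : ℕ) :
    ∀ j ∈ selection x w u k i, j < i := by
  induction i with
  | zero => simp [selection]
  | succ i ih =>
    intro j hj
    rw [selection] at hj
    split_ifs at hj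
    · rcases Finset.mem_insert.1 hj with rfl | hj
      · exact Nat.lt_succ_self _
      · exact (ih j hj).trans (Nat.lt_succ_self i)
    · exact (ih j hj).trans (Nat.lt_succ_self i)

/-- Since the numbers `u j` lie in `[0, 1)`, no decision of probability zero is ever taken. -/
theorem completionVolume_selection_ne_zero (x : ℕ → Fin d → ℝ) {w u : ℕ → ℝ} (k : ℕ)
    (hw : ∀ j, 0 ≤ w j) (hu0 : ∀ j < k, 0 ≤ u j) (hu1 : ∀ j < k, u j < 1)
    (hV : completionVolume x w k 0 ∅ ≠ 0) {i : ℕ} (hi : i ≤ k) :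
    completionVolume x w (k - i) i (selection x w u k i) ≠ 0 := by
  induction i with
  | zero => simpa [selection] using hV
  | succ i ih =>
    have ih := ih (by omega)
    have hpos := (completionVolume_nonneg x hw (k - i) i (selection x w u k i)).lt_of_ne' ih
    rw [selection]
    split_ifs with h
    · exact ((mul_nonneg (hu0 i hi) hpos.le).trans_lt h).ne'
    · intro h0
      have hr : k - i = (k - (i + 1)) + 1 := by omega
      have : completionVolume x w (k - i) i (selection x w u k i) =
          completionVolume x w (k - i - 1) (i + 1) (insert i (selection x w u k i)) := by
        conv_lhs => rw [hr, completionVolume, h0, zero_add]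
        rw [Nat.sub_sub]
      rw [← this, not_lt] at h
      have := hu1 i hi
      nlinarith

/-- One step of the sequential selection, carried out through the tilted inverse: in time `O(d²)`
rather than through the completion volumes, which are sums over exponentially many subsets. -/
theorem IsTiltedInverse.selection_step (x : ℕ → Fin d → ℝ) {w u : ℕ → ℝ} (k : ℕ)
    (hw : ∀ j < k, 0 < w j) (hw0 : ∀ j, 0 ≤ w j) (hu0 : ∀ j < k, 0 ≤ u j) (hu1 : ∀ j < k, u j < 1)
    (hV : completionVolume x w k 0 ∅ ≠ 0) {i : ℕ} (hi : i < k) {A : Matrix (Fin d) (Fin d) ℝ}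
    (h : IsTiltedInverse x w (k - i) i (selection x w u k i) A) :
    (u i * (w i)⁻¹ < (x i ᵥ* A) ⬝ᵥ x i →
      selection x w u k (i + 1) = insert i (selection x w u k i) ∧
      IsTiltedInverse x w (k - (i + 1)) (i + 1) (selection x w u k (i + 1))
        (A - ((x i ᵥ* A) ⬝ᵥ x i)⁻¹ • Matrix.vecMulVec (x i ᵥ* A) (x i ᵥ* A))) ∧
    (¬ u i * (w i)⁻¹ < (x i ᵥ* A) ⬝ᵥ x i →
      selection x w u k (i + 1) = selection x w u k i ∧
      IsTiltedInverse x w (k - (i + 1)) (i + 1) (selection x w u k (i + 1))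
        (A - ((x i ᵥ* A) ⬝ᵥ x i - (w i)⁻¹)⁻¹ • Matrix.vecMulVec (x i ᵥ* A) (x i ᵥ* A))) := by
  have hsel := lt_of_mem_selection x w u k i
  have hVi := completionVolume_selection_ne_zero x k hw0 hu0 hu1 hV hi.le
  have hVi' := completionVolume_selection_ne_zero x k hw0 hu0 hu1 hV (i := i + 1) hi
  have hpos := (completionVolume_nonneg x hw0 (k - i) i (selection x w u k i)).lt_of_ne' hVi
  have hsymm : A *ᵥ x i = x i ᵥ* A := by
    rw [← Matrix.vecMul_transpose, h.isSymm.eq]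
  have hr : k - i = (k - (i + 1)) + 1 := by omega
  have hr' : k - i - 1 = k - (i + 1) := by omega
  rw [hr] at h
  have hprob := h.weight_mul_dotProduct hsel (by rwa [← hr])
  rw [← hr] at hprob
  rw [Matrix.dotProduct_mulVec] at hprob
  have hwi := hw i hi
  have htest : u i * (w i)⁻¹ < (x i ᵥ* A) ⬝ᵥ x i ↔
      u i * completionVolume x w (k - i) i (selection x w u k i) <
        completionVolume x w (k - i - 1) (i + 1) (insert i (selection x w u k i)) := by
    rw [hr', ← lt_div_iff₀ hpos, ← hprob, ← div_eq_mul_inv, div_lt_iff₀ hwi, mul_comm (w i)]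
  rw [htest]
  constructor
  · intro ht
    have hs : selection x w u k (i + 1) = insert i (selection x w u k i) := by
      rw [selection, if_pos ht]
    refine ⟨hs, ?_⟩
    rw [hs] at hVi' ⊢
    have := h.select hsel (by rwa [← hr]) hVi'
    rwa [hsymm, dotProduct_comm] at this
  · intro ht
    have hs : selection x w u k (i + 1) = selection x w u k i := by
      rw [selection, if_neg ht]
    refine ⟨hs, ?_⟩
    rw [hs] at hVi' ⊢
    have := h.skip hsel hwi.ne' (by rwa [← hr]) hVi'
    rwa [hsymm, dotProduct_comm] at this

/-- The sequential selection produces `J` if and only if each single decision agrees with `J`. -/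
theorem selection_eq_iff (x : ℕ → Fin d → ℝ) (w u : ℕ → ℝ) (k : ℕ) {J : Finset ℕ}
    (hJ : ∀ j ∈ J, j < k) :
    selection x w u k k = J ↔ ∀ i < k, (u i * completionVolume x w (k - i) i (J.filter (· < i)) <
        completionVolume x w (k - i - 1) (i + 1) (insert i (J.filter (· < i))) ↔ i ∈ J) := by
  have hfilter : ∀ i, J.filter (· < i + 1) =
      if i ∈ J then insert i (J.filter (· < i)) else J.filter (· < i) := by
    intro i
    ext j
    split_ifs with h
    · simp only [Finset.mem_filter, Finset.mem_insert, Nat.lt_succ_iff_lt_or_eq]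
      constructor
      · rintro ⟨h1, h2 | h2⟩ <;> simp [*]
      · rintro (rfl | ⟨h1, h2⟩) <;> simp [*]
    · simp only [Finset.mem_filter, Nat.lt_succ_iff_lt_or_eq]
      constructor
      · rintro ⟨h1, h2 | rfl⟩
        · exact ⟨h1, h2⟩
        · exact absurd h1 h
      · rintro ⟨h1, h2⟩
        exact ⟨h1, Or.inl h2⟩
  have hmono : ∀ i n, (selection x w u k (i + n)).filter (· < i) = selection x w u k i := by
    intro i n
    induction n with
    | zero => exact Finset.filter_true_of_mem (lt_of_mem_selection x w u k i)
    | succ n ih =>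
      rw [← ih, ← add_assoc, selection]
      split_ifs
      · rw [Finset.filter_insert, if_neg (by omega)]
      · rfl
  constructor
  · rintro rfl i hi
    have h1 : (selection x w u k k).filter (· < i) = selection x w u k i := by
      have := hmono i (k - i)
      rwa [Nat.add_sub_of_le hi.le] at this
    have h2 : (selection x w u k k).filter (· < i + 1) = selection x w u k (i + 1) := by
      have := hmono (i + 1) (k - (i + 1))
      rwa [Nat.add_sub_of_le hi] at this
    have h3 : i ∈ selection x w u k k ↔ i ∈ selection x w u k (i + 1) := by
      rw [← h2, Finset.mem_filter]; simp
    have hi' : i ∉ selection x w u k i := fun h => (lt_of_mem_selection x w u k i i h).false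
    rw [h1, h3, selection]
    split_ifs with h
    · simp [h]
    · simp [h, hi']
  · intro h
    have key : ∀ i ≤ k, selection x w u k i = J.filter (· < i) := by
      intro i
      induction i with
      | zero => simp [selection]
      | succ i ih =>
        intro hi
        have ih := ih (by omega)
        rw [selection, ih, hfilter]
        have := h i hi
        by_cases hiJ : i ∈ J
        · rw [if_pos hiJ, if_pos (this.2 hiJ)]
        · rw [if_neg hiJ, if_neg (fun h' => hiJ (this.1 h'))]
    rw [key k le_rfl]
    exact Finset.filter_true_of_mem hJ

/-- The conditional probability that the sequential selection includes the index `i`, given that it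
agrees with `J` on all smaller indices. -/
noncomputable def stepProbability (x : ℕ → Fin d → ℝ) (w : ℕ → ℝ) (k : ℕ) (J : Finset ℕ)
    (i : ℕ) : ℝ :=
  completionVolume x w (k - i - 1) (i + 1) (insert i (J.filter (· < i))) /
    completionVolume x w (k - i) i (J.filter (· < i))

theorem stepProbability_nonneg (x : ℕ → Fin d → ℝ) {w : ℕ → ℝ} (hw : ∀ j, 0 ≤ w j) (k : ℕ)
    (J : Finset ℕ) (i : ℕ) : 0 ≤ stepProbability x w k J i :=
  div_nonneg (completionVolume_nonneg x hw _ _ _) (completionVolume_nonneg x hw _ _ _)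

theorem stepProbability_le_one (x : ℕ → Fin d → ℝ) {w : ℕ → ℝ} (hw : ∀ j, 0 ≤ w j) {k : ℕ}
    (J : Finset ℕ) {i : ℕ} (hi : i < k) : stepProbability x w k J i ≤ 1 := by
  refine div_le_one_of_le₀ ?_ (completionVolume_nonneg x hw _ _ _)
  have hr : k - i = (k - i - 1) + 1 := by omega
  conv_rhs => rw [hr, completionVolume]
  exact le_add_of_nonneg_left (completionVolume_nonneg x hw _ _ _)

/-- The decision probabilities telescope: the sequential selection produces `J` with probability
proportional to its squared volume. -/
theorem completionVolume_mul_prod_stepProbability (x : ℕ → Fin d → ℝ) {w : ℕ → ℝ}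
    (hw : ∀ j, 0 ≤ w j) (k : ℕ) {J : Finset ℕ} (hJ : ∀ j ∈ J, j < k) :
    completionVolume x w k 0 ∅ * ∏ i ∈ Finset.range k,
      (if i ∈ J then stepProbability x w k J i else 1 - stepProbability x w k J i) =
      subsetVolume x w J := by
  have key : ∀ m ≤ k, completionVolume x w k 0 ∅ * ∏ i ∈ Finset.range m,
      (if i ∈ J then stepProbability x w k J i else 1 - stepProbability x w k J i) =
      completionVolume x w (k - m) m (J.filter (· < m)) := by
    intro m
    induction m with
    | zero => simp
    | succ m ih =>
      intro hm
      rw [Finset.prod_range_succ, ← mul_assoc, ih (by omega), stepProbability]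
      have hr : k - m = (k - m - 1) + 1 := by omega
      have hr' : k - (m + 1) = k - m - 1 := by omega
      have hsum : completionVolume x w (k - m) m (J.filter (· < m)) =
          completionVolume x w (k - m - 1) (m + 1) (J.filter (· < m)) +
          completionVolume x w (k - m - 1) (m + 1) (insert m (J.filter (· < m))) := by
        conv_lhs => rw [hr, completionVolume]
      have hf : J.filter (· < m + 1) =
          if m ∈ J then insert m (J.filter (· < m)) else J.filter (· < m) := by
        ext j
        split_ifs with h <;>
        simp only [Finset.mem_filter, Finset.mem_insert, Nat.lt_succ_iff_lt_or_eq] <;>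
        grind
      have h1 := completionVolume_nonneg x hw (k - m - 1) (m + 1) (J.filter (· < m))
      have h2 := completionVolume_nonneg x hw (k - m - 1) (m + 1) (insert m (J.filter (· < m)))
      rw [hr', hf]
      by_cases hV : completionVolume x w (k - m) m (J.filter (· < m)) = 0
      · rw [hV, zero_mul]
        rw [hV] at hsum
        split_ifs <;> linarith
      · split_ifs
        · rw [mul_div_cancel₀ _ hV]
        · rw [mul_sub, mul_div_cancel₀ _ hV, hsum]; ring
  have := key k le_rfl
  rw [this, Nat.sub_self, completionVolume, Finset.filter_true_of_mem hJ]

end Selection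

/-! ### Hoare logic with time bounds for the real RAM -/

namespace RealRAM

/-- The state `s` with its clock set to `τ`. -/
def State.at (s : State) (τ : ℕ) : State := { s with time := τ }

@[simp] theorem State.at_idx (s : State) (τ : ℕ) : (s.at τ).idx = s.idx := rfl

@[simp] theorem State.at_mat (s : State) (τ : ℕ) : (s.at τ).mat = s.mat := rfl

@[simp] theorem IdxExpr.eval_at (s : State) (τ : ℕ) (a : IdxExpr) : a.eval (s.at τ) = a.eval s := by
  induction a <;> simp [IdxExpr.eval, *]

@[simp] theorem RealExpr.eval_at (s : State) (τ : ℕ) (a : RealExpr) :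
    a.eval (s.at τ) = a.eval s := by
  induction a <;> simp [RealExpr.eval, *]

@[simp] theorem Test.holds_at (s : State) (τ : ℕ) (p : Test) : p.holds (s.at τ) ↔ p.holds s := by
  induction p <;> simp [Test.holds, *]

variable {d : ℕ} {xs : ℕ → Fin d → ℝ} {us : ℕ → ℝ}

/-- `c`, started in the memory of `s` at any time, terminates within `T` units of time in a state
that satisfies `Q`.  The clocks of `s` and of the states passed to `Q` carry no information. -/
def Runs (xs : ℕ → Fin d → ℝ) (us : ℕ → ℝ) (c : Cmd) (T : ℕ) (s : State) (Q : State → Prop) :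
    Prop :=
  ∀ τ, ∃ s' t, t ≤ T ∧ Exec xs us c (s.at τ) (s'.at (τ + t)) ∧ Q s'

theorem Runs.mono {c : Cmd} {T T' : ℕ} {s : State} {Q Q' : State → Prop}
    (h : Runs xs us c T s Q) (hT : T ≤ T') (hQ : ∀ s', Q s' → Q' s') : Runs xs us c T' s Q' := by
  intro τ
  obtain ⟨s', t, ht, he, hq⟩ := h τ
  exact ⟨s', t, ht.trans hT, he, hQ s' hq⟩

theorem Runs.mono_time {c : Cmd} {T T' : ℕ} {s : State} {Q : State → Prop}
    (h : Runs xs us c T s Q) (hT : T ≤ T') : Runs xs us c T' s Q :=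
  h.mono hT fun _ h => h

theorem Runs.seq {c₁ c₂ : Cmd} {T₁ T₂ : ℕ} {s : State} {Q R : State → Prop}
    (h₁ : Runs xs us c₁ T₁ s Q) (h₂ : ∀ s', Q s' → Runs xs us c₂ T₂ s' R) :
    Runs xs us (.seq c₁ c₂) (T₁ + T₂) s R := by
  intro τ
  obtain ⟨s', t, ht, he, hq⟩ := h₁ τ
  obtain ⟨s'', t', ht', he', hr⟩ := h₂ s' hq (τ + t)
  refine ⟨s'', t + t', add_le_add ht ht', .seq he ?_, hr⟩
  rwa [← add_assoc]

theorem runs_skip {s : State} {Q : State → Prop} (h : Q s) : Runs xs us .skip 1 s Q :=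
  fun _ => ⟨s, 1, le_rfl, .skip _, h⟩

theorem runs_setIdx {v : ℕ} {a : IdxExpr} {s : State} {Q : State → Prop}
    (h : Q (s.writeIdx v (a.eval s))) : Runs xs us (.setIdx v a) (a.cost + 1) s Q := by
  intro τ
  refine ⟨_, _, le_rfl, ?_, h⟩
  have := Exec.setIdx (xs := xs) (us := us) v a (s.at τ)
  rw [IdxExpr.eval_at] at this
  exact this

theorem runs_setReal {m : ℕ} {i j : IdxExpr} {a : RealExpr} {s : State} {Q : State → Prop}
    (h : Q (s.writeReal m (i.eval s) (j.eval s) (a.eval s))) :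
    Runs xs us (.setReal m i j a) (i.cost + j.cost + a.cost + 1) s Q := by
  intro τ
  refine ⟨_, _, le_rfl, ?_, h⟩
  have := Exec.setReal (xs := xs) (us := us) m i j a (s.at τ)
  rw [IdxExpr.eval_at, IdxExpr.eval_at, RealExpr.eval_at] at this
  exact this

theorem runs_drawUniform {m : ℕ} {i j : IdxExpr} {s : State} {Q : State → Prop}
    (h : Q { s.writeReal m (i.eval s) (j.eval s) (us s.uniforms) with
      uniforms := s.uniforms + 1 }) :
    Runs xs us (.drawUniform m i j) (i.cost + j.cost + 1) s Q := by
  intro τ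
  refine ⟨_, _, le_rfl, ?_, h⟩
  have := Exec.drawUniform (xs := xs) (us := us) m i j (s.at τ)
  rw [IdxExpr.eval_at, IdxExpr.eval_at] at this
  exact this

theorem runs_drawSample {m : ℕ} {i : IdxExpr} {s : State} {Q : State → Prop}
    (h : Q { s.writeRow m (i.eval s) (xs s.samples) with samples := s.samples + 1 }) :
    Runs xs us (.drawSample m i) (i.cost + d + 1) s Q := by
  intro τ
  refine ⟨_, _, le_rfl, ?_, h⟩
  have := Exec.drawSample (xs := xs) (us := us) m i (s.at τ)
  rw [IdxExpr.eval_at] at this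
  exact this

theorem runs_branch {p : Test} {c₁ c₂ : Cmd} {T : ℕ} {s : State} {Q : State → Prop}
    (h₁ : p.holds s → Runs xs us c₁ T s Q) (h₂ : ¬ p.holds s → Runs xs us c₂ T s Q) :
    Runs xs us (.branch p c₁ c₂) (p.cost + 1 + T) s Q := by
  intro τ
  by_cases hp : p.holds s
  · obtain ⟨s', t, ht, he, hq⟩ := h₁ hp (τ + (p.cost + 1))
    refine ⟨s', p.cost + 1 + t, Nat.add_le_add_left ht _, .branchTrue (by simpa using hp) ?_, hq⟩
    rwa [← add_assoc]
  · obtain ⟨s', t, ht, he, hq⟩ := h₂ hp (τ + (p.cost + 1))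
    refine ⟨s', p.cost + 1 + t, Nat.add_le_add_left ht _, .branchFalse (by simpa using hp) ?_, hq⟩
    rwa [← add_assoc]

/-- The counted loop `for v < b do c`. -/
def Cmd.forLoop (v : ℕ) (b : IdxExpr) (c : Cmd) : Cmd :=
  .seq (.setIdx v (.const 0))
    (.loop (.idxLt (.var v) b) (.seq c (.setIdx v (.add (.var v) (.const 1)))))

/-- The invariant rule for counted loops: `I i` holds when the counter has just reached `i`. -/
theorem runs_forLoop {v n T : ℕ} {b : IdxExpr} {c : Cmd} {s : State} (I : ℕ → State → Prop)
    (hn : ∀ i s', I i s' → b.eval s' = n) (hv : ∀ i s', I i s' → s'.idx v = i)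
    (h0 : I 0 (s.writeIdx v 0))
    (hstep : ∀ i s', i < n → I i s' →
      Runs xs us c T s' fun s'' => s''.idx v = i ∧ I (i + 1) (s''.writeIdx v (i + 1))) :
    Runs xs us (.forLoop v b c) (n * (T + b.cost + 7) + b.cost + 5) s (I n) := by
  have hloop : ∀ r i s', i + r = n → I i s' →
      Runs xs us (.loop (.idxLt (.var v) b) (.seq c (.setIdx v (.add (.var v) (.const 1)))))
        (r * (T + b.cost + 7) + b.cost + 3) s' (I n) := by
    intro r
    induction r with
    | zero =>
      intro i s' hi hI τ
      have hi : i = n := hi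
      have hnot : ¬ (Test.idxLt (.var v) b).holds (s'.at τ) := by
        simp [Test.holds, IdxExpr.eval, hn i s' hI, hv i s' hI, hi]
      refine ⟨s', _, ?_, .loopStop hnot, hi ▸ hI⟩
      simp only [Test.cost, IdxExpr.cost]
      omega
    | succ r ih =>
      intro i s' hi hI τ
      have hp : (Test.idxLt (.var v) b).holds (s'.at τ) := by
        simp only [Test.holds, IdxExpr.eval_at, IdxExpr.eval, State.at_idx, hn i s' hI, hv i s' hI]
        omega
      have hbody : Runs xs us (.seq c (.setIdx v (.add (.var v) (.const 1)))) (T + 4) s'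
          (I (i + 1)) :=
        (hstep i s' (by omega) hI).seq fun s'' ⟨h1, h2⟩ =>
          runs_setIdx (by simpa [IdxExpr.eval, h1] using h2)
      obtain ⟨s₁, t₁, ht₁, he₁, hI₁⟩ := hbody (τ + (Test.idxLt (.var v) b).cost + 1)
      obtain ⟨s₂, t₂, ht₂, he₂, hI₂⟩ := ih (i + 1) s₁ (by omega) hI₁
        (τ + (Test.idxLt (.var v) b).cost + 1 + t₁)
      refine ⟨s₂, (Test.idxLt (.var v) b).cost + 1 + t₁ + t₂, ?_, .loopStep hp he₁ ?_, hI₂⟩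
      · simp only [Test.cost, IdxExpr.cost]
        rw [Nat.succ_mul]
        omega
      · convert he₂ using 2
        omega
  refine ((runs_setIdx (Q := I 0) (by simpa [IdxExpr.eval] using h0)).seq fun s' hI =>
    hloop n 0 s' (Nat.zero_add n) hI).mono ?_ fun _ h => h
  simp only [IdxExpr.cost]
  omega

@[simp] theorem State.writeIdx_idx_self (s : State) (v n : ℕ) : (s.writeIdx v n).idx v = n := by
  simp [State.writeIdx]

theorem State.writeIdx_idx_of_ne (s : State) {v v' : ℕ} (n : ℕ) (h : v' ≠ v) :
    (s.writeIdx v n).idx v' = s.idx v' := by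
  simp [State.writeIdx, h]

@[simp] theorem State.writeIdx_mat (s : State) (v n : ℕ) : (s.writeIdx v n).mat = s.mat := rfl
@[simp] theorem State.writeIdx_samples (s : State) (v n : ℕ) :
    (s.writeIdx v n).samples = s.samples := rfl
@[simp] theorem State.writeIdx_uniforms (s : State) (v n : ℕ) :
    (s.writeIdx v n).uniforms = s.uniforms := rfl
@[simp] theorem State.writeReal_idx (s : State) (m i j : ℕ) (r : ℝ) :
    (s.writeReal m i j r).idx = s.idx := rfl

theorem State.writeReal_mat_of_ne (s : State) {m m' : ℕ} (i j : ℕ) (r : ℝ) (h : m' ≠ m) :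
    (s.writeReal m i j r).mat m' = s.mat m' := by
  ext a b; simp [State.writeReal, h]

theorem State.writeReal_mat_self (s : State) (m i j a b : ℕ) (r : ℝ) :
    (s.writeReal m i j r).mat m a b = if a = i ∧ b = j then r else s.mat m a b := by
  simp [State.writeReal]

/-- The states `s` and `s'` differ at most in the variables `V`, the matrices `M` and the clock. -/
structure Agree (V M : List ℕ) (s s' : State) : Prop where
  idx : ∀ v, v ∉ V → s'.idx v = s.idx v
  mat : ∀ m, m ∉ M → s'.mat m = s.mat m
  samples : s'.samples = s.samples
  uniforms : s'.uniforms = s.uniforms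

theorem Agree.refl (V M : List ℕ) (s : State) : Agree V M s s :=
  ⟨fun _ _ => rfl, fun _ _ => rfl, rfl, rfl⟩

theorem Agree.trans {V M : List ℕ} {s s' s'' : State} (h : Agree V M s s')
    (h' : Agree V M s' s'') : Agree V M s s'' :=
  ⟨fun v hv => (h'.idx v hv).trans (h.idx v hv), fun m hm => (h'.mat m hm).trans (h.mat m hm),
    h'.samples.trans h.samples, h'.uniforms.trans h.uniforms⟩

theorem Agree.mono {V V' M M' : List ℕ} {s s' : State} (h : Agree V M s s') (hV : V ⊆ V')
    (hM : M ⊆ M') : Agree V' M' s s' :=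
  ⟨fun v hv => h.idx v fun h => hv (hV h), fun m hm => h.mat m fun h => hm (hM h),
    h.samples, h.uniforms⟩

theorem Agree.writeIdx {V M : List ℕ} {s s' : State} (h : Agree V M s s') {v : ℕ} (hv : v ∈ V)
    (n : ℕ) : Agree V M s (s'.writeIdx v n) :=
  ⟨fun v' hv' => (State.writeIdx_idx_of_ne _ _ fun e => hv' (by rwa [e])).trans (h.idx v' hv'), h.mat,
    h.samples, h.uniforms⟩

theorem Agree.writeReal {V M : List ℕ} {s s' : State} (h : Agree V M s s') {m : ℕ} (hm : m ∈ M)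
    (i j : ℕ) (r : ℝ) : Agree V M s (s'.writeReal m i j r) :=
  ⟨h.idx, fun m' hm' => (State.writeReal_mat_of_ne _ _ _ _ fun e => hm' (by rwa [e])).trans
    (h.mat m' hm'), h.samples, h.uniforms⟩

/-! ### Vector and matrix routines -/

/-- The first `d` entries of row `i` of matrix `m`. -/
def State.row (d : ℕ) (s : State) (m i : ℕ) : Fin d → ℝ := fun j => s.mat m i j

/-- The upper left `d × d` block of matrix `m`. -/
def State.block (d : ℕ) (s : State) (m : ℕ) : Matrix (Fin d) (Fin d) ℝ :=
  Matrix.of fun i j => s.mat m i j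

theorem State.row_writeIdx (s : State) (v n m i : ℕ) :
    (s.writeIdx v n).row d m i = s.row d m i := rfl

theorem State.block_writeIdx (s : State) (v n m : ℕ) :
    (s.writeIdx v n).block d m = s.block d m := rfl

theorem Agree.row_eq {V M : List ℕ} {s s' : State} (h : Agree V M s s') {m : ℕ} (hm : m ∉ M)
    (i : ℕ) : s'.row d m i = s.row d m i := by
  ext j; simp [State.row, h.mat m hm]

theorem Agree.block_eq {V M : List ℕ} {s s' : State} (h : Agree V M s s') {m : ℕ} (hm : m ∉ M) :
    s'.block d m = s.block d m := by
  ext i j; simp [State.block, h.mat m hm]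

/-- Set the first `d` entries of row `r` of matrix `m`, with the index in variable `j`, to `e`. -/
def Cmd.fillRow (j m : ℕ) (r : IdxExpr) (e : RealExpr) : Cmd :=
  .forLoop j (.var 0) (.setReal m r (.var j) e)

theorem runs_fillRow {j m R : ℕ} {r : IdxExpr} {e : RealExpr} {s : State} (f : Fin d → ℝ)
    (hd : s.idx 0 = d) (hj : j ≠ 0)
    (hr : ∀ s', Agree [j] [m] s s' → r.eval s' = R)
    (he : ∀ s' (b : Fin d), Agree [j] [m] s s' → s'.idx j = b → s'.mat m R b = s.mat m R b →
      e.eval s' = f b) :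
    Runs xs us (.fillRow j m r e) (d * (r.cost + e.cost + 10) + 6) s fun s' =>
      Agree [j] [m] s s' ∧ s'.row d m R = f ∧
      ∀ a b, (a ≠ R ∨ d ≤ b) → s'.mat m a b = s.mat m a b := by
  refine (runs_forLoop (n := d) (fun i s' => Agree [j] [m] s s' ∧ s'.idx j = i ∧
    (∀ b : Fin d, (b : ℕ) < i → s'.mat m R b = f b) ∧
    ∀ a b, (a ≠ R ∨ d ≤ b ∨ i ≤ b) → s'.mat m a b = s.mat m a b)
    (fun i s' h => ?_) (fun i s' h => h.2.1) ?_ fun i s' hi ⟨hA, hij, h1, h2⟩ => ?_).mono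
    (T := d * ((r.cost + (IdxExpr.var j).cost + e.cost + 1) + (IdxExpr.var 0).cost + 7) +
      (IdxExpr.var 0).cost + 5) ?_ ?_
  · simp only [IdxExpr.eval]
    rw [h.1.idx 0 (by simpa using hj.symm), hd]
  · refine ⟨(Agree.refl _ _ s).writeIdx (by simp) 0, by simp, by simp, by simp⟩
  · refine runs_setReal ?_
    have hR := hr s' hA
    have hE := he s' ⟨i, hi⟩ hA hij (h2 _ _ (by simp))
    rw [hR, hE]
    simp only [IdxExpr.eval, hij]
    refine ⟨by simpa using hij, (hA.writeReal (by simp) _ _ _).writeIdx (by simp) _, by simp, ?_, ?_⟩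
    · intro b hb
      rw [State.writeIdx_mat, State.writeReal_mat_self]
      by_cases hbi : (b : ℕ) = i
      · rw [if_pos ⟨rfl, hbi⟩]
        congr 1
        exact Fin.ext hbi.symm
      · rw [if_neg (fun h => hbi h.2)]
        exact h1 b (by omega)
    · intro a b hab
      rw [State.writeIdx_mat, State.writeReal_mat_self, if_neg (by omega)]
      exact h2 a b (by omega)
  · simp only [IdxExpr.cost]
    exact le_of_eq (by ring)
  · rintro s' ⟨hA, -, h1, h2⟩
    refine ⟨hA, funext fun b => h1 b b.2, fun a b hab => h2 a b (by tauto)⟩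

/-- Set the upper left `d × d` block of matrix `m`, with indices in variables `1` and `2`,
to `e`. -/
def Cmd.fillBlock (m : ℕ) (e : RealExpr) : Cmd :=
  .forLoop 1 (.var 0) (.fillRow 2 m (.var 1) e)

theorem runs_fillBlock {m : ℕ} {e : RealExpr} {s : State} (f : Matrix (Fin d) (Fin d) ℝ)
    (hd : s.idx 0 = d)
    (he : ∀ s' (a b : Fin d), Agree [1, 2] [m] s s' → s'.idx 1 = a → s'.idx 2 = b →
      s'.mat m a b = s.mat m a b → e.eval s' = f a b) :
    Runs xs us (.fillBlock m e) (d * (d * (e.cost + 11) + 14) + 6) s fun s' =>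
      Agree [1, 2] [m] s s' ∧ s'.block d m = f := by
  refine (runs_forLoop (n := d) (fun i s' => Agree [1, 2] [m] s s' ∧ s'.idx 1 = i ∧
    (∀ a : Fin d, (a : ℕ) < i → ∀ b : Fin d, s'.mat m a b = f a b) ∧
    ∀ a b, i ≤ a → s'.mat m a b = s.mat m a b)
    (fun i s' h => ?_) (fun i s' h => h.2.1) ?_ fun i s' hi ⟨hA, hij, h1, h2⟩ => ?_).mono
    (T := d * ((d * ((IdxExpr.var 1).cost + e.cost + 10) + 6) + (IdxExpr.var 0).cost + 7) +
      (IdxExpr.var 0).cost + 5) ?_ ?_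
  · simp only [IdxExpr.eval]
    rw [h.1.idx 0 (by simp), hd]
  · exact ⟨(Agree.refl _ _ s).writeIdx (by simp) 0, by simp, by simp, by simp⟩
  · refine (runs_fillRow (R := i) (fun b => f ⟨i, hi⟩ b) ?_ (by simp) ?_ ?_).mono le_rfl ?_
    · rw [hA.idx 0 (by simp), hd]
    · intro s'' h
      simp only [IdxExpr.eval]
      rw [h.idx 1 (by simp), hij]
    · intro s'' b h hb hm
      refine he s'' ⟨i, hi⟩ b (hA.trans (h.mono (by simp) (by simp))) ?_ hb ?_
      · rw [h.idx 1 (by simp), hij]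
      · rw [hm]; exact h2 _ _ le_rfl
    · rintro s'' ⟨hA', hrow, hrest⟩
      refine ⟨by rw [hA'.idx 1 (by simp), hij],
        (hA.trans (hA'.mono (by simp) (by simp))).writeIdx (by simp) _, by simp, ?_, ?_⟩
      · intro a ha b
        rw [State.writeIdx_mat]
        by_cases hai : (a : ℕ) = i
        · have : (⟨i, hi⟩ : Fin d) = a := Fin.ext hai.symm
          rw [this] at hrow
          rw [hai]
          exact congrFun hrow b
        · rw [hrest _ _ (Or.inl hai)]
          exact h1 a (by omega) b
      · intro a b ha
        rw [State.writeIdx_mat, hrest _ _ (Or.inl (by omega))]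
        exact h2 a b (by omega)
  · simp only [IdxExpr.cost]
    have : d * (1 + e.cost + 10) = d * (e.cost + 11) := by ring
    rw [this]
  · rintro s' ⟨hA, -, h1, -⟩
    exact ⟨hA, Matrix.ext fun a b => h1 a a.2 b⟩

/-- Add to entry `(r, c)` of matrix `m` the values of `e` for all `d` values of variable `2`. -/
def Cmd.addSum (m : ℕ) (r c : IdxExpr) (e : RealExpr) : Cmd :=
  .forLoop 2 (.var 0) (.setReal m r c (.add (.get m r c) e))

theorem runs_addSum {m R C : ℕ} {r c : IdxExpr} {e : RealExpr} {s : State} (f : Fin d → ℝ)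
    (hd : s.idx 0 = d)
    (hr : ∀ s', Agree [2] [m] s s' → r.eval s' = R)
    (hc : ∀ s', Agree [2] [m] s s' → c.eval s' = C)
    (he : ∀ s' (b : Fin d), Agree [2] [m] s s' → s'.idx 2 = b → e.eval s' = f b) :
    Runs xs us (.addSum m r c e) (d * (2 * r.cost + 2 * c.cost + e.cost + 11) + 6) s fun s' =>
      Agree [2] [m] s s' ∧ s'.mat m R C = s.mat m R C + ∑ b, f b ∧
      ∀ a b, (a ≠ R ∨ b ≠ C) → s'.mat m a b = s.mat m a b := by
  refine (runs_forLoop (n := d) (fun i s' => Agree [2] [m] s s' ∧ s'.idx 2 = i ∧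
    s'.mat m R C = s.mat m R C + ∑ b : Fin d, (if (b : ℕ) < i then f b else 0) ∧
    ∀ a b, (a ≠ R ∨ b ≠ C) → s'.mat m a b = s.mat m a b)
    (fun i s' h => ?_) (fun i s' h => h.2.1) ?_ fun i s' hi ⟨hA, hij, h1, h2⟩ => ?_).mono
    (T := d * ((r.cost + c.cost + (RealExpr.add (.get m r c) e).cost + 1) +
      (IdxExpr.var 0).cost + 7) + (IdxExpr.var 0).cost + 5) ?_ ?_
  · simp only [IdxExpr.eval]
    rw [h.1.idx 0 (by simp), hd]
  · exact ⟨(Agree.refl _ _ s).writeIdx (by simp) 0, by simp, by simp, by simp⟩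
  · refine runs_setReal ?_
    simp only [RealExpr.eval, hr s' hA, hc s' hA, he s' ⟨i, hi⟩ hA hij]
    refine ⟨by simpa using hij, (hA.writeReal (by simp) _ _ _).writeIdx (by simp) _, by simp, ?_, ?_⟩
    · rw [State.writeIdx_mat, State.writeReal_mat_self, if_pos ⟨rfl, rfl⟩, h1, add_assoc]
      congr 1
      have : ∀ b : Fin d, (if (b : ℕ) < i + 1 then f b else 0) =
          (if (b : ℕ) < i then f b else 0) + if b = ⟨i, hi⟩ then f b else 0 := by
        intro b
        rcases lt_trichotomy (b : ℕ) i with h | h | h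
        · have h' : b ≠ ⟨i, hi⟩ := fun e => h.ne (congrArg Fin.val e)
          simp [h, h', Nat.lt_succ_of_lt h]
        · have h' : b = ⟨i, hi⟩ := Fin.ext h
          simp [h']
        · have h' : b ≠ ⟨i, hi⟩ := fun e => h.ne' (congrArg Fin.val e)
          simp [h.not_gt, h', show ¬ ((b : ℕ) < i + 1) by omega]
      rw [Finset.sum_congr rfl fun b _ => this b, Finset.sum_add_distrib]
      simp
    · intro a b hab
      rw [State.writeIdx_mat, State.writeReal_mat_self, if_neg (by tauto)]
      exact h2 a b hab
  · simp only [IdxExpr.cost, RealExpr.cost]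
    exact le_of_eq (by ring)
  · rintro s' ⟨hA, -, h1, h2⟩
    refine ⟨hA, ?_, h2⟩
    simpa using h1

/-- Store the product of the row `r` of matrix `src` with the block of matrix `m` in row `0` of
matrix `dst`. -/
def Cmd.vecMul (m src : ℕ) (r : IdxExpr) (dst : ℕ) : Cmd :=
  .forLoop 1 (.var 0) (.seq (.setReal dst (.const 0) (.var 1) (.ofIdx (.const 0)))
    (.addSum dst (.const 0) (.var 1) (.mul (.get src r (.var 2)) (.get m (.var 2) (.var 1)))))

theorem runs_vecMul {m src dst R : ℕ} {r : IdxExpr} {s : State} (hd : s.idx 0 = d)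
    (hm : m ≠ dst) (hsrc : src ≠ dst) (hr : ∀ s', Agree [1, 2] [dst] s s' → r.eval s' = R) :
    Runs xs us (.vecMul m src r dst) (d * (d * (r.cost + 21) + 20) + 6) s fun s' =>
      Agree [1, 2] [dst] s s' ∧ s'.row d dst 0 = s.row d src R ᵥ* s.block d m := by
  refine (runs_forLoop (n := d) (fun i s' => Agree [1, 2] [dst] s s' ∧ s'.idx 1 = i ∧
    (∀ b : Fin d, (b : ℕ) < i → s'.mat dst 0 b = (s.row d src R ᵥ* s.block d m) b))
    (fun i s' h => ?_) (fun i s' h => h.2.1) ?_ fun i s' hi ⟨hA, hij, h1⟩ => ?_).mono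
    (T := d * (6 + (d * (r.cost + 21) + 6) + (IdxExpr.var 0).cost + 7) +
      (IdxExpr.var 0).cost + 5) ?_ ?_
  · simp only [IdxExpr.eval]
    rw [h.1.idx 0 (by simp), hd]
  · exact ⟨(Agree.refl _ _ s).writeIdx (by simp) 0, by simp, by simp⟩
  · refine Runs.seq (T₁ := 6)
      (Q := fun s'' => Agree [1, 2] [dst] s s'' ∧ s''.idx 1 = i ∧ s''.mat dst 0 i = 0 ∧
        ∀ b : Fin d, (b : ℕ) < i → s''.mat dst 0 b = (s.row d src R ᵥ* s.block d m) b)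
      ((runs_setReal ?_).mono ?_ fun _ h => h) ?_
    · simp only [RealExpr.eval, IdxExpr.eval, hij]
      refine ⟨hA.writeReal (by simp) _ _ _, by simpa using hij, ?_, ?_⟩
      · simp [State.writeReal_mat_self]
      · intro b hb
        rw [State.writeReal_mat_self, if_neg (by omega)]
        exact h1 b hb
    · simp [IdxExpr.cost, RealExpr.cost]
    · rintro s₁ ⟨hA₁, hi₁, hz, h1⟩
      refine (runs_addSum (R := 0) (C := i)
        (fun b : Fin d => s.row d src R b * s.block d m b ⟨i, hi⟩) ?_ ?_ ?_ ?_).mono ?_ ?_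
      · rw [hA₁.idx 0 (by simp), hd]
      · intro s' _; rfl
      · intro s' h
        simp only [IdxExpr.eval]
        rw [h.idx 1 (by simp), hi₁]
      · intro s' b h hb
        have hA' : Agree [1, 2] [dst] s s' := hA₁.trans (h.mono (by simp) (by simp))
        simp only [RealExpr.eval, IdxExpr.eval, hb, hr s' hA']
        rw [h.idx 1 (by simp), hi₁, hA'.mat src (by simpa using hsrc), hA'.mat m (by simpa using hm)]
        rfl
      · simp only [IdxExpr.cost, RealExpr.cost]
        exact le_of_eq (by ring)
      · rintro s' ⟨hA', hsum, hrest⟩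
        refine ⟨by rw [hA'.idx 1 (by simp), hi₁],
          (hA₁.trans (hA'.mono (by simp) (by simp))).writeIdx (by simp) _, by simp, ?_⟩
        intro b hb
        rw [State.writeIdx_mat]
        by_cases hbi : (b : ℕ) = i
        · have : b = ⟨i, hi⟩ := Fin.ext hbi
          rw [this, hsum, hz, zero_add]
          simp [Matrix.vecMul, dotProduct]
        · rw [hrest _ _ (Or.inr hbi)]
          exact h1 b (by omega)
  · simp only [IdxExpr.cost]
    exact le_of_eq (by ring)
  · rintro s' ⟨hA, -, h1⟩
    exact ⟨hA, funext fun b => h1 b b.2⟩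

/-- Store the inner product of row `0` of matrix `m` and row `r` of matrix `src` in entry `(0, 0)`
of matrix `dst`. -/
def Cmd.dot (m src : ℕ) (r : IdxExpr) (dst : ℕ) : Cmd :=
  .seq (.setReal dst (.const 0) (.const 0) (.ofIdx (.const 0)))
    (.addSum dst (.const 0) (.const 0) (.mul (.get m (.const 0) (.var 2)) (.get src r (.var 2))))

theorem runs_dot {m src dst R : ℕ} {r : IdxExpr} {s : State} (hd : s.idx 0 = d)
    (hm : m ≠ dst) (hsrc : src ≠ dst) (hr : ∀ s', Agree [2] [dst] s s' → r.eval s' = R) :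
    Runs xs us (.dot m src r dst) (d * (r.cost + 21) + 12) s fun s' =>
      Agree [2] [dst] s s' ∧ s'.mat dst 0 0 = s.row d m 0 ⬝ᵥ s.row d src R := by
  refine (Runs.seq (T₁ := 6)
      (Q := fun s'' => Agree [2] [dst] s s'' ∧ s''.mat dst 0 0 = 0)
      ((runs_setReal ?_).mono ?_ fun _ h => h) ?_).mono (T := 6 + (d * (r.cost + 21) + 6))
        (by omega) fun _ h => h
  · simp only [RealExpr.eval, IdxExpr.eval]
    exact ⟨(Agree.refl _ _ s).writeReal (by simp) _ _ _, by simp [State.writeReal_mat_self]⟩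
  · simp [IdxExpr.cost, RealExpr.cost]
  · rintro s₁ ⟨hA₁, hz⟩
    refine (runs_addSum (R := 0) (C := 0)
      (fun b : Fin d => s.row d m 0 b * s.row d src R b) ?_ ?_ ?_ ?_).mono ?_ ?_
    · rw [hA₁.idx 0 (by simp), hd]
    · intro s' _; rfl
    · intro s' _; rfl
    · intro s' b h hb
      have hA' : Agree [2] [dst] s s' := hA₁.trans h
      simp only [RealExpr.eval, IdxExpr.eval, hb, hr s' hA']
      rw [hA'.mat src (by simpa using hsrc), hA'.mat m (by simpa using hm)]
      rfl
    · simp only [IdxExpr.cost, RealExpr.cost]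
      exact le_of_eq (by ring)
    · rintro s' ⟨hA', hsum, -⟩
      refine ⟨hA₁.trans hA', ?_⟩
      rw [hsum, hz, zero_add]
      rfl

/-- Subtract from the block of matrix `m` the rank-one matrix `v hᵀ / p`, where `v` is the row `rv`
of matrix `mv`, `h` is the row `rh` of matrix `mh`, and `p` is the entry `(0, 0)` of
matrix `mp`. -/
def Cmd.subRankOne (m mv : ℕ) (rv : IdxExpr) (mh : ℕ) (rh : IdxExpr) (mp : ℕ) : Cmd :=
  .fillBlock m (.sub (.get m (.var 1) (.var 2))
    (.div (.mul (.get mv rv (.var 1)) (.get mh rh (.var 2))) (.get mp (.const 0) (.const 0))))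

theorem runs_subRankOne {m mv mh mp Rv Rh : ℕ} {rv rh : IdxExpr} {s : State} (hd : s.idx 0 = d)
    (hmv : mv ≠ m) (hmh : mh ≠ m) (hmp : mp ≠ m)
    (hrv : ∀ s', Agree [1, 2] [m] s s' → rv.eval s' = Rv)
    (hrh : ∀ s', Agree [1, 2] [m] s s' → rh.eval s' = Rh) :
    Runs xs us (.subRankOne m mv rv mh rh mp) (d * (d * (rv.cost + rh.cost + 24) + 14) + 6) s
      fun s' => Agree [1, 2] [m] s s' ∧ s'.block d m = s.block d m -
        (s.mat mp 0 0)⁻¹ • Matrix.vecMulVec (s.row d mv Rv) (s.row d mh Rh) := by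
  refine (runs_fillBlock _ hd ?_).mono ?_ fun _ h => h
  · intro s' a b hA ha hb hm
    simp only [RealExpr.eval, IdxExpr.eval, ha, hb, hrv s' hA, hrh s' hA, hm]
    rw [hA.mat mv (by simpa using hmv), hA.mat mh (by simpa using hmh),
      hA.mat mp (by simpa using hmp)]
    simp [State.block, State.row, Matrix.vecMulVec_apply, div_eq_inv_mul]
  · simp only [IdxExpr.cost, RealExpr.cost]
    exact le_of_eq (by ring)

/-- The expression with value `1` if the variables `i` and `j` are equal, and `0` otherwise. -/
def RealExpr.delta (i j : ℕ) : RealExpr :=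
  .ofIdx (.sub (.const 1) (.add (.sub (.var i) (.var j)) (.sub (.var j) (.var i))))

theorem RealExpr.eval_delta (s : State) (i j : ℕ) :
    (RealExpr.delta i j).eval s = if s.idx i = s.idx j then 1 else 0 := by
  simp only [RealExpr.delta, RealExpr.eval, IdxExpr.eval]
  split_ifs with h
  · simp [h]
  · have : 1 - (s.idx i - s.idx j + (s.idx j - s.idx i)) = 0 := by omega
    simp [this]

/-- Invert the block of matrix `src` into matrix `dst` and store its determinant in entry `(0, 0)`
of matrix `det`.  The matrices `6`, `7`, `8`, `9` serve as scratch memory. -/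
def Cmd.invert (src dst det : ℕ) : Cmd :=
  .seq (.fillBlock dst (.delta 1 2)) <|
  .seq (.setReal det (.const 0) (.const 0) (.ofIdx (.const 1))) <|
  .forLoop 3 (.var 0) <|
    .seq (.fillRow 2 6 (.const 0) (.sub (.get src (.var 3) (.var 2)) (.delta 3 2))) <|
    .seq (.vecMul dst 6 (.const 0) 7) <|
    .seq (.fillRow 2 8 (.const 0) (.get dst (.var 2) (.var 3))) <|
    .seq (.setReal 9 (.const 0) (.const 0)
      (.add (.get 7 (.const 0) (.var 3)) (.ofIdx (.const 1)))) <|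
    .seq (.setReal det (.const 0) (.const 0)
      (.mul (.get det (.const 0) (.const 0)) (.get 9 (.const 0) (.const 0)))) <|
    .subRankOne dst 8 (.const 0) 7 (.const 0) 9

theorem runs_invert {src dst det : ℕ} {s : State} (hd : s.idx 0 = d) (hd1 : 1 ≤ d)
    (hsrc : src ∉ [6, 7, 8, 9, dst, det]) (hdst : dst ∉ [6, 7, 8, 9, det])
    (hdet : det ∉ [6, 7, 8, 9]) (hM : (s.block d src).PosSemidef) :
    Runs xs us (.invert src dst det) (300 * d ^ 3) s fun s' =>
      Agree [1, 2, 3] [6, 7, 8, 9, dst, det] s s' ∧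
      IsPartialInverse (s.block d src) d (s'.block d dst) (s'.mat det 0 0) := by
  simp only [List.mem_cons, List.not_mem_nil, or_false, not_or] at hsrc hdst hdet
  obtain ⟨hs6, hs7, hs8, hs9, hsd, hst⟩ := hsrc
  obtain ⟨hd6, hd7, hd8, hd9, hdt⟩ := hdst
  obtain ⟨ht6, ht7, ht8, ht9⟩ := hdet
  refine Runs.mono (Runs.seq (runs_fillBlock (1 : Matrix (Fin d) (Fin d) ℝ) hd ?_) fun s₁ ⟨hA₁, h₁⟩ =>
    Runs.seq (Q := fun s₂ => Agree [1, 2, 3] [6, 7, 8, 9, dst, det] s s₂ ∧ s₂.block d dst = 1 ∧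
      s₂.mat det 0 0 = 1) (runs_setReal ?_) fun s₂ ⟨hA₂, h₂, h₂'⟩ =>
    runs_forLoop (n := d) (T := 48 * d ^ 2 + 73 * d + 43)
      (fun q s' => Agree [1, 2, 3] [6, 7, 8, 9, dst, det] s s' ∧ s'.idx 3 = q ∧
      IsPartialInverse (s.block d src) q (s'.block d dst) (s'.mat det 0 0))
      (fun i s' h => ?_) (fun i s' h => h.2.1) ?_ fun q s' hq ⟨hA, hi, hP⟩ => ?_) ?_ ?_
  · intro s' a b _ ha hb _
    rw [RealExpr.eval_delta, ha, hb, Matrix.one_apply]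
    simp [Fin.ext_iff]
  · refine ⟨(hA₁.mono (by simp) (by simp)).writeReal (by simp) _ _ _, ?_, ?_⟩
    · rw [← h₁]
      ext i j
      simp [State.block, State.writeReal_mat_of_ne _ _ _ _ hdt]
    · simp [State.writeReal_mat_self, IdxExpr.eval, RealExpr.eval]
  · simp only [IdxExpr.eval]
    rw [h.1.idx 0 (by simp), hd]
  · refine ⟨hA₂.writeIdx (by simp) _, by simp, ?_⟩
    have : (s₂.writeIdx 3 0).block d dst = 1 := h₂
    rw [this, State.writeIdx_mat, h₂']
    exact isPartialInverse_zero _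
  · -- One row replacement: `w` is the change of the row, `h = wᵀ G`, `v` is a column of `G`.
    set M := s.block d src with hMdef
    set G := s'.block d dst with hG
    set w : Fin d → ℝ := M ⟨q, hq⟩ - Pi.single ⟨q, hq⟩ 1 with hw
    refine Runs.mono_time (Runs.seq (runs_fillRow (R := 0) w ?_ (by simp) (fun _ _ => rfl) ?_)
      fun s₁ ⟨hA₁, h₁, _⟩ =>
      Runs.seq (runs_vecMul (R := 0) ?_ hd7 (by simp) (fun _ _ => rfl)) fun s₂ ⟨hA₂, h₂⟩ =>
      Runs.seq (runs_fillRow (R := 0) (fun i => G i ⟨q, hq⟩) ?_ (by simp) (fun _ _ => rfl) ?_)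
        fun s₃ ⟨hA₃, h₃, _⟩ =>
      Runs.seq (Q := fun s₄ => Agree [1, 2] [6, 7, 8, 9] s' s₄ ∧ s₄.row d 7 0 = w ᵥ* G ∧
        s₄.row d 8 0 = (fun i => G i ⟨q, hq⟩) ∧ s₄.mat 9 0 0 = (w ᵥ* G) ⟨q, hq⟩ + 1)
        (runs_setReal ?_) fun s₄ ⟨hA₄, h₄, h₄', h₄''⟩ =>
      Runs.seq (Q := fun s₅ => Agree [1, 2] [6, 7, 8, 9, det] s' s₅ ∧ s₅.row d 7 0 = w ᵥ* G ∧
        s₅.row d 8 0 = (fun i => G i ⟨q, hq⟩) ∧ s₅.mat 9 0 0 = (w ᵥ* G) ⟨q, hq⟩ + 1 ∧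
        s₅.mat det 0 0 = s'.mat det 0 0 * ((w ᵥ* G) ⟨q, hq⟩ + 1))
        (runs_setReal ?_) fun s₅ ⟨hA₅, h₅, h₅', h₅'', h₅'''⟩ =>
      (runs_subRankOne (Rv := 0) (Rh := 0) ?_ (Ne.symm hd8) (Ne.symm hd7) (Ne.symm hd9)
        (fun _ _ => rfl) (fun _ _ => rfl)).mono le_rfl
        fun t ⟨ht, hb⟩ => ?_) ?_
    · rw [hA.idx 0 (by simp), hd]
    · intro t b ht hb _
      simp only [RealExpr.eval, IdxExpr.eval, RealExpr.eval_delta, hb]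
      rw [ht.idx 3 (by simp), hi, ht.mat src (by simpa using hs6),
        hA.mat src (by simp [hs6, hs7, hs8, hs9, hsd, hst])]
      simp [hw, hMdef, State.block, Pi.single_apply, Fin.ext_iff, eq_comm]
    · rw [hA₁.idx 0 (by simp), hA.idx 0 (by simp), hd]
    · rw [hA₂.idx 0 (by simp), hA₁.idx 0 (by simp), hA.idx 0 (by simp), hd]
    · intro t b ht hb _
      simp only [RealExpr.eval, IdxExpr.eval, hb]
      rw [ht.idx 3 (by simp), hA₂.idx 3 (by simp), hA₁.idx 3 (by simp), hi,
        ht.mat dst (by simpa using hd8), hA₂.mat dst (by simpa using hd7),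
        hA₁.mat dst (by simpa using hd6)]
      rfl
    · have hA' : Agree [1, 2] [6, 7, 8, 9] s' s₃ :=
        ((hA₁.mono (by simp) (by simp)).trans (hA₂.mono (by simp) (by simp))).trans
          (hA₃.mono (by simp) (by simp))
      have h7 : s₃.row d 7 0 = w ᵥ* G := by
        rw [hA₃.row_eq (by simp), h₂, h₁, hA₁.block_eq (by simpa using hd6)]
      refine ⟨hA'.writeReal (by simp) _ _ _, ?_, ?_, ?_⟩
      · rw [← h7]; ext b; simp [State.row, State.writeReal_mat_of_ne]
      · rw [← h₃]; ext b; simp [State.row, State.writeReal_mat_of_ne]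
      · simp only [RealExpr.eval, IdxExpr.eval]
        rw [State.writeReal_mat_self, if_pos ⟨rfl, rfl⟩, hA'.idx 3 (by simp), hi, ← h7]
        simp [State.row]
    · refine ⟨(hA₄.mono (by simp) (by simp)).writeReal (by simp) _ _ _, ?_, ?_, ?_, ?_⟩
      · rw [← h₄]; ext b; simp [State.row, State.writeReal_mat_of_ne _ _ _ _ (Ne.symm ht7)]
      · rw [← h₄']; ext b; simp [State.row, State.writeReal_mat_of_ne _ _ _ _ (Ne.symm ht8)]
      · rw [← h₄'', State.writeReal_mat_of_ne _ _ _ _ (Ne.symm ht9)]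
      · simp only [RealExpr.eval, IdxExpr.eval]
        rw [State.writeReal_mat_self, if_pos ⟨rfl, rfl⟩, h₄'',
          hA₄.mat det (by simp [ht6, ht7, ht8, ht9])]
    · rw [hA₅.idx 0 (by simp), hA.idx 0 (by simp), hd]
    · rw [h₅, h₅', h₅'', hA₅.block_eq (by simp [hd6, hd7, hd8, hd9, hdt])] at hb
      refine ⟨?_, ?_, by simp, ?_⟩
      · rw [ht.idx 3 (by simp), hA₅.idx 3 (by simp), hi]
      · exact ((hA.trans (hA₅.mono (by simp) (by simp))).trans
          (ht.mono (by simp) (by simp))).writeIdx (by simp) _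
      · have e1 : (t.writeIdx 3 (q + 1)).block d dst = t.block d dst := rfl
        rw [e1, hb, State.writeIdx_mat, ht.mat det (by simpa using Ne.symm hdt), h₅''']
        exact hP.step hM ⟨q, hq⟩
    · simp only [IdxExpr.cost, RealExpr.cost, RealExpr.delta]
      nlinarith
  · simp only [IdxExpr.cost, RealExpr.cost, RealExpr.delta]
    have h2 : d ≤ d ^ 2 := by nlinarith
    have h3 : d ^ 2 ≤ d ^ 3 := by nlinarith [sq_nonneg d]
    nlinarith
  · rintro s' ⟨hA, -, hP⟩
    exact ⟨hA, hP⟩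

/-! ### The rejection sampling program -/

/-- The number `d ^ 2` of candidate vectors of one round. -/
def IdxExpr.dimSq : IdxExpr := .mul (.var 0) (.var 0)

theorem IdxExpr.eval_dimSq (s : State) : IdxExpr.dimSq.eval s = s.idx 0 ^ 2 := by
  simp [IdxExpr.dimSq, IdxExpr.eval, sq]

/-- Draw the candidates `x` and uniform reals of one round into the rows of the matrices `5` and
`10`, store `Q = d xᵀ G x` in matrix `11`, where `G` is the matrix `2`, and add `x xᵀ / Q` to
matrix `3`.  The addition is a subtraction with the divisor `-Q`, which is entry `(0, 0)` of
matrix `9`. -/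
def Cmd.drawCandidates : Cmd :=
  .forLoop 3 .dimSq <|
    .seq (.drawSample 5 (.var 3)) <|
    .seq (.drawUniform 10 (.var 3) (.const 0)) <|
    .seq (.vecMul 2 5 (.var 3) 7) <|
    .seq (.dot 7 5 (.var 3) 9) <|
    .seq (.setReal 11 (.var 3) (.const 0)
      (.mul (.ofIdx (.var 0)) (.get 9 (.const 0) (.const 0)))) <|
    .seq (.setReal 9 (.const 0) (.const 0)
      (.sub (.ofIdx (.const 0)) (.get 11 (.var 3) (.const 0)))) <|
    .subRankOne 3 5 (.var 3) 5 (.var 3) 9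

/-- The inverse weight `d xᵀ G x` of a candidate vector. -/
noncomputable def candidateNorm (G : Matrix (Fin d) (Fin d) ℝ) (x : Fin d → ℝ) : ℝ :=
  d * ((x ᵥ* G) ⬝ᵥ x)

theorem runs_drawCandidates {G : Matrix (Fin d) (Fin d) ℝ} {s : State} (hd : s.idx 0 = d)
    (hG : s.block d 2 = G) (h3 : s.block d 3 = 0) (x : ℕ → Fin d → ℝ) (u : ℕ → ℝ)
    (hx : ∀ n < d ^ 2, xs (s.samples + n) = x n) (hu : ∀ n < d ^ 2, us (s.uniforms + n) = u n) :
    Runs xs us .drawCandidates (d ^ 2 * (48 * d ^ 2 + 57 * d + 57) + 8) s fun s' =>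
      (∀ v, v ∉ [1, 2, 3] → s'.idx v = s.idx v) ∧
      (∀ m, m ∉ [3, 5, 7, 9, 10, 11] → s'.mat m = s.mat m) ∧
      s'.samples = s.samples + d ^ 2 ∧ s'.uniforms = s.uniforms + d ^ 2 ∧
      (∀ i < d ^ 2, s'.row d 5 i = x i ∧ s'.mat 10 i 0 = u i ∧
        s'.mat 11 i 0 = candidateNorm G (x i)) ∧
      s'.block d 3 = gram x (fun i => (candidateNorm G (x i))⁻¹) (Finset.range (d ^ 2)) := by
  refine Runs.mono (runs_forLoop (n := d ^ 2) (T := 48 * d ^ 2 + 57 * d + 47)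
    (fun n s' => (∀ v, v ∉ [1, 2, 3] → s'.idx v = s.idx v) ∧ s'.idx 3 = n ∧
      (∀ m, m ∉ [3, 5, 7, 9, 10, 11] → s'.mat m = s.mat m) ∧
      s'.samples = s.samples + n ∧ s'.uniforms = s.uniforms + n ∧
      (∀ i < n, s'.row d 5 i = x i ∧ s'.mat 10 i 0 = u i ∧
        s'.mat 11 i 0 = candidateNorm G (x i)) ∧
      s'.block d 3 = gram x (fun i => (candidateNorm G (x i))⁻¹) (Finset.range n))
    (fun i s' h => ?_) (fun i s' h => h.2.1) ?_ fun n s' hn ⟨hA, hi, hm, hsam, hun, hrow, hgr⟩ => ?_)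
      ?_ ?_
  · rw [IdxExpr.eval_dimSq, h.1 0 (by simp), hd]
  · refine ⟨fun v hv => State.writeIdx_idx_of_ne _ _ (by simp at hv; tauto), by simp, by simp,
      by simp, by simp, by simp, ?_⟩
    simpa [gram, State.block] using h3
  · have hd' : s'.idx 0 = d := by rw [hA 0 (by simp), hd]
    have hG' : s'.block d 2 = G := by rw [← hG]; ext a b; simp [State.block, hm 2]
    -- `s₂` is the state after both draws.
    refine Runs.mono_time (Runs.seq (Q := fun s₁ => s₁.idx = s'.idx ∧
        s₁.samples = s.samples + (n + 1) ∧ s₁.uniforms = s.uniforms + n ∧ (∀ m, m ≠ 5 → s₁.mat m = s'.mat m) ∧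
        (∀ i, i ≠ n → s₁.mat 5 i = s'.mat 5 i) ∧ s₁.row d 5 n = x n)
      (runs_drawSample ?_) fun s₁ ⟨hidx₁, hsam₁, hun₁, hm₁, h5₁, hx₁⟩ =>
      Runs.seq (Q := fun s₂ => s₂.idx = s'.idx ∧ s₂.samples = s.samples + (n + 1) ∧
        s₂.uniforms = s.uniforms + (n + 1) ∧ (∀ m, m ≠ 5 → m ≠ 10 → s₂.mat m = s'.mat m) ∧
        (∀ i, i ≠ n → s₂.mat 5 i = s'.mat 5 i) ∧ s₂.row d 5 n = x n ∧
        (∀ i, i ≠ n → s₂.mat 10 i 0 = s'.mat 10 i 0) ∧ s₂.mat 10 n 0 = u n)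
      (runs_drawUniform ?_) fun s₂ ⟨hidx₂, hsam₂, hun₂, hm₂, h5₂, hx₂, h10₂, hu₂⟩ =>
      Runs.seq (runs_vecMul (R := n) ?_ (by simp) (by simp) ?_) fun s₃ ⟨hA₃, h₃⟩ =>
      Runs.seq (runs_dot (R := n) ?_ (by simp) (by simp) ?_) fun s₄ ⟨hA₄, h₄⟩ =>
      Runs.seq (Q := fun s₅ => Agree [1, 2] [7, 9, 11] s₂ s₅ ∧
        (∀ i, i ≠ n → s₅.mat 11 i 0 = s'.mat 11 i 0) ∧ s₅.mat 11 n 0 = candidateNorm G (x n))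
        (runs_setReal ?_) fun s₅ ⟨hA₅, h11, hQ⟩ =>
      Runs.seq (Q := fun s₆ => Agree [1, 2] [7, 9, 11] s₂ s₆ ∧
        (∀ i, i ≠ n → s₆.mat 11 i 0 = s'.mat 11 i 0) ∧ s₆.mat 11 n 0 = candidateNorm G (x n) ∧
        s₆.mat 9 0 0 = - candidateNorm G (x n))
        (runs_setReal ?_) fun s₆ ⟨hA₆, h11₆, hQ₆, hp⟩ =>
      (runs_subRankOne (Rv := n) (Rh := n) ?_ (by simp) (by simp) (by simp) ?_ ?_).mono le_rfl
        fun t ⟨ht, hb⟩ => ?_) ?_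
    · simp only [IdxExpr.eval, hi, hsam, hx n hn]
      refine ⟨rfl, rfl, hun, fun m hm5 => ?_, fun i hin => ?_, ?_⟩
      · ext a b; simp [State.writeRow, hm5]
      · ext b; simp [State.writeRow, hin]
      · ext b; simp [State.row, State.writeRow]
    · simp only [IdxExpr.eval, hidx₁, hi, hun₁, hu n hn]
      refine ⟨hidx₁, hsam₁, by simp [add_assoc], fun m hm5 hm10 => ?_, fun i hin => ?_, ?_,
        fun i hin => ?_, ?_⟩
      · exact (State.writeReal_mat_of_ne _ _ _ _ hm10).trans (hm₁ m hm5)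
      · exact (congrFun (State.writeReal_mat_of_ne _ _ _ _ (by simp)) i).trans (h5₁ i hin)
      · rw [← hx₁]; ext b; simp [State.row, State.writeReal]
      · refine (State.writeReal_mat_self _ _ _ _ _ _ _).trans ?_
        rw [if_neg (by tauto), hm₁ 10 (by simp)]
      · exact (State.writeReal_mat_self _ _ _ _ _ _ _).trans (if_pos ⟨rfl, rfl⟩)
    · rw [hidx₂, hd']
    · intro t ht; simp only [IdxExpr.eval]; rw [ht.idx 3 (by simp), hidx₂, hi]
    · rw [hA₃.idx 0 (by simp), hidx₂, hd']
    · intro t ht; simp only [IdxExpr.eval]; rw [ht.idx 3 (by simp), hA₃.idx 3 (by simp), hidx₂, hi]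
    · have hA₄' : Agree [1, 2] [7, 9, 11] s₂ s₄ :=
        (hA₃.mono (by simp) (by simp)).trans (hA₄.mono (by simp) (by simp))
      have hG₂ : s₂.block d 2 = G := by rw [← hG']; ext a b; simp [State.block, hm₂ 2]
      have h11₄ : s₄.mat 11 = s'.mat 11 := by
        rw [hA₄.mat 11 (by simp), hA₃.mat 11 (by simp), hm₂ 11 (by simp) (by simp)]
      simp only [IdxExpr.eval, RealExpr.eval]
      rw [hA₄'.idx 3 (by simp), hA₄'.idx 0 (by simp), hidx₂, hi, hd']
      refine ⟨hA₄'.writeReal (by simp) _ _ _, fun i hin => ?_, ?_⟩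
      · rw [State.writeReal_mat_self, if_neg (by tauto), h11₄]
      · rw [State.writeReal_mat_self, if_pos ⟨rfl, rfl⟩, h₄, h₃, hA₃.row_eq (by simp), hx₂, hG₂]
        rfl
    · simp only [IdxExpr.eval, RealExpr.eval]
      rw [hA₅.idx 3 (by simp), hidx₂, hi]
      refine ⟨hA₅.writeReal (by simp) _ _ _, fun i hin => ?_, ?_, ?_⟩
      · rw [State.writeReal_mat_of_ne _ _ _ _ (by simp), h11 i hin]
      · rw [State.writeReal_mat_of_ne _ _ _ _ (by simp), hQ]
      · rw [State.writeReal_mat_self, if_pos ⟨rfl, rfl⟩, hQ]; simp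
    · rw [hA₆.idx 0 (by simp), hidx₂, hd']
    · intro t ht; simp only [IdxExpr.eval]; rw [ht.idx 3 (by simp), hA₆.idx 3 (by simp), hidx₂, hi]
    · intro t ht; simp only [IdxExpr.eval]; rw [ht.idx 3 (by simp), hA₆.idx 3 (by simp), hidx₂, hi]
    · have hA₇ : Agree [1, 2] [3, 7, 9, 11] s₂ t :=
        (hA₆.mono (by simp) (by simp)).trans (ht.mono (by simp) (by simp))
      refine ⟨by rw [hA₇.idx 3 (by simp), hidx₂, hi], fun v hv => ?_, by simp, fun m hm' => ?_, ?_, ?_,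
        fun i hi' => ⟨?_, ?_, ?_⟩, ?_⟩
      · simp only [List.mem_cons, List.not_mem_nil, or_false, not_or] at hv
        rw [State.writeIdx_idx_of_ne _ _ hv.2.2, hA₇.idx v (by simp [hv]), hidx₂,
          hA v (by simp [hv])]
      · simp only [List.mem_cons, List.not_mem_nil, or_false, not_or] at hm'
        rw [State.writeIdx_mat, hA₇.mat m (by simp [hm']), hm₂ m (by tauto) (by tauto),
          hm m (by simp [hm'])]
      · rw [State.writeIdx_samples, hA₇.samples, hsam₂]
      · rw [State.writeIdx_uniforms, hA₇.uniforms, hun₂]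
      · change t.row d 5 i = x i
        rw [hA₇.row_eq (by simp)]
        by_cases hin : i = n
        · rw [hin, hx₂]
        · rw [← (hrow i (by omega)).1]; ext b; simp [State.row, h5₂ i hin]
      · rw [State.writeIdx_mat, hA₇.mat 10 (by simp)]
        by_cases hin : i = n
        · rw [hin, hu₂]
        · rw [h10₂ i hin, (hrow i (by omega)).2.1]
      · rw [State.writeIdx_mat, ht.mat 11 (by simp)]
        by_cases hin : i = n
        · rw [hin, hQ₆]
        · rw [h11₆ i hin, (hrow i (by omega)).2.2]
      · change t.block d 3 = _
        have h3' : s₆.block d 3 = s'.block d 3 := by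
          rw [hA₆.block_eq (by simp)]; ext a b; simp [State.block, hm₂ 3]
        rw [hb, h3', hgr, hp, hA₆.row_eq (by simp), hx₂, Finset.range_add_one,
          gram_insert _ _ (by simp), inv_neg, neg_smul, sub_neg_eq_add, add_comm]
    · simp only [IdxExpr.cost, RealExpr.cost]
      nlinarith
  · simp only [IdxExpr.dimSq, IdxExpr.cost]
    nlinarith
  · rintro s' ⟨h1, -, h2⟩
    exact ⟨h1, h2⟩

/-- Decide for each candidate whether it is selected, by means of the matrix `4` that holds the
current tilted inverse, and store the selected ones in consecutive rows of matrix `1`.  Variable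
`4` counts them.  For a candidate `x` with inverse weight `Q`, entry `(0, 0)` of matrix `9` holds
`p = xᵀ A x`, the test is `u Q < p`, and the rank-one update of the tilted inverse `A` divides by
`p` or by `p - Q`. -/
def Cmd.selectCandidates : Cmd :=
  .forLoop 3 .dimSq <|
    .seq (.vecMul 4 5 (.var 3) 7) <|
    .seq (.dot 7 5 (.var 3) 9) <|
    .seq (.branch (.realLt (.mul (.get 10 (.var 3) (.const 0)) (.get 11 (.var 3) (.const 0)))
        (.get 9 (.const 0) (.const 0)))
      (.seq (.fillRow 2 1 (.var 4) (.get 5 (.var 3) (.var 2)))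
        (.setIdx 4 (.add (.var 4) (.const 1))))
      (.setReal 9 (.const 0) (.const 0)
        (.sub (.get 9 (.const 0) (.const 0)) (.get 11 (.var 3) (.const 0))))) <|
    .subRankOne 4 7 (.const 0) 7 (.const 0) 9

/-- The rows of matrix `1` list the vectors `x j`, `j ∈ I`, in increasing order of `j`. -/
def ListsRows (x : ℕ → Fin d → ℝ) (I : Finset ℕ) (s : State) : Prop :=
  ∀ j ∈ I, s.row d 1 (I.filter (· < j)).card = x j

/-- If the Gram matrix of the candidates is singular, only the time bound and the memory footprint
are claimed: the round is then rejected. -/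
theorem runs_selectCandidates {s : State} (hd : s.idx 0 = d) (h4 : s.idx 4 = 0)
    (x : ℕ → Fin d → ℝ) (u w : ℕ → ℝ) (hw : ∀ i, 0 < w i) (hu0 : ∀ i, 0 ≤ u i) (hu1 : ∀ i, u i < 1)
    (hrow : ∀ i < d ^ 2, s.row d 5 i = x i ∧ s.mat 10 i 0 = u i ∧ s.mat 11 i 0 = (w i)⁻¹)
    (hinv : (gram x w (Finset.range (d ^ 2))).det ≠ 0 →
      s.block d 4 = (gram x w (Finset.range (d ^ 2)))⁻¹) :
    Runs xs us .selectCandidates (d ^ 2 * (48 * d ^ 2 + 70 * d + 56) + 8) s fun s' =>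
      Agree [1, 2, 3, 4] [1, 4, 7, 9] s s' ∧
      ((gram x w (Finset.range (d ^ 2))).det ≠ 0 →
        ListsRows x (selection x w u (d ^ 2) (d ^ 2)) s') := by
  refine Runs.mono (runs_forLoop (n := d ^ 2) (T := 48 * d ^ 2 + 70 * d + 46)
    (fun i s' => Agree [1, 2, 3, 4] [1, 4, 7, 9] s s' ∧ s'.idx 3 = i ∧
      ((gram x w (Finset.range (d ^ 2))).det ≠ 0 →
        IsTiltedInverse x w (d ^ 2 - i) i (selection x w u (d ^ 2) i) (s'.block d 4) ∧
        s'.idx 4 = (selection x w u (d ^ 2) i).card ∧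
        ListsRows x (selection x w u (d ^ 2) i) s'))
    (fun i s' h => ?_) (fun i s' h => h.2.1) ?_ fun i s' hi ⟨hA, hi3, hI⟩ => ?_) ?_ ?_
  · rw [IdxExpr.eval_dimSq, h.1.idx 0 (by simp), hd]
  · refine ⟨(Agree.refl _ _ s).writeIdx (by simp) _, by simp, fun hdet => ⟨?_, ?_, ?_⟩⟩
    · rw [State.block_writeIdx, hinv hdet]
      rw [Nat.sub_zero, selection]
      exact isTiltedInverse_range x w (d ^ 2)
    · rw [State.writeIdx_idx_of_ne _ _ (by simp), h4]; simp [selection]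
    · simp [ListsRows, selection]
  · have hd' : s'.idx 0 = d := by rw [hA.idx 0 (by simp), hd]
    obtain ⟨hxi, hui, hQi⟩ := hrow i hi
    set A := s'.block d 4 with hAdef
    set I := selection x w u (d ^ 2) i with hIdef
    refine Runs.mono_time (Runs.seq (runs_vecMul (R := i) hd' (by simp) (by simp) ?_)
      fun s₁ ⟨hA₁, h₁⟩ =>
      Runs.seq ((runs_dot (R := i) ?_ (by simp) (by simp) ?_).mono le_rfl
        (Q' := fun s₂ => Agree [1, 2] [7, 9] s' s₂ ∧ s₂.row d 7 0 = x i ᵥ* A ∧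
          s₂.mat 9 0 0 = (x i ᵥ* A) ⬝ᵥ x i) fun s₂ ⟨hA₂, h₂⟩ => ?_) fun s₂ ⟨hA₂', h7, h9⟩ =>
      Runs.seq (Q := fun s₃ => Agree [1, 2, 4] [1, 7, 9] s' s₃ ∧ s₃.row d 7 0 = x i ᵥ* A ∧
        ((u i * (w i)⁻¹ < (x i ᵥ* A) ⬝ᵥ x i ∧ s₃.mat 9 0 0 = (x i ᵥ* A) ⬝ᵥ x i ∧
          s₃.idx 4 = s'.idx 4 + 1 ∧ s₃.row d 1 (s'.idx 4) = x i ∧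
          ∀ a, a ≠ s'.idx 4 → s₃.row d 1 a = s'.row d 1 a) ∨
        (¬ u i * (w i)⁻¹ < (x i ᵥ* A) ⬝ᵥ x i ∧ s₃.mat 9 0 0 = (x i ᵥ* A) ⬝ᵥ x i - (w i)⁻¹ ∧
          s₃.idx 4 = s'.idx 4 ∧ s₃.mat 1 = s'.mat 1)))
        (runs_branch (T := 14 * d + 10) (fun hp => ?_) fun hp => ?_) fun s₃ ⟨hA₃, h₃, hcase⟩ =>
      (runs_subRankOne (Rv := 0) (Rh := 0) ?_ (by simp) (by simp) (by simp) (fun _ _ => rfl)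
        (fun _ _ => rfl)).mono le_rfl fun t ⟨ht, hb⟩ => ?_) ?_
    · intro t ht; simp only [IdxExpr.eval]; rw [ht.idx 3 (by simp), hi3]
    · rw [hA₁.idx 0 (by simp), hd']
    · intro t ht; simp only [IdxExpr.eval]; rw [ht.idx 3 (by simp), hA₁.idx 3 (by simp), hi3]
    · refine ⟨(hA₁.mono (by simp) (by simp)).trans (hA₂.mono (by simp) (by simp)), ?_, ?_⟩
      · rw [hA₂.row_eq (by simp), h₁, hA.row_eq (by simp), hxi]
      · rw [h₂, h₁, hA₁.row_eq (by simp), hA.row_eq (by simp), hxi]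
    · simp only [Test.holds, RealExpr.eval, IdxExpr.eval] at hp
      rw [hA₂'.idx 3 (by simp), hi3, h9, hA₂'.mat 10 (by simp), hA₂'.mat 11 (by simp),
        hA.mat 10 (by simp), hA.mat 11 (by simp), hui, hQi] at hp
      refine Runs.mono_time (Runs.seq (runs_fillRow (R := s'.idx 4) (x i) ?_ (by simp) ?_ ?_)
        fun s₃ ⟨hA₃, h₃, hrest⟩ => runs_setIdx ?_) ?_
      · rw [hA₂'.idx 0 (by simp), hd']
      · intro t ht; simp only [IdxExpr.eval]; rw [ht.idx 4 (by simp), hA₂'.idx 4 (by simp)]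
      · intro t b ht hb _
        simp only [RealExpr.eval, IdxExpr.eval]
        rw [hb, ht.idx 3 (by simp), hA₂'.idx 3 (by simp), hi3, ht.mat 5 (by simp),
          hA₂'.mat 5 (by simp), hA.mat 5 (by simp), ← hxi]
        rfl
      · have hA₃' : Agree [1, 2] [1, 7, 9] s' s₃ :=
          (hA₂'.mono (by simp) (by simp)).trans (hA₃.mono (by simp) (by simp))
        refine ⟨(hA₃'.mono (by simp) (by simp)).writeIdx (by simp) _, ?_, Or.inl ⟨hp, ?_, ?_, ?_, ?_⟩⟩
        · rw [State.row_writeIdx, hA₃.row_eq (by simp), h7]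
        · rw [State.writeIdx_mat, hA₃.mat 9 (by simp), h9]
        · simp only [IdxExpr.eval, State.writeIdx_idx_self]
          rw [hA₃'.idx 4 (by simp)]
        · exact h₃
        · intro a ha
          change s₃.row d 1 a = _
          ext b
          rw [State.row, hrest a b (Or.inl ha), hA₂'.mat 1 (by simp)]
          rfl
      · simp only [IdxExpr.cost, RealExpr.cost]
        nlinarith
    · simp only [Test.holds, RealExpr.eval, IdxExpr.eval] at hp
      rw [hA₂'.idx 3 (by simp), hi3, h9, hA₂'.mat 10 (by simp), hA₂'.mat 11 (by simp),
        hA.mat 10 (by simp), hA.mat 11 (by simp), hui, hQi] at hp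
      refine Runs.mono_time (runs_setReal ?_) (by simp only [IdxExpr.cost, RealExpr.cost]; omega)
      simp only [RealExpr.eval, IdxExpr.eval]
      rw [hA₂'.idx 3 (by simp), hi3, h9, hA₂'.mat 11 (by simp), hA.mat 11 (by simp), hQi]
      refine ⟨(hA₂'.mono (by simp) (by simp)).writeReal (by simp) _ _ _, ?_, Or.inr ⟨hp, ?_, ?_, ?_⟩⟩
      · rw [← h7]; ext b; simp [State.row, State.writeReal]
      · rw [State.writeReal_mat_self, if_pos ⟨rfl, rfl⟩]
      · rw [State.writeReal_idx, hA₂'.idx 4 (by simp)]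
      · rw [State.writeReal_mat_of_ne _ _ _ _ (by simp), hA₂'.mat 1 (by simp)]
    · rw [hA₃.idx 0 (by simp), hd']
    · have hA₄ : Agree [1, 2, 4] [1, 4, 7, 9] s' t :=
        (hA₃.mono (by simp) (by simp)).trans (ht.mono (by simp) (by simp))
      refine ⟨by rw [hA₄.idx 3 (by simp), hi3],
        (hA.trans (hA₄.mono (by simp) (by simp))).writeIdx (by simp) _, by simp, fun hdet => ?_⟩
      obtain ⟨hT, hc, hL⟩ := hI hdet
      have hV : completionVolume x w (d ^ 2) 0 ∅ ≠ 0 := by rwa [completionVolume_range]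
      have hstep := hT.selection_step x (d ^ 2) (fun j _ => hw j) (fun j => (hw j).le)
        (fun j _ => hu0 j) (fun j _ => hu1 j) hV hi
      rw [h₃, hA₃.block_eq (by simp)] at hb
      rw [State.block_writeIdx, hb, State.writeIdx_idx_of_ne _ _ (by simp), ht.idx 4 (by simp)]
      have hlt := lt_of_mem_selection x w u (d ^ 2) i
      have hiI : i ∉ I := fun h => (hlt i h).false
      rcases hcase with ⟨htest, hp, hc₃, hnew, hold⟩ | ⟨htest, hp, hc₃, hold⟩
      · obtain ⟨hsel, htil⟩ := hstep.1 htest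
        refine ⟨hp ▸ htil, ?_, ?_⟩
        · rw [hsel, Finset.card_insert_of_notMem hiI, hc₃, hc]
        · rw [hsel]
          intro j hj
          rw [State.row_writeIdx, ht.row_eq (by simp)]
          rcases Finset.mem_insert.1 hj with rfl | hj
          · rw [Finset.filter_insert, if_neg (lt_irrefl _), Finset.filter_true_of_mem hlt, ← hc, hnew]
          · rw [Finset.filter_insert, if_neg (hlt j hj).not_gt, hold, hL j hj]
            rw [hc]
            refine (Finset.card_lt_card ?_).ne
            exact Finset.filter_ssubset.2 ⟨j, hj, lt_irrefl _⟩
      · obtain ⟨hsel, htil⟩ := hstep.2 htest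
        refine ⟨hp ▸ htil, ?_, ?_⟩
        · rw [hsel, hc₃]
          exact hc
        · rw [hsel]
          intro j hj
          rw [State.row_writeIdx, ht.row_eq (by simp), ← hL j hj]
          ext b
          simp [State.row, hold, hIdef]
    · simp only [IdxExpr.cost, RealExpr.cost, Test.cost]
      nlinarith
  · simp only [IdxExpr.dimSq, IdxExpr.cost]
    nlinarith
  · rintro s' ⟨hA, -, hI⟩
    exact ⟨hA, fun h => (hI h).2.2⟩

/-- One round: draw candidates, invert their Gram matrix, select, and set the flag `5` if the
acceptance test succeeds.  Besides the `d ^ 2` candidates one more vector is drawn, and not used,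
so that a round consumes as many vectors as uniform reals; the last uniform real serves for the
acceptance test. -/
def Cmd.round : Cmd :=
  .seq (.fillBlock 3 (.ofIdx (.const 0))) <|
  .seq .drawCandidates <|
  .seq (.drawSample 5 .dimSq) <|
  .seq (.drawUniform 10 .dimSq (.const 0)) <|
  .seq (.invert 3 4 13) <|
  .seq (.setIdx 4 (.const 0)) <|
  .seq .selectCandidates <|
  .branch (.realLt (.mul (.get 10 .dimSq (.const 0)) (.get 12 (.const 0) (.const 0)))
    (.get 13 (.const 0) (.const 0))) (.setIdx 5 (.const 1)) .skip

/-- Store the inverse and the determinant of the input in the matrices `2` and `12`, then repeat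
rounds until one is accepted. -/
def Cmd.volumeSampler : Cmd :=
  .seq (.invert 0 2 12) (.loop (.idxLt (.var 5) (.const 1)) .round)

/-- The weights `1 / (d xᵀ G x)` of the candidates of a round. -/
noncomputable def candidateWeight (G : Matrix (Fin d) (Fin d) ℝ) (x : ℕ → Fin d → ℝ) (i : ℕ) : ℝ :=
  (candidateNorm G (x i))⁻¹

/-- The Gram determinant of the weighted candidates of a round. -/
noncomputable def candidateDet (G : Matrix (Fin d) (Fin d) ℝ) (x : ℕ → Fin d → ℝ) : ℝ :=
  (gram x (candidateWeight G x) (Finset.range (d ^ 2))).det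

/-- The set of candidates selected in a round. -/
noncomputable def candidateSelection (G : Matrix (Fin d) (Fin d) ℝ) (x : ℕ → Fin d → ℝ)
    (u : ℕ → ℝ) : Finset ℕ :=
  selection x (candidateWeight G x) u (d ^ 2) (d ^ 2)

/-- The acceptance test of a round with candidates `x` and uniform reals `u`. -/
def Accepts (G : Matrix (Fin d) (Fin d) ℝ) (δ : ℝ) (x : ℕ → Fin d → ℝ) (u : ℕ → ℝ) : Prop :=
  u (d ^ 2) * δ < candidateDet G x

/-- What holds between rounds: the matrix `2` is `G` and entry `(0, 0)` of matrix `12` is `δ`. -/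
structure Ready (G : Matrix (Fin d) (Fin d) ℝ) (δ : ℝ) (s : State) : Prop where
  dim : s.idx 0 = d
  inv : s.block d 2 = G
  det : s.mat 12 0 0 = δ

open Classical in
theorem runs_round {G : Matrix (Fin d) (Fin d) ℝ} {δ : ℝ} {s : State} (hs : Ready G δ s)
    (hd1 : 1 ≤ d) (hδ : 0 ≤ δ) (x : ℕ → Fin d → ℝ) (u : ℕ → ℝ)
    (hx : ∀ n ≤ d ^ 2, xs (s.samples + n) = x n) (hu : ∀ n ≤ d ^ 2, us (s.uniforms + n) = u n)
    (hpos : ∀ i, 0 < candidateNorm G (x i)) (hu0 : ∀ i, 0 ≤ u i) (hu1 : ∀ i, u i < 1) :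
    Runs xs us .round (1000 * d ^ 4) s fun s' => Ready G δ s' ∧
      s'.samples = s.samples + (d ^ 2 + 1) ∧ s'.uniforms = s.uniforms + (d ^ 2 + 1) ∧
      s'.idx 5 = (if Accepts G δ x u then 1 else s.idx 5) ∧
      (Accepts G δ x u → ListsRows x (candidateSelection G x u) s') := by
  have hw : ∀ i, 0 < candidateWeight G x i := fun i => inv_pos.2 (hpos i)
  set M := gram x (candidateWeight G x) (Finset.range (d ^ 2)) with hM
  refine Runs.mono_time (Runs.seq (runs_fillBlock 0 hs.dim ?_) fun s₁ ⟨hA₁, h₁⟩ =>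
    Runs.seq (runs_drawCandidates (G := G) ?_ ?_ h₁ x u ?_ ?_)
      fun s₂ ⟨hidx₂, hmat₂, hsam₂, hun₂, hrow₂, hgr₂⟩ =>
    Runs.seq (Q := fun s₃ => s₃.idx = s₂.idx ∧ (∀ m, m ≠ 5 → s₃.mat m = s₂.mat m) ∧
      (∀ i < d ^ 2, s₃.row d 5 i = x i) ∧
      s₃.samples = s.samples + (d ^ 2 + 1) ∧ s₃.uniforms = s.uniforms + d ^ 2)
      (runs_drawSample ?_) fun s₃ ⟨hidx₃, hmat₃, hrow₃, hsam₃, hun₃⟩ =>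
    Runs.seq (Q := fun s₄ => s₄.idx = s₂.idx ∧ (∀ m, m ≠ 5 → m ≠ 10 → s₄.mat m = s₂.mat m) ∧
      s₄.block d 3 = M ∧ (∀ i < d ^ 2, s₄.row d 5 i = x i) ∧ (∀ i < d ^ 2 + 1, s₄.mat 10 i 0 = u i) ∧
      s₄.samples = s.samples + (d ^ 2 + 1) ∧ s₄.uniforms = s.uniforms + (d ^ 2 + 1))
      (runs_drawUniform ?_) fun s₄ ⟨hidx₄, hmat₄, hM₄, hrow₄, hu₄, hsam₄, hun₄⟩ =>
    Runs.seq (runs_invert ?_ hd1 (by simp) (by simp) (by simp) ?_) fun s₅ ⟨hA₅, hP₅⟩ =>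
    Runs.seq (Q := fun s₆ => Agree [1, 2, 3, 4] [6, 7, 8, 9, 4, 13] s₄ s₆ ∧
      IsPartialInverse (s₄.block d 3) d (s₆.block d 4) (s₆.mat 13 0 0) ∧ s₆.idx 4 = 0)
      (runs_setIdx ?_) fun s₆ ⟨hA₆, hP₆, h4₆⟩ =>
    Runs.seq ((runs_selectCandidates ?_ h4₆ x u (candidateWeight G x) hw hu0 hu1 ?_ ?_).mono le_rfl
      (Q' := fun s₇ => (s₇.idx 0 = d ∧ s₇.idx 5 = s.idx 5 ∧ s₇.mat 12 0 0 = δ ∧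
        s₇.block d 2 = G ∧ s₇.mat 10 (d ^ 2) 0 = u (d ^ 2) ∧
        s₇.samples = s.samples + (d ^ 2 + 1) ∧ s₇.uniforms = s.uniforms + (d ^ 2 + 1)) ∧
        s₇.mat 13 0 0 = candidateDet G x ∧
        (candidateDet G x ≠ 0 → ListsRows x (candidateSelection G x u) s₇))
        fun s₇ ⟨hA₇, hL₇⟩ => ?_) fun s₇ ⟨⟨h0, h5, h12, h2, h10, hsam, hun⟩, hdet₇, hL₇⟩ =>
    runs_branch (T := 2) (fun hp => ?_) fun hp => ?_) ?_
  · intro t a b _ _ _ _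
    simp [RealExpr.eval, IdxExpr.eval]
  · rw [hA₁.idx 0 (by simp), hs.dim]
  · rw [hA₁.block_eq (by simp), hs.inv]
  · intro n hn; rw [hA₁.samples, hx n hn.le]
  · intro n hn; rw [hA₁.uniforms, hu n hn.le]
  · rw [IdxExpr.eval_dimSq, hidx₂ 0 (by simp), hA₁.idx 0 (by simp), hs.dim]
    refine ⟨rfl, fun m hm => ?_, fun i hi => ?_, ?_, ?_⟩
    · ext a b; simp [State.writeRow, hm]
    · rw [← (hrow₂ i hi).1]; ext b; simp [State.row, State.writeRow, hi.ne]
    · simp [hsam₂, hA₁.samples, add_assoc]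
    · exact hun₂.trans (by rw [hA₁.uniforms])
  · rw [IdxExpr.eval_dimSq, hidx₃, hidx₂ 0 (by simp), hA₁.idx 0 (by simp), hs.dim, hun₃, hu _ le_rfl]
    refine ⟨hidx₃, fun m hm hm' => ?_, ?_, fun i hi => ?_, fun i hi => ?_, hsam₃, ?_⟩
    · exact (State.writeReal_mat_of_ne _ _ _ _ hm').trans (hmat₃ m hm)
    · rw [hM, show candidateWeight G x = fun i => (candidateNorm G (x i))⁻¹ from rfl, ← hgr₂]
      ext a b
      simp [State.block, State.writeReal, hmat₃ 3]
    · rw [← hrow₃ i hi]; ext b; simp [State.row, State.writeReal]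
    · refine (State.writeReal_mat_self _ _ _ _ _ _ _).trans ?_
      by_cases hid : i = d ^ 2
      · rw [if_pos ⟨hid, rfl⟩, hid]
      · rw [if_neg (by tauto), hmat₃ 10 (by simp), (hrow₂ i (by omega)).2.1]
    · simp [add_assoc]
  · rw [hidx₄, hidx₂ 0 (by simp), hA₁.idx 0 (by simp), hs.dim]
  · rw [hM₄]
    exact gram_posSemidef x (fun i => (hw i).le) _
  · refine ⟨(hA₅.mono (by simp) (by simp)).writeIdx (by simp) _, hP₅, by simp [IdxExpr.eval]⟩
  · rw [hA₆.idx 0 (by simp), hidx₄, hidx₂ 0 (by simp), hA₁.idx 0 (by simp), hs.dim]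
  · intro i hi
    rw [hA₆.row_eq (by simp), hrow₄ i hi, hA₆.mat 10 (by simp), hu₄ i (by omega),
      hA₆.mat 11 (by simp), hmat₄ 11 (by simp) (by simp), (hrow₂ i hi).2.2, candidateWeight, inv_inv]
    exact ⟨rfl, rfl, rfl⟩
  · intro hdet
    rw [hP₆.eq_inv (by rwa [hM₄]), hM₄]
  · have hA : Agree [1, 2, 3, 4] [1, 6, 7, 8, 9, 4, 13] s₄ s₇ :=
      (hA₆.mono (by simp) (by simp)).trans (hA₇.mono (by simp) (by simp))
    refine ⟨⟨?_, ?_, ?_, ?_, ?_, ?_, ?_⟩, ?_, hL₇⟩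
    · rw [hA.idx 0 (by simp), hidx₄, hidx₂ 0 (by simp), hA₁.idx 0 (by simp), hs.dim]
    · rw [hA.idx 5 (by simp), hidx₄, hidx₂ 5 (by simp), hA₁.idx 5 (by simp)]
    · rw [hA.mat 12 (by simp), hmat₄ 12 (by simp) (by simp), hmat₂ 12 (by simp),
        hA₁.mat 12 (by simp), hs.det]
    · rw [hA.block_eq (by simp), ← hs.inv]
      ext a b
      simp only [State.block, Matrix.of_apply]
      rw [hmat₄ 2 (by simp) (by simp), hmat₂ 2 (by simp), hA₁.mat 2 (by simp)]
    · rw [hA.mat 10 (by simp), hu₄ _ (by omega)]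
    · rw [hA.samples, hsam₄]
    · rw [hA.uniforms, hun₄]
    · rw [hA₇.mat 13 (by simp), hP₆.det_eq, hM₄]
      rfl
  · simp only [Test.holds, RealExpr.eval, IdxExpr.eval_dimSq, IdxExpr.eval, h0, h10, h12, hdet₇] at hp
    have hp' : Accepts G δ x u := hp
    refine runs_setIdx ⟨⟨?_, h2, h12⟩, hsam, hun, ?_, fun _ => ?_⟩
    · rw [State.writeIdx_idx_of_ne _ _ (by simp), h0]
    · rw [if_pos hp']; simp [IdxExpr.eval]
    · exact hL₇ ((mul_nonneg (hu0 _) hδ).trans_lt hp).ne'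
  · simp only [Test.holds, RealExpr.eval, IdxExpr.eval_dimSq, IdxExpr.eval, h0, h10, h12, hdet₇] at hp
    have hp' : ¬ Accepts G δ x u := hp
    refine (runs_skip ⟨⟨h0, h2, h12⟩, hsam, hun, ?_, fun h => absurd h hp'⟩).mono_time (by simp)
    rw [if_neg hp', h5]
  · simp only [IdxExpr.cost, RealExpr.cost, Test.cost, IdxExpr.dimSq]
    have e2 : d ≤ d ^ 2 := by nlinarith
    have e3 : d ^ 2 ≤ d ^ 3 := by nlinarith [sq_nonneg d]
    have e4 : d ^ 3 ≤ d ^ 4 := Nat.pow_le_pow_right hd1 (by simp)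
    nlinarith

/-- The inputs `z` of one round as an infinite sequence, whose values after the index `d ^ 2` do
not matter. -/
def ofBlock {α : Type*} (z : Fin (d ^ 2 + 1) → α) (i : ℕ) : α :=
  z ⟨min i (d ^ 2), Nat.lt_succ_of_le (min_le_right _ _)⟩

/-- The inputs of the round number `n`. -/
def batch {α : Type*} (d : ℕ) (a : ℕ → α) (n : ℕ) : ℕ → α :=
  ofBlock fun j : Fin (d ^ 2 + 1) => a (n * (d ^ 2 + 1) + j)

theorem batch_apply {α : Type*} (a : ℕ → α) (n : ℕ) {i : ℕ} (hi : i ≤ d ^ 2) :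
    batch d a n i = a (n * (d ^ 2 + 1) + i) := by
  simp [batch, ofBlock, hi]

/-- Correctness and cost of the program for inputs whose rounds are rejected up to the round number
`R`, which is accepted. -/
theorem exec_volumeSampler {S : Matrix (Fin d) (Fin d) ℝ} (hd1 : 1 ≤ d) (hS : S.PosDef)
    (hx : ∀ n, xs n ≠ 0) (hu0 : ∀ n, 0 ≤ us n) (hu1 : ∀ n, us n < 1) {R : ℕ}
    (hrej : ∀ n < R, ¬ Accepts S⁻¹ S.det (batch d xs n) (batch d us n))
    (hacc : Accepts S⁻¹ S.det (batch d xs R) (batch d us R)) :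
    ∃ s, Exec xs us .volumeSampler (initState S) s ∧
      s.samples = (R + 1) * (d ^ 2 + 1) ∧ s.time ≤ (R + 1) * (1400 * d ^ 4) ∧
      ListsRows (batch d xs R) (candidateSelection S⁻¹ (batch d xs R) (batch d us R)) s := by
  have hpos : ∀ n, 0 < candidateNorm S⁻¹ (xs n) := by
    intro n
    have := hS.inv.dotProduct_mulVec_pos (hx n)
    rw [star_trivial, Matrix.dotProduct_mulVec] at this
    exact mul_pos (by exact_mod_cast hd1) this
  have hloop : ∀ r n s, n + r = R → Ready S⁻¹ S.det s → s.samples = n * (d ^ 2 + 1) →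
      s.uniforms = n * (d ^ 2 + 1) → s.idx 5 = 0 →
      Runs xs us (.loop (.idxLt (.var 5) (.const 1)) .round) ((r + 1) * (1000 * d ^ 4 + 4) + 4) s
        fun s' => s'.samples = (R + 1) * (d ^ 2 + 1) ∧
        ListsRows (batch d xs R) (candidateSelection S⁻¹ (batch d xs R) (batch d us R)) s' := by
    intro r
    induction r with
    | zero =>
      intro n s hn hs hsam hun h5 τ
      have hn : n = R := hn
      subst hn
      have hp : (Test.idxLt (.var 5) (.const 1)).holds (s.at τ) := by
        simp [Test.holds, IdxExpr.eval, h5]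
      obtain ⟨s', t, ht, he, -, hsam', -, h5', hL⟩ := runs_round (xs := xs) (us := us) hs hd1
        hS.det_pos.le (batch d xs n) (batch d us n) (fun i hi => by rw [hsam, batch_apply _ _ hi])
        (fun i hi => by rw [hun, batch_apply _ _ hi]) (fun i => hpos _) (fun i => hu0 _) (fun i => hu1 _)
        (τ + (Test.idxLt (.var 5) (.const 1)).cost + 1)
      rw [if_pos hacc] at h5'
      refine ⟨s', (Test.idxLt (.var 5) (.const 1)).cost + 1 + t +
        ((Test.idxLt (.var 5) (.const 1)).cost + 1), ?_,
        .loopStep hp he ?_, ?_, hL hacc⟩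
      · simp only [Test.cost, IdxExpr.cost]; omega
      · have hexit : ¬ (Test.idxLt (.var 5) (.const 1)).holds
            (s'.at (τ + (Test.idxLt (.var 5) (.const 1)).cost + 1 + t)) := by
          simp [Test.holds, IdxExpr.eval, h5']
        convert Exec.loopStop hexit using 1
        simp only [State.at, State.tick]
        congr 1
        omega
      · rw [hsam', hsam]; ring
    | succ r ih =>
      intro n s hn hs hsam hun h5 τ
      have hp : (Test.idxLt (.var 5) (.const 1)).holds (s.at τ) := by
        simp [Test.holds, IdxExpr.eval, h5]
      obtain ⟨s', t, ht, he, hs', hsam', hun', h5', -⟩ := runs_round (xs := xs) (us := us) hs hd1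
        hS.det_pos.le (batch d xs n) (batch d us n) (fun i hi => by rw [hsam, batch_apply _ _ hi])
        (fun i hi => by rw [hun, batch_apply _ _ hi]) (fun i => hpos _) (fun i => hu0 _) (fun i => hu1 _)
        (τ + (Test.idxLt (.var 5) (.const 1)).cost + 1)
      rw [if_neg (hrej n (by omega)), h5] at h5'
      obtain ⟨s'', t', ht', he', hQ⟩ := ih (n + 1) s' (by omega) hs' (by rw [hsam', hsam]; ring)
        (by rw [hun', hun]; ring) h5' (τ + (Test.idxLt (.var 5) (.const 1)).cost + 1 + t)
      refine ⟨s'', (Test.idxLt (.var 5) (.const 1)).cost + 1 + t + t', ?_, .loopStep hp he ?_, hQ⟩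
      · simp only [Test.cost, IdxExpr.cost]
        rw [Nat.succ_mul (r + 1)]
        omega
      · convert he' using 2
        omega
  have h0 : (initState S).block d 0 = S := by
    ext i j; simp [initState, State.block]
  have hinvert := runs_invert (xs := xs) (us := us) (src := 0) (dst := 2) (det := 12)
    (s := initState S) (by simp [initState]) hd1 (by simp) (by simp) (by simp)
    (by rw [h0]; exact hS.posSemidef)
  obtain ⟨s, t, ht, he, hQ⟩ := hinvert.seq (fun s' ⟨hA, hP⟩ => hloop R 0 s' (Nat.zero_add R)
    ⟨by rw [hA.idx 0 (by simp)]; simp [initState], by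
      rw [hP.eq_inv (by rw [h0]; exact hS.det_pos.ne'), h0], by rw [hP.det_eq, h0]⟩
    (by rw [hA.samples]; simp [initState]) (by rw [hA.uniforms]; simp [initState])
    (by rw [hA.idx 5 (by simp)]; simp [initState])) 0
  refine ⟨s.at (0 + t), he, hQ.1, ?_, hQ.2⟩
  simp only [State.at]
  have e3 : d ^ 3 ≤ d ^ 4 := Nat.pow_le_pow_right hd1 (by simp)
  have e4 : 1 ≤ d ^ 4 := Nat.one_le_pow _ _ hd1
  nlinarith

end RealRAM

/-! ### Determinant and trace inequalities -/

section Inequalities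

/-- The inequality of arithmetic and geometric means, without roots. -/
theorem prod_le_pow_sum_div_card {ι : Type*} [Fintype ι] (z : ι → ℝ) (hz : ∀ i, 0 ≤ z i) :
    ∏ i, z i ≤ ((∑ i, z i) / Fintype.card ι) ^ Fintype.card ι := by
  rcases isEmpty_or_nonempty ι with h | h
  · simp
  have hcard : (0 : ℝ) < Fintype.card ι := by exact_mod_cast Fintype.card_pos
  have := Real.geom_mean_le_arith_mean Finset.univ (fun _ => 1) z (fun _ _ => zero_le_one)
    (by simpa using Fintype.card_pos) (fun i _ => hz i)
  simp only [Real.rpow_one, Finset.sum_const, Finset.card_univ, nsmul_eq_mul, mul_one,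
    one_mul] at this
  have hp : 0 ≤ ∏ i, z i := Finset.prod_nonneg fun i _ => hz i
  calc ∏ i, z i = ((∏ i, z i) ^ ((Fintype.card ι : ℝ)⁻¹)) ^ Fintype.card ι := by
        rw [← Real.rpow_natCast, ← Real.rpow_mul hp, inv_mul_cancel₀ hcard.ne', Real.rpow_one]
    _ ≤ _ := pow_le_pow_left₀ (Real.rpow_nonneg hp _) this _

variable {d : ℕ}

theorem Matrix.PosSemidef.det_le_pow_trace {H : Matrix (Fin d) (Fin d) ℝ} (hH : H.PosSemidef) :
    H.det ≤ (H.trace / d) ^ d := by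
  have h1 := hH.isHermitian.det_eq_prod_eigenvalues
  have h2 := hH.isHermitian.trace_eq_sum_eigenvalues
  simp only [RCLike.ofReal_real_eq_id, id] at h1 h2
  rw [h1, h2]
  simpa using prod_le_pow_sum_div_card hH.isHermitian.eigenvalues hH.eigenvalues_nonneg

open scoped MatrixOrder in
theorem Matrix.PosSemidef.exists_eq_transpose_mul_self {A : Matrix (Fin d) (Fin d) ℝ}
    (hA : A.PosSemidef) : ∃ B : Matrix (Fin d) (Fin d) ℝ, A = B.transpose * B := by
  obtain ⟨B, hB⟩ := CStarAlgebra.nonneg_iff_eq_star_mul_self.mp hA.nonneg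
  exact ⟨B, by simpa [Matrix.star_eq_conjTranspose] using hB⟩

theorem Matrix.PosSemidef.det_mul_le_pow_trace {A M : Matrix (Fin d) (Fin d) ℝ}
    (hA : A.PosSemidef) (hM : M.PosSemidef) : (A * M).det ≤ ((A * M).trace / d) ^ d := by
  obtain ⟨B, rfl⟩ := hA.exists_eq_transpose_mul_self
  have h := (hM.mul_mul_conjTranspose_same B).det_le_pow_trace
  have h1 : (B.transpose * B * M).trace = (B * M * B.conjTranspose).trace := by
    rw [Matrix.mul_assoc, Matrix.trace_mul_comm, Matrix.conjTranspose_eq_transpose_of_trivial]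
  have h2 : (B.transpose * B * M).det = (B * M * B.conjTranspose).det := by
    rw [Matrix.det_mul, Matrix.det_mul, Matrix.det_mul, Matrix.det_mul,
      Matrix.conjTranspose_eq_transpose_of_trivial]
    ring
  rwa [h1, h2]

/-- A Kantorovich-type inequality: numbers whose reciprocals lie in `[1 - ε, 1 + ε]` with
`ε = 1 / √(2 d)` have comparable geometric and arithmetic means. -/
theorem half_pow_mean_le_prod (hd : 1 ≤ d) (l : Fin d → ℝ) {ε : ℝ} (hε : 2 * d * ε ^ 2 = 1)
    (hl : ∀ i, 0 < l i) (h1 : ∀ i, (1 - ε) * l i ≤ 1) (h2 : ∀ i, 1 ≤ (1 + ε) * l i) :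
    1 / 2 * ((∑ i, l i) / d) ^ d ≤ ∏ i, l i := by
  have hd0 : (0 : ℝ) < d := by exact_mod_cast hd
  have hd1 : (1 : ℝ) ≤ d := by exact_mod_cast hd
  have hε2 : ε ^ 2 ≤ 1 / 2 := by nlinarith [sq_nonneg ε]
  set a := (∑ i, (l i)⁻¹) / d with ha
  set b := (∑ i, l i) / d with hb
  -- The chord of the convex function `1 / l` over the range of the `l i`.
  have hpt : ∀ i, (l i)⁻¹ + (1 - ε ^ 2) * l i ≤ 2 := by
    intro i
    have h := mul_nonneg (sub_nonneg.2 (h1 i)) (sub_nonneg.2 (h2 i))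
    have h3 : (l i) * ((l i)⁻¹ + (1 - ε ^ 2) * l i - 2) ≤ 0 := by
      rw [mul_sub, mul_add, mul_inv_cancel₀ (hl i).ne']
      nlinarith
    have := nonpos_of_mul_nonpos_right h3 (hl i)
    linarith
  have hab : a + (1 - ε ^ 2) * b ≤ 2 := by
    have hs := Finset.sum_le_sum fun i (_ : i ∈ Finset.univ) => hpt i
    rw [Finset.sum_add_distrib, ← Finset.mul_sum] at hs
    simp only [Finset.sum_const, Finset.card_univ, Fintype.card_fin, nsmul_eq_mul] at hs
    rw [ha, hb, ← mul_div_assoc, ← add_div, div_le_iff₀ hd0]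
    linarith
  have : Nonempty (Fin d) := ⟨⟨0, hd⟩⟩
  have ha0 : 0 < a := div_pos (Finset.sum_pos (fun i _ => inv_pos.2 (hl i)) Finset.univ_nonempty) hd0
  have hb0 : 0 < b := div_pos (Finset.sum_pos (fun i _ => hl i) Finset.univ_nonempty) hd0
  have hprod : (1 - ε ^ 2) * b * a ≤ 1 := by
    have ht : 0 ≤ (1 - ε ^ 2) * b := mul_nonneg (by linarith) hb0.le
    generalize (1 - ε ^ 2) * b = t at ht hab
    have hsq := pow_le_pow_left₀ (add_nonneg ha0.le ht) hab 2
    nlinarith [sq_nonneg (a - t)]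
  -- The arithmetic mean `a` of the reciprocals dominates their geometric mean.
  have hAM : (∏ i, l i)⁻¹ ≤ a ^ d := by
    have := prod_le_pow_sum_div_card (fun i => (l i)⁻¹) (fun i => (inv_pos.2 (hl i)).le)
    rwa [Finset.prod_inv_distrib, Fintype.card_fin] at this
  have hPpos : 0 < ∏ i, l i := Finset.prod_pos fun i _ => hl i
  have hbern : 1 / 2 ≤ (1 - ε ^ 2) ^ d := by
    have := one_add_mul_le_pow (a := -ε ^ 2) (by linarith) d
    rw [← sub_eq_add_neg] at this
    linarith
  have hpow : ((1 - ε ^ 2) * b) ^ d * a ^ d ≤ 1 := by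
    rw [← mul_pow]
    exact pow_le_one₀ (mul_nonneg (mul_nonneg (by linarith) hb0.le) ha0.le) hprod
  calc 1 / 2 * b ^ d ≤ (1 - ε ^ 2) ^ d * b ^ d :=
        mul_le_mul_of_nonneg_right hbern (pow_nonneg hb0.le _)
    _ = ((1 - ε ^ 2) * b) ^ d := (mul_pow _ _ _).symm
    _ = ((1 - ε ^ 2) * b) ^ d * (∏ i, l i)⁻¹ * ∏ i, l i := by
        rw [mul_assoc, inv_mul_cancel₀ hPpos.ne', mul_one]
    _ ≤ ((1 - ε ^ 2) * b) ^ d * a ^ d * ∏ i, l i := by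
        gcongr
        exact pow_nonneg (mul_nonneg (by linarith) hb0.le) _
    _ ≤ 1 * ∏ i, l i := by gcongr
    _ = _ := one_mul _

/-- If `S` approximates `M` up to a factor `1 ± 1 / √(2 d)`, then `M S⁻¹` has eigenvalues so close
to each other that the inequality between its determinant and its trace loses a factor of at
most two. -/
theorem half_pow_trace_le_det (hd : 1 ≤ d) {S M : Matrix (Fin d) (Fin d) ℝ} {ε : ℝ}
    (hε : 2 * d * ε ^ 2 = 1) (hS : S.PosDef) (hM : M.PosDef) (h1 : (S - (1 - ε) • M).PosSemidef)
    (h2 : ((1 + ε) • M - S).PosSemidef) :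
    1 / 2 * ((M * S⁻¹).trace / d) ^ d ≤ (M * S⁻¹).det := by
  obtain ⟨B, hB⟩ := hS.inv.posSemidef.exists_eq_transpose_mul_self
  have hBdet : IsUnit B.det := by
    have h := hS.inv.det_pos
    rw [hB, Matrix.det_mul, Matrix.det_transpose] at h
    exact isUnit_iff_ne_zero.2 fun h0 => by simp [h0] at h
  have hBS : B * S * B.transpose = 1 := by
    have hSinv : S = B⁻¹ * (B.transpose)⁻¹ := by
      rw [← Matrix.mul_inv_rev, ← hB, Matrix.nonsing_inv_nonsing_inv _ hS.det_pos.ne'.isUnit]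
    rw [hSinv, ← Matrix.mul_assoc, Matrix.mul_nonsing_inv _ hBdet, Matrix.one_mul,
      Matrix.nonsing_inv_mul _ (by rwa [Matrix.det_transpose])]
  -- `H` is similar to `M S⁻¹` and, unlike the latter, symmetric.
  set H := B * M * B.transpose with hHdef
  have hH : H.PosDef := by
    refine Matrix.PosSemidef.posDef_iff_det_ne_zero ?_ |>.2 ?_
    · simpa using hM.posSemidef.mul_mul_conjTranspose_same B
    · rw [hHdef, Matrix.det_mul, Matrix.det_mul, Matrix.det_transpose]
      exact mul_ne_zero (mul_ne_zero hBdet.ne_zero hM.det_pos.ne') hBdet.ne_zero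
  have hH1 : (1 - (1 - ε) • H).PosSemidef := by
    have := h1.mul_mul_conjTranspose_same B
    rwa [Matrix.conjTranspose_eq_transpose_of_trivial, Matrix.mul_sub, Matrix.sub_mul, hBS,
      Matrix.mul_smul, Matrix.smul_mul] at this
  have hH2 : ((1 + ε) • H - 1).PosSemidef := by
    have := h2.mul_mul_conjTranspose_same B
    rwa [Matrix.conjTranspose_eq_transpose_of_trivial, Matrix.mul_sub, Matrix.sub_mul, hBS,
      Matrix.mul_smul, Matrix.smul_mul] at this
  have htr : (M * S⁻¹).trace = H.trace := by
    rw [hB, hHdef, ← Matrix.mul_assoc, Matrix.trace_mul_comm, ← Matrix.mul_assoc]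
  have hdet : (M * S⁻¹).det = H.det := by
    rw [hB, hHdef]
    simp only [Matrix.det_mul]
    ring
  have hev : ∀ i, 0 ≤ 1 - (1 - ε) * hH.isHermitian.eigenvalues i ∧
      0 ≤ (1 + ε) * hH.isHermitian.eigenvalues i - 1 := by
    intro i
    set v : Fin d → ℝ := ⇑(hH.isHermitian.eigenvectorBasis i)
    have hv : H *ᵥ v = hH.isHermitian.eigenvalues i • v := hH.isHermitian.mulVec_eigenvectorBasis i
    have hv1 : v ⬝ᵥ v = 1 := by
      have := hH.isHermitian.eigenvectorBasis.orthonormal.1 i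
      have h2 := EuclideanSpace.real_norm_sq_eq (hH.isHermitian.eigenvectorBasis i)
      rw [this] at h2
      simp only [dotProduct, v, ← sq]
      linarith
    have e1 := hH1.dotProduct_mulVec_nonneg v
    have e2 := hH2.dotProduct_mulVec_nonneg v
    rw [star_trivial, Matrix.sub_mulVec, Matrix.smul_mulVec, Matrix.one_mulVec, hv, smul_smul,
      dotProduct_sub, dotProduct_smul, hv1] at e1 e2
    simp only [smul_eq_mul, mul_one] at e1 e2
    exact ⟨e1, e2⟩
  have e1 := hH.isHermitian.det_eq_prod_eigenvalues
  have e2 := hH.isHermitian.trace_eq_sum_eigenvalues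
  simp only [RCLike.ofReal_real_eq_id, id] at e1 e2
  rw [htr, hdet, e1, e2]
  exact half_pow_mean_le_prod hd _ hε hH.eigenvalues_pos (fun i => by linarith [(hev i).1])
    (fun i => by linarith [(hev i).2])

/-- A union bound in disguise: `d` independent uniform choices among `d ^ 2` elements are distinct
with probability at least `1 / 2`. -/
theorem half_le_descFactorial (hd : 1 ≤ d) :
    1 / 2 * ((d : ℝ) ^ 2) ^ d ≤ ((d ^ 2).descFactorial d : ℝ) := by
  have hd0 : (0 : ℝ) < d := by exact_mod_cast hd
  have key : ∀ m ≤ d, (1 - m * (m - 1) / (2 * (d : ℝ) ^ 2)) * ((d : ℝ) ^ 2) ^ m ≤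
      ((d ^ 2).descFactorial m : ℝ) := by
    intro m
    induction m with
    | zero => simp
    | succ m ih =>
      intro hm
      have ih := ih (by omega)
      have hmd : m ≤ d ^ 2 := by nlinarith
      rw [Nat.descFactorial_succ]
      push_cast [Nat.cast_sub hmd]
      have hm' : (m : ℝ) + 1 ≤ d := by exact_mod_cast hm
      have hm0 : (0 : ℝ) ≤ m := Nat.cast_nonneg m
      have hpos : (0 : ℝ) ≤ (d : ℝ) ^ 2 - m := by nlinarith
      refine le_trans ?_ (mul_le_mul_of_nonneg_left ih hpos)
      rw [pow_succ ((d : ℝ) ^ 2) m, ← sub_nonneg]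
      have : ((d : ℝ) ^ 2 - m) * ((1 - m * (m - 1) / (2 * (d : ℝ) ^ 2)) * ((d : ℝ) ^ 2) ^ m) -
          (1 - (m + 1) * (m + 1 - 1) / (2 * (d : ℝ) ^ 2)) * (((d : ℝ) ^ 2) ^ m * (d : ℝ) ^ 2) =
          ((d : ℝ) ^ 2) ^ m * (m * (m * (m - 1) / (2 * (d : ℝ) ^ 2))) := by
        field_simp
        ring
      rw [this]
      rcases Nat.eq_zero_or_pos m with rfl | hmpos
      · simp
      · have : (1 : ℝ) ≤ m := by exact_mod_cast hmpos
        have : (0 : ℝ) ≤ m - 1 := by linarith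
        positivity
  refine le_trans ?_ (key d le_rfl)
  gcongr
  rw [le_sub_comm, div_le_iff₀ (by positivity)]
  nlinarith

end Inequalities

/-! ### One round with fixed candidates -/

section OneRound

open RealRAM

/-- The uniform law on the unit interval. -/
noncomputable def uniformLaw : Measure ℝ := volume.restrict (Set.Icc (0 : ℝ) 1)

instance : IsProbabilityMeasure uniformLaw := ⟨by simp [uniformLaw]⟩

theorem uniformLaw_setOf_mul_lt {a b : ℝ} (ha : 0 ≤ a) (hab : a ≤ b) :
    uniformLaw {u | u * b < a} = ENNReal.ofReal (a / b) := by
  rcases (ha.trans hab).eq_or_lt with hb | hb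
  · obtain rfl : a = 0 := le_antisymm (hab.trans hb.ge) ha
    simp [← hb]
  · have h1 : {u | u * b < a} = Set.Iio (a / b) := by
      ext u; simp [lt_div_iff₀ hb]
    have h2 : Set.Iio (a / b) ∩ Set.Icc (0 : ℝ) 1 = Set.Ico 0 (a / b) := by
      ext u
      have : a / b ≤ 1 := div_le_one_of_le₀ hab hb.le
      simp only [Set.mem_inter_iff, Set.mem_Iio, Set.mem_Icc, Set.mem_Ico]
      constructor
      · tauto
      · rintro ⟨h, h'⟩; exact ⟨h', h, h'.le.trans this⟩
    rw [h1, uniformLaw, Measure.restrict_apply measurableSet_Iio, h2, Real.volume_Ico, sub_zero]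

theorem uniformLaw_setOf_mul_lt_iff {a b : ℝ} (ha : 0 ≤ a) (hab : a ≤ b) (p : Prop) [Decidable p] :
    uniformLaw {u | u * b < a ↔ p} = ENNReal.ofReal (if p then a / b else 1 - a / b) := by
  split_ifs with hp
  · simpa [hp] using uniformLaw_setOf_mul_lt ha hab
  · have h : {u | u * b < a ↔ p} = {u | u * b < a}ᶜ := by ext u; simp [hp]
    rw [h, prob_compl_eq_one_sub (measurableSet_lt (by fun_prop) (by fun_prop)),
      uniformLaw_setOf_mul_lt ha hab,
      ENNReal.ofReal_sub _ (div_nonneg ha (ha.trans hab)), ENNReal.ofReal_one]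

variable {d : ℕ}

/-- With fixed candidates, the uniform reals leading to acceptance and to the selection of `J`
form a box, one factor per step, whose volume telescopes. -/
theorem pi_uniformLaw_selection (x : ℕ → Fin d → ℝ) {w : ℕ → ℝ} (hw : ∀ j, 0 ≤ w j)
    {J : Finset ℕ} (hJ : ∀ j ∈ J, j < d ^ 2) {δ : ℝ}
    (hδ : completionVolume x w (d ^ 2) 0 ∅ ≤ δ) :
    (Measure.pi fun _ : Fin (d ^ 2 + 1) => uniformLaw)
      {u | ofBlock u (d ^ 2) * δ < completionVolume x w (d ^ 2) 0 ∅ ∧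
        selection x w (ofBlock u) (d ^ 2) (d ^ 2) = J} =
      ENNReal.ofReal (subsetVolume x w J / δ) := by
  set k := d ^ 2 with hk
  set V := completionVolume x w k 0 ∅ with hV
  have hV0 : 0 ≤ V := completionVolume_nonneg x hw _ _ _
  -- `B i` is the range of `u i`: for `i < k` it governs the decision on `i`, for `i = k` acceptance.
  let B : ℕ → Set ℝ := fun i => if i < k then
    {u | u * completionVolume x w (k - i) i (J.filter (· < i)) <
        completionVolume x w (k - i - 1) (i + 1) (insert i (J.filter (· < i))) ↔ i ∈ J}
    else {u | u * δ < V}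
  have hbox : {u : Fin (k + 1) → ℝ | ofBlock u k * δ < V ∧ selection x w (ofBlock u) k k = J} =
      Set.univ.pi fun i : Fin (k + 1) => B i := by
    ext u
    have hstep : ∀ i : Fin k, u i.castSucc = ofBlock u (i : ℕ) := by
      intro i
      exact congrArg u (Fin.ext (min_eq_left i.2.le).symm)
    have hfinal : u (Fin.last k) = ofBlock u k := by
      simp only [ofBlock]; congr 1; ext; simp [hk]
    have hBlt : ∀ i (hi : i < k), B i = _ := fun i hi => if_pos hi
    have hBk : B k = _ := if_neg (lt_irrefl _)
    rw [Set.mem_univ_pi, Fin.forall_fin_succ', hfinal, Fin.val_last, hBk]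
    constructor
    · rintro ⟨hacc, hsel⟩
      refine ⟨fun i => ?_, hacc⟩
      rw [hstep, Fin.val_castSucc, hBlt i i.2]
      exact (selection_eq_iff x w _ k hJ).1 hsel i i.2
    · rintro ⟨hsel, hacc⟩
      refine ⟨hacc, (selection_eq_iff x w _ k hJ).2 fun i hi => ?_⟩
      have := hsel ⟨i, hi⟩
      rwa [hstep, Fin.val_castSucc, hBlt i hi] at this
  have hB : ∀ i < k, uniformLaw (B i) = ENNReal.ofReal
      (if i ∈ J then stepProbability x w k J i else 1 - stepProbability x w k J i) := by
    intro i hi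
    have h2 : B i = _ := if_pos hi
    rw [h2]
    refine uniformLaw_setOf_mul_lt_iff (completionVolume_nonneg x hw _ _ _) ?_ _
    have hr : k - i = (k - i - 1) + 1 := by omega
    conv_rhs => rw [hr, completionVolume]
    exact le_add_of_nonneg_left (completionVolume_nonneg x hw _ _ _)
  have hlast : uniformLaw (B k) = ENNReal.ofReal (V / δ) := by
    have h2 : B k = _ := if_neg (lt_irrefl _)
    rw [h2]
    exact uniformLaw_setOf_mul_lt hV0 hδ
  rw [hbox, Measure.pi_pi, Fin.prod_univ_eq_prod_range (fun i => uniformLaw (B i)) (k + 1),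
    Finset.prod_range_succ, hlast, Finset.prod_congr rfl fun i hi => hB i (Finset.mem_range.1 hi),
    ← ENNReal.ofReal_prod_of_nonneg, ← ENNReal.ofReal_mul',
    ← completionVolume_mul_prod_stepProbability x hw k hJ]
  · congr 1; ring
  · exact div_nonneg hV0 (hV0.trans hδ)
  · intro i hi
    split_ifs
    · exact stepProbability_nonneg x hw k J i
    · exact sub_nonneg.2 (stepProbability_le_one x hw J (Finset.mem_range.1 hi))

/-- The rows of a sequence that are listed in `J`, in increasing order of the index; the zero
matrix if `J` does not have `d` elements. -/
noncomputable def listed (x : ℕ → Fin d → ℝ) (J : Finset ℕ) : Fin d → Fin d → ℝ :=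
  if h : J.card = d then fun c => x (J.orderEmbOfFin h c) else 0

/-- The row number of the element number `c` of `J` is the number `c` of smaller elements. -/
theorem RealRAM.ListsRows.output_eq {x : ℕ → Fin d → ℝ} {J : Finset ℕ} {s : State}
    (h : ListsRows x J s) (hJ : J.card = d) : s.output d = listed x J := by
  funext c
  rw [listed, dif_pos hJ, ← h _ (J.orderEmbOfFin_mem hJ c)]
  have hc : (J.filter (· < J.orderEmbOfFin hJ c)).card = c := by
    have : J.filter (· < J.orderEmbOfFin hJ c) =
        (Finset.Iio c).map (J.orderEmbOfFin hJ).toEmbedding := by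
      ext j
      simp only [Finset.mem_filter, Finset.mem_map, Finset.mem_Iio]
      constructor
      · rintro ⟨hj, hlt⟩
        obtain ⟨b, rfl⟩ : j ∈ Set.range (J.orderEmbOfFin hJ) := by
          rw [Finset.range_orderEmbOfFin]; exact hj
        exact ⟨b, by simpa using hlt, rfl⟩
      · rintro ⟨b, hb, rfl⟩
        exact ⟨J.orderEmbOfFin_mem hJ b, by simpa using hb⟩
    rw [this, Finset.card_map, Fin.card_Iio]
  rw [hc]
  rfl

variable {G : Matrix (Fin d) (Fin d) ℝ}

theorem candidateNorm_nonneg (hG : G.PosSemidef) (y : Fin d → ℝ) : 0 ≤ candidateNorm G y := by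
  have := hG.dotProduct_mulVec_nonneg y
  rw [star_trivial, Matrix.dotProduct_mulVec] at this
  exact mul_nonneg (Nat.cast_nonneg _) this

theorem candidateWeight_nonneg (hG : G.PosSemidef) (x : ℕ → Fin d → ℝ) (i : ℕ) :
    0 ≤ candidateWeight G x i :=
  inv_nonneg.2 (candidateNorm_nonneg hG _)

theorem candidateDet_eq_completionVolume (x : ℕ → Fin d → ℝ) :
    candidateDet G x = completionVolume x (candidateWeight G x) (d ^ 2) 0 ∅ :=
  (completionVolume_range _ _ _).symm

/-- With a regular Gram matrix, exactly `d` candidates are selected, because other selections have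
volume zero. -/
theorem card_candidateSelection (hG : G.PosSemidef) {x : ℕ → Fin d → ℝ} {u : ℕ → ℝ}
    (hu0 : ∀ n, 0 ≤ u n) (hu1 : ∀ n, u n < 1) (hx : candidateDet G x ≠ 0) :
    (candidateSelection G x u).card = d := by
  rw [candidateDet_eq_completionVolume] at hx
  have := completionVolume_selection_ne_zero x (d ^ 2) (candidateWeight_nonneg hG x)
    (fun j _ => hu0 j) (fun j _ => hu1 j) hx le_rfl
  rw [Nat.sub_self, completionVolume, subsetVolume] at this
  by_contra hne
  exact this (if_neg hne)

/-- The acceptance probability is at most one: the weighted Gram matrix `H` of `d ^ 2` candidates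
satisfies `tr (S⁻¹ H) ≤ d`, so that `det (S⁻¹ H) ≤ 1`. -/
theorem candidateDet_inv_le {S : Matrix (Fin d) (Fin d) ℝ} (hS : S.PosDef) (x : ℕ → Fin d → ℝ) :
    candidateDet S⁻¹ x ≤ S.det := by
  set w := candidateWeight S⁻¹ x
  have hG : S⁻¹.PosSemidef := hS.inv.posSemidef
  have hH := gram_posSemidef x (candidateWeight_nonneg hG x) (Finset.range (d ^ 2))
  have h := hG.det_mul_le_pow_trace hH
  have htr : (S⁻¹ * gram x w (Finset.range (d ^ 2))).trace ≤ d := by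
    rw [gram, Finset.mul_sum, Matrix.trace_sum]
    calc ∑ i ∈ Finset.range (d ^ 2), (S⁻¹ * w i • Matrix.vecMulVec (x i) (x i)).trace
        ≤ ∑ i ∈ Finset.range (d ^ 2), (d : ℝ)⁻¹ := by
          refine Finset.sum_le_sum fun i _ => ?_
          rw [Matrix.mul_smul, Matrix.trace_smul, Matrix.mul_vecMulVec, Matrix.trace_vecMulVec,
            smul_eq_mul]
          have hw : w i = (d * ((x i ᵥ* S⁻¹) ⬝ᵥ x i))⁻¹ := rfl
          rw [hw, ← Matrix.dotProduct_mulVec, dotProduct_comm (S⁻¹ *ᵥ x i), mul_inv, mul_assoc]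
          exact mul_le_of_le_one_right (by positivity) inv_mul_le_one
      _ ≤ d := by
          rw [Finset.sum_const, Finset.card_range, nsmul_eq_mul, Nat.cast_pow, sq]
          rcases eq_or_ne (d : ℝ) 0 with h0 | h0
          · simp [h0]
          · rw [mul_inv_cancel_right₀ h0]
  have htr0 : 0 ≤ (S⁻¹ * gram x w (Finset.range (d ^ 2))).trace := by
    rw [gram, Finset.mul_sum, Matrix.trace_sum]
    refine Finset.sum_nonneg fun i _ => ?_
    rw [Matrix.mul_smul, Matrix.trace_smul, Matrix.mul_vecMulVec, Matrix.trace_vecMulVec,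
      dotProduct_comm]
    exact mul_nonneg (candidateWeight_nonneg hG x i)
      (by simpa using hG.dotProduct_mulVec_nonneg (x i))
  have h1 : (S⁻¹ * gram x w (Finset.range (d ^ 2))).det ≤ 1 :=
    h.trans (pow_le_one₀ (by positivity) (div_le_one_of_le₀ htr (by positivity)))
  rw [Matrix.det_mul, Matrix.det_nonsing_inv, Ring.inverse_eq_inv'] at h1
  rwa [inv_mul_le_iff₀ hS.det_pos, mul_one] at h1

/-! ### Product measures -/

theorem Measure.pi_withDensity {ι α : Type*} [Fintype ι] [MeasurableSpace α] (μ : Measure α)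
    [IsProbabilityMeasure μ] {f : α → ENNReal} (hf : Measurable f) [SigmaFinite (μ.withDensity f)] :
    Measure.pi (fun _ : ι => μ.withDensity f) =
      (Measure.pi fun _ : ι => μ).withDensity fun a => ∏ i, f (a i) := by
  refine Measure.pi_eq fun s hs => ?_
  have hms : MeasurableSet (Set.univ.pi s) := MeasurableSet.univ_pi hs
  rw [withDensity_apply _ hms, ← lintegral_indicator hms]
  have h1 : (Set.univ.pi s).indicator (fun a : ι → α => ∏ i, f (a i)) =
      fun a => ∏ i, (s i).indicator f (a i) := by
    funext a
    by_cases ha : a ∈ Set.univ.pi s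
    · rw [Set.indicator_of_mem ha]
      exact Finset.prod_congr rfl fun i _ => (Set.indicator_of_mem (ha i trivial) f).symm
    · rw [Set.indicator_of_notMem ha]
      obtain ⟨i, hi⟩ : ∃ i, a i ∉ s i := by simpa [Set.mem_univ_pi] using ha
      exact (Finset.prod_eq_zero (Finset.mem_univ i) (Set.indicator_of_notMem hi f)).symm
  have hmeas : ∀ i, Measurable ((s i).indicator f) := fun i => hf.indicator (hs i)
  rw [h1, lintegral_prod_eq_prod_lintegral_of_indepFun Finset.univ
    (fun i (a : ι → α) => (s i).indicator f (a i))
    (iIndepFun_pi fun i => (hmeas i).aemeasurable) fun i => (hmeas i).comp (measurable_pi_apply i)]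
  refine Finset.prod_congr rfl fun i _ => ?_
  rw [withDensity_apply _ (hs i), ← lintegral_indicator (hs i)]
  exact ((measurePreserving_eval (fun _ : ι => μ) i).lintegral_comp (hmeas i))

theorem measurePreserving_pi_comp_injective {ι κ α : Type*} [Fintype ι] [Fintype κ]
    [MeasurableSpace α] (μ : Measure α) [IsProbabilityMeasure μ] {e : κ → ι}
    (he : Function.Injective e) :
    MeasurePreserving (fun (a : ι → α) k => a (e k)) (Measure.pi fun _ => μ)
      (Measure.pi fun _ => μ) := by
  refine ⟨by fun_prop, ?_⟩
  have := Measure.map_infinitePi_infinitePi_of_inj (P := fun _ : ι => μ) he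
  rwa [Measure.infinitePi_eq_pi, Measure.infinitePi_eq_pi] at this

/-! ### The mean squared volume of independent rows -/

theorem Matrix.det_transpose_mul_self_eq_sum (X : Matrix (Fin d) (Fin d) ℝ) :
    (Xᵀ * X).det = ∑ σ : Equiv.Perm (Fin d), ∑ τ : Equiv.Perm (Fin d),
      (Equiv.Perm.sign σ : ℝ) * (Equiv.Perm.sign τ : ℝ) * ∏ i, X i (σ i) * X i (τ i) := by
  rw [Matrix.det_mul, ← Matrix.det_transpose X, Matrix.det_apply', Finset.sum_mul_sum]
  refine Finset.sum_congr rfl fun σ _ => Finset.sum_congr rfl fun τ _ => ?_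
  simp only [Matrix.transpose_apply, Finset.prod_mul_distrib]
  ring

theorem integrable_det_transpose_mul_self {D : Measure (Fin d → ℝ)} [IsProbabilityMeasure D]
    (hD : ∀ i j, Integrable (fun x : Fin d → ℝ => x i * x j) D) :
    Integrable (fun X : Fin d → Fin d → ℝ => ((Matrix.of X)ᵀ * Matrix.of X).det)
      (Measure.pi fun _ => D) := by
  simp_rw [Matrix.det_transpose_mul_self_eq_sum]
  refine integrable_finsetSum _ fun σ _ => integrable_finsetSum _ fun τ _ => ?_
  exact (Integrable.fintype_prod (f := fun i (x : Fin d → ℝ) => x (σ i) * x (τ i))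
    fun i => hD _ _).const_mul _

/-- The mean of a squared determinant: in the double sum over permutations, each `σ` contributes the
expansion of `det Σ`, where `Σ` is the second moment matrix. -/
theorem integral_det_transpose_mul_self {D : Measure (Fin d → ℝ)} [IsProbabilityMeasure D]
    (hD : ∀ i j, Integrable (fun x : Fin d → ℝ => x i * x j) D) :
    ∫ X : Fin d → Fin d → ℝ, ((Matrix.of X)ᵀ * Matrix.of X).det ∂(Measure.pi fun _ => D) =
      d.factorial * (secondMoment D).det := by
  have hint : ∀ σ τ : Equiv.Perm (Fin d), Integrable (fun X : Fin d → Fin d → ℝ =>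
      (Equiv.Perm.sign σ : ℝ) * (Equiv.Perm.sign τ : ℝ) * ∏ i, X i (σ i) * X i (τ i))
      (Measure.pi fun _ => D) := fun σ τ =>
    (Integrable.fintype_prod (f := fun i (x : Fin d → ℝ) => x (σ i) * x (τ i))
      fun i => hD _ _).const_mul _
  simp_rw [Matrix.det_transpose_mul_self_eq_sum, Matrix.of_apply]
  rw [integral_finsetSum _ fun σ _ => integrable_finsetSum _ fun τ _ => hint σ τ]
  have hσ : ∀ σ : Equiv.Perm (Fin d), ∫ X : Fin d → Fin d → ℝ, ∑ τ : Equiv.Perm (Fin d),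
      (Equiv.Perm.sign σ : ℝ) * (Equiv.Perm.sign τ : ℝ) * ∏ i, X i (σ i) * X i (τ i)
      ∂(Measure.pi fun _ => D) = (secondMoment D).det := by
    intro σ
    rw [integral_finsetSum _ fun τ _ => hint σ τ]
    have h1 : ∀ τ : Equiv.Perm (Fin d), ∫ X : Fin d → Fin d → ℝ,
        (Equiv.Perm.sign σ : ℝ) * (Equiv.Perm.sign τ : ℝ) * ∏ i, X i (σ i) * X i (τ i)
        ∂(Measure.pi fun _ => D) = (Equiv.Perm.sign σ : ℝ) *
          ((Equiv.Perm.sign τ : ℝ) * ∏ i, ((secondMoment D).submatrix σ id)ᵀ (τ i) i) := by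
      intro τ
      rw [integral_const_mul, mul_assoc,
        integral_fintype_prod_eq_prod (fun i (x : Fin d → ℝ) => x (σ i) * x (τ i))]
      rfl
    simp_rw [h1]
    rw [← Finset.mul_sum, ← Matrix.det_apply', Matrix.det_transpose, Matrix.det_permute, ← mul_assoc]
    rcases Int.units_eq_one_or (Equiv.Perm.sign σ) with h | h <;> simp [h]
  simp_rw [hσ]
  simp [Finset.card_univ, Fintype.card_perm]

theorem lintegral_volumeWeight {D : Measure (Fin d → ℝ)} [IsProbabilityMeasure D]
    (hD : ∀ i j, Integrable (fun x : Fin d → ℝ => x i * x j) D) :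
    ∫⁻ X : Fin d → Fin d → ℝ, volumeWeight X ∂(Measure.pi fun _ => D) =
      ENNReal.ofReal (d.factorial * (secondMoment D).det) := by
  rw [← integral_det_transpose_mul_self hD, ofReal_integral_eq_lintegral_ofReal
    (integrable_det_transpose_mul_self hD)]
  · rfl
  · refine Filter.Eventually.of_forall fun X => ?_
    have := (Matrix.posSemidef_conjTranspose_mul_self (Matrix.of X)).det_nonneg
    rwa [Matrix.conjTranspose_eq_transpose_of_trivial] at this

theorem posSemidef_secondMoment {D : Measure (Fin d → ℝ)}
    (hD : ∀ i j, Integrable (fun x : Fin d → ℝ => x i * x j) D) : (secondMoment D).PosSemidef := by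
  refine Matrix.PosSemidef.of_dotProduct_mulVec_nonneg ?_ fun v => ?_
  · ext i j
    simp [secondMoment, mul_comm]
  · have h : star v ⬝ᵥ (secondMoment D *ᵥ v) = ∫ x, (v ⬝ᵥ x) ^ 2 ∂D := by
      have : ∀ x : Fin d → ℝ, (v ⬝ᵥ x) ^ 2 = ∑ i, ∑ j, v i * v j * (x i * x j) := by
        intro x
        rw [sq, dotProduct, Finset.sum_mul_sum]
        exact Finset.sum_congr rfl fun i _ => Finset.sum_congr rfl fun j _ => by ring
      simp_rw [this]
      rw [integral_finsetSum _ fun i _ => integrable_finsetSum _ fun j _ => (hD i j).const_mul _]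
      simp only [star_trivial, dotProduct, Matrix.mulVec, secondMoment, Matrix.of_apply, Finset.mul_sum]
      refine Finset.sum_congr rfl fun i _ => ?_
      rw [integral_finsetSum _ fun j _ => (hD i j).const_mul _]
      refine Finset.sum_congr rfl fun j _ => ?_
      rw [integral_const_mul]
      ring
    rw [h]
    exact integral_nonneg fun x => sq_nonneg _

theorem posDef_secondMoment {D : Measure (Fin d → ℝ)}
    (hD : ∀ i j, Integrable (fun x : Fin d → ℝ => x i * x j) D) (hr : (secondMoment D).rank = d) :
    (secondMoment D).PosDef := by
  refine (posSemidef_secondMoment hD).posDef_iff_isUnit.2 ?_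
  rw [← Matrix.mulVec_surjective_iff_isUnit]
  have h : LinearMap.range (secondMoment D).mulVecLin = ⊤ :=
    Submodule.eq_top_of_finrank_eq (by rw [← Matrix.rank, hr, Module.finrank_fin_fun])
  exact LinearMap.range_eq_top.1 h

/-! ### The law of one round -/

theorem measurable_matrix_det {α : Type*} [MeasurableSpace α] {M : α → Matrix (Fin d) (Fin d) ℝ}
    (hM : ∀ i j, Measurable fun a => M a i j) : Measurable fun a => (M a).det := by
  simp_rw [Matrix.det_apply']
  fun_prop

theorem measurable_volumeWeight : Measurable (volumeWeight : (Fin d → Fin d → ℝ) → ENNReal) := by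
  refine ENNReal.measurable_ofReal.comp (measurable_matrix_det fun i j => ?_)
  simp only [Matrix.mul_apply, Matrix.transpose_apply, Matrix.of_apply]
  fun_prop

theorem measurable_completionVolume {α : Type*} [MeasurableSpace α] {x : α → ℕ → Fin d → ℝ}
    {w : α → ℕ → ℝ} (hx : ∀ j, Measurable fun a => x a j) (hw : ∀ j, Measurable fun a => w a j)
    (r i : ℕ) (I : Finset ℕ) : Measurable fun a => completionVolume (x a) (w a) r i I := by
  induction r generalizing i I with
  | zero =>
    simp only [completionVolume, subsetVolume]
    split_ifs
    · refine measurable_matrix_det fun b c => ?_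
      simp only [gram_apply]
      fun_prop
    · exact measurable_const
  | succ r ih =>
    simp only [completionVolume]
    exact (ih _ _).add (ih _ _)

theorem measurable_candidateNorm (G : Matrix (Fin d) (Fin d) ℝ) : Measurable (candidateNorm G) := by
  unfold candidateNorm
  simp only [dotProduct, Matrix.vecMul]
  fun_prop

/-- The inputs of one round. -/
abbrev RoundInput (d : ℕ) : Type := (Fin (d ^ 2 + 1) → Fin d → ℝ) × (Fin (d ^ 2 + 1) → ℝ)

/-- The inputs for which a round ends with acceptance. -/
def acceptSet (S : Matrix (Fin d) (Fin d) ℝ) : Set (RoundInput d) :=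
  {z | Accepts S⁻¹ S.det (ofBlock z.1) (ofBlock z.2)}

/-- The set of candidates selected in a round with inputs `z`. -/
noncomputable def roundSelection (S : Matrix (Fin d) (Fin d) ℝ) (z : RoundInput d) : Finset ℕ :=
  candidateSelection S⁻¹ (ofBlock z.1) (ofBlock z.2)

/-- The matrix of the selected candidates of a round with inputs `z`. -/
noncomputable def roundOutput (S : Matrix (Fin d) (Fin d) ℝ) (z : RoundInput d) :
    Fin d → Fin d → ℝ :=
  listed (ofBlock z.1) (roundSelection S z)

theorem measurable_ofBlock_fst (i : ℕ) : Measurable fun z : RoundInput d => ofBlock z.1 i :=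
  (measurable_pi_apply _).comp measurable_fst

theorem measurable_ofBlock_snd (i : ℕ) : Measurable fun z : RoundInput d => ofBlock z.2 i :=
  (measurable_pi_apply _).comp measurable_snd

theorem measurable_completionVolume_candidates (G : Matrix (Fin d) (Fin d) ℝ) (r i : ℕ)
    (I : Finset ℕ) : Measurable fun z : RoundInput d =>
      completionVolume (ofBlock z.1) (candidateWeight G (ofBlock z.1)) r i I :=
  measurable_completionVolume measurable_ofBlock_fst
    (fun j => ((measurable_candidateNorm G).comp (measurable_ofBlock_fst j)).inv) r i I

theorem measurableSet_acceptSet (S : Matrix (Fin d) (Fin d) ℝ) : MeasurableSet (acceptSet S) := by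
  simp only [acceptSet, Accepts, candidateDet_eq_completionVolume]
  exact measurableSet_lt ((measurable_ofBlock_snd _).mul_const _)
    (measurable_completionVolume_candidates _ _ _ _)

theorem roundSelection_subset (S : Matrix (Fin d) (Fin d) ℝ) (z : RoundInput d) :
    roundSelection S z ⊆ Finset.range (d ^ 2) := fun j hj =>
  Finset.mem_range.2 (lt_of_mem_selection _ _ _ _ _ j hj)

theorem measurableSet_roundSelection_eq (S : Matrix (Fin d) (Fin d) ℝ) (J : Finset ℕ) :
    MeasurableSet {z : RoundInput d | roundSelection S z = J} := by
  by_cases hJ : J ⊆ Finset.range (d ^ 2)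
  · simp only [roundSelection, candidateSelection, selection_eq_iff _ _ _ _
      fun j hj => Finset.mem_range.1 (hJ hj), Set.ofPred_forall]
    refine MeasurableSet.iInter fun i => MeasurableSet.iInter fun hi => ?_
    refine MeasurableSet.iff ?_ (MeasurableSet.const _)
    exact measurableSet_lt ((measurable_ofBlock_snd _).mul
      (measurable_completionVolume_candidates _ _ _ _)) (measurable_completionVolume_candidates _ _ _ _)
  · convert MeasurableSet.empty
    refine Set.eq_empty_of_forall_notMem fun z hz => hJ ?_
    have : roundSelection S z = J := hz
    exact this ▸ roundSelection_subset S z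

theorem measurable_listed (J : Finset ℕ) :
    Measurable fun z : RoundInput d => listed (ofBlock z.1) J := by
  unfold listed
  split_ifs
  · exact measurable_pi_lambda _ fun c => measurable_ofBlock_fst _
  · exact measurable_const

theorem measurable_roundOutput (S : Matrix (Fin d) (Fin d) ℝ) : Measurable (roundOutput S) := by
  intro A hA
  have : roundOutput S ⁻¹' A = ⋃ J : Finset ℕ,
      {z | roundSelection S z = J} ∩ (fun z : RoundInput d => listed (ofBlock z.1) J) ⁻¹' A := by
    ext z
    simp [roundOutput]
  rw [this]
  exact MeasurableSet.iUnion fun J =>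
    (measurableSet_roundSelection_eq S J).inter (measurable_listed J hA)

/-- The law of the inputs of one round. -/
noncomputable def roundLaw (L : Measure (Fin d → ℝ)) : Measure (RoundInput d) :=
  (Measure.pi fun _ => L).prod (Measure.pi fun _ => uniformLaw)

instance (L : Measure (Fin d → ℝ)) [IsProbabilityMeasure L] : IsProbabilityMeasure (roundLaw L) := by
  unfold roundLaw; infer_instance

variable {S : Matrix (Fin d) (Fin d) ℝ}

/-- Integration of `pi_uniformLaw_selection` over the candidates. -/
theorem roundLaw_acceptSet_inter_roundSelection (hS : S.PosDef) (L : Measure (Fin d → ℝ))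
    [IsProbabilityMeasure L] {J : Finset ℕ} (hJ : J ⊆ Finset.range (d ^ 2))
    {A : Set (Fin d → Fin d → ℝ)} (hA : MeasurableSet A) :
    roundLaw L (acceptSet S ∩ roundOutput S ⁻¹' A ∩ {z | roundSelection S z = J}) =
      ∫⁻ X, {X : Fin (d ^ 2 + 1) → Fin d → ℝ | listed (ofBlock X) J ∈ A}.indicator (fun X =>
        ENNReal.ofReal (subsetVolume (ofBlock X) (candidateWeight S⁻¹ (ofBlock X)) J / S.det)) X
      ∂(Measure.pi fun _ => L) := by
  rw [roundLaw, Measure.prod_apply (((measurableSet_acceptSet S).inter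
    (measurable_roundOutput S hA)).inter (measurableSet_roundSelection_eq S J))]
  refine lintegral_congr fun X => ?_
  have hw := candidateWeight_nonneg hS.inv.posSemidef (ofBlock X)
  by_cases hX : listed (ofBlock X) J ∈ A
  · have hX' : X ∈ {X : Fin (d ^ 2 + 1) → Fin d → ℝ | listed (ofBlock X) J ∈ A} := hX
    rw [Set.indicator_of_mem hX', ← pi_uniformLaw_selection (ofBlock X) hw
      (fun j hj => Finset.mem_range.1 (hJ hj))
      ((candidateDet_eq_completionVolume _).symm.trans_le (candidateDet_inv_le hS _))]
    congr 1
    ext u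
    simp only [Set.mem_preimage, Set.mem_inter_iff, acceptSet, Set.mem_ofPred_eq, Accepts,
      candidateDet_eq_completionVolume, roundOutput]
    constructor
    · rintro ⟨⟨h1, -⟩, h2⟩
      exact ⟨h1, h2⟩
    · rintro ⟨h1, h2⟩
      have h2' : roundSelection S (X, u) = J := h2
      exact ⟨⟨h1, h2' ▸ hX⟩, h2⟩
  · have hX' : X ∉ {X : Fin (d ^ 2 + 1) → Fin d → ℝ | listed (ofBlock X) J ∈ A} := hX
    rw [Set.indicator_of_notMem hX']
    convert measure_empty (μ := Measure.pi fun _ : Fin (d ^ 2 + 1) => uniformLaw)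
    refine Set.eq_empty_of_forall_notMem ?_
    rintro u ⟨⟨-, h1⟩, h2⟩
    have h2' : roundSelection S (X, u) = J := h2
    rw [Set.mem_preimage, roundOutput, h2'] at h1
    exact hX h1

theorem volumeWeight_eq_zero {Y : Fin d → Fin d → ℝ} {c : Fin d} (hc : Y c = 0) :
    volumeWeight Y = 0 := by
  have : (Matrix.of Y).det = 0 := Matrix.det_eq_zero_of_row_eq_zero c fun j => congrFun hc j
  simp [volumeWeight, this]

theorem volumeWeight_toReal_nonneg (Y : Fin d → Fin d → ℝ) :
    0 ≤ ((Matrix.of Y)ᵀ * Matrix.of Y).det := by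
  have := (Matrix.posSemidef_conjTranspose_mul_self (Matrix.of Y)).det_nonneg
  rwa [Matrix.conjTranspose_eq_transpose_of_trivial] at this

/-- The density of leverage score sampling cancels the weights of the candidates, up to a constant
factor per row. -/
theorem prod_density_mul_weighted_volume (hd : 1 ≤ d) (hS : S.PosDef) {T : ℝ} (hT : 0 < T)
    (Y : Fin d → Fin d → ℝ) :
    (∏ c, ENNReal.ofReal (Y c ⬝ᵥ (S⁻¹.mulVec (Y c)) / T)) *
      ENNReal.ofReal ((∏ c, (candidateNorm S⁻¹ (Y c))⁻¹) *
        ((Matrix.of Y)ᵀ * Matrix.of Y).det / S.det) =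
      ENNReal.ofReal (((d * T) ^ d * S.det)⁻¹) * volumeWeight Y := by
  by_cases hY : ∃ c, Y c = 0
  · obtain ⟨c, hc⟩ := hY
    have h := volumeWeight_eq_zero hc
    have h0 : ((Matrix.of Y)ᵀ * Matrix.of Y).det = 0 :=
      le_antisymm (ENNReal.ofReal_eq_zero.1 h) (volumeWeight_toReal_nonneg Y)
    rw [h, h0]
    simp
  · have hd0 : (0 : ℝ) < d := by exact_mod_cast hd
    have hq : ∀ c, 0 < Y c ⬝ᵥ (S⁻¹.mulVec (Y c)) := fun c => by
      simpa using hS.inv.dotProduct_mulVec_pos fun h => hY ⟨c, h⟩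
    rw [← ENNReal.ofReal_prod_of_nonneg fun c _ => (div_pos (hq c) hT).le,
      ← ENNReal.ofReal_mul (Finset.prod_nonneg fun c _ => (div_pos (hq c) hT).le), volumeWeight,
      ← ENNReal.ofReal_mul (inv_nonneg.2 (mul_pos (by positivity) hS.det_pos).le)]
    congr 1
    have hc : ∀ c, Y c ⬝ᵥ (S⁻¹.mulVec (Y c)) / T * (candidateNorm S⁻¹ (Y c))⁻¹ = (d * T)⁻¹ := by
      intro c
      rw [candidateNorm, ← Matrix.dotProduct_mulVec]
      have := (hq c).ne'
      field_simp
    rw [mul_div_assoc, ← mul_assoc, ← Finset.prod_mul_distrib, Finset.prod_congr rfl fun c _ => hc c,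
      Finset.prod_const, Finset.card_univ, Fintype.card_fin, inv_pow, div_eq_mul_inv]
    ring

theorem measurable_leverage_density (S : Matrix (Fin d) (Fin d) ℝ) (T : ℝ) :
    Measurable fun x : Fin d → ℝ => ENNReal.ofReal (x ⬝ᵥ (S⁻¹.mulVec x) / T) := by
  simp only [dotProduct, Matrix.mulVec]
  fun_prop

/-- A nonpositive trace would make the density, and with it the leverage law, vanish. -/
theorem leverage_trace_pos (hS : S.PosDef) (D : Measure (Fin d → ℝ))
    [h : IsProbabilityMeasure (leverageLaw S D)] : 0 < (secondMoment D * S⁻¹).trace := by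
  by_contra! hT
  have h1 : ∀ x : Fin d → ℝ,
      ENNReal.ofReal (x ⬝ᵥ (S⁻¹.mulVec x) / (secondMoment D * S⁻¹).trace) = 0 := fun x =>
    ENNReal.ofReal_eq_zero.2 (div_nonpos_of_nonneg_of_nonpos
      (by simpa using hS.inv.posSemidef.dotProduct_mulVec_nonneg x) hT)
  have h2 : leverageLaw S D = 0 := by
    rw [leverageLaw, funext h1]
    exact withDensity_zero
  exact IsProbabilityMeasure.ne_zero (leverageLaw S D) h2

/-- The rows selected by a fixed set `J` are independent with the leverage law, and reweighting by
the acceptance and selection probabilities turns their law into the unnormalized volume-rescaled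
law, with a factor that does not depend on `J`. -/
theorem roundLaw_acceptSet_inter_of_card (hd : 1 ≤ d) (hS : S.PosDef) (D : Measure (Fin d → ℝ))
    [IsProbabilityMeasure D] [IsProbabilityMeasure (leverageLaw S D)] {J : Finset ℕ}
    (hJ : J ⊆ Finset.range (d ^ 2)) (hcard : J.card = d)
    {A : Set (Fin d → Fin d → ℝ)} (hA : MeasurableSet A) :
    roundLaw (leverageLaw S D)
      (acceptSet S ∩ roundOutput S ⁻¹' A ∩ {z | roundSelection S z = J}) =
      ENNReal.ofReal (((d * (secondMoment D * S⁻¹).trace) ^ d * S.det)⁻¹) *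
        (Measure.pi fun _ => D).withDensity volumeWeight A := by
  rw [roundLaw_acceptSet_inter_roundSelection hS _ hJ hA]
  set T := (secondMoment D * S⁻¹).trace with hT
  have hTpos : 0 < T := leverage_trace_pos hS D
  have hJlt : ∀ c, J.orderEmbOfFin hcard c < d ^ 2 := fun c =>
    Finset.mem_range.1 (hJ (J.orderEmbOfFin_mem hcard c))
  -- `e` enumerates `J`; the minimum only serves to bound the index and has no effect.
  let e : Fin d → Fin (d ^ 2 + 1) := fun c =>
    ⟨min (J.orderEmbOfFin hcard c) (d ^ 2), Nat.lt_succ_of_le (min_le_right _ _)⟩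
  have he : Function.Injective e := by
    intro a b hab
    have h : min (J.orderEmbOfFin hcard a) (d ^ 2) = min (J.orderEmbOfFin hcard b) (d ^ 2) :=
      congrArg Fin.val hab
    rw [min_eq_left (hJlt a).le, min_eq_left (hJlt b).le] at h
    exact (J.orderEmbOfFin hcard).injective h
  have hlist : ∀ X : Fin (d ^ 2 + 1) → Fin d → ℝ, listed (ofBlock X) J = fun c => X (e c) :=
    fun X => dif_pos hcard
  let H : (Fin d → Fin d → ℝ) → ENNReal := A.indicator fun Y =>
    ENNReal.ofReal ((∏ c, (candidateNorm S⁻¹ (Y c))⁻¹) *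
      ((Matrix.of Y)ᵀ * Matrix.of Y).det / S.det)
  have hHm : Measurable H := by
    refine Measurable.indicator (ENNReal.measurable_ofReal.comp (Measurable.div_const ?_ _)) hA
    refine Measurable.mul (Finset.measurable_prod _ fun c _ =>
      ((measurable_candidateNorm _).comp (measurable_pi_apply c)).inv) ?_
    refine measurable_matrix_det fun i j => ?_
    simp only [Matrix.mul_apply, Matrix.transpose_apply, Matrix.of_apply]
    fun_prop
  calc _ = ∫⁻ X : Fin (d ^ 2 + 1) → Fin d → ℝ, H (fun c => X (e c))
        ∂(Measure.pi fun _ => leverageLaw S D) := by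
        refine lintegral_congr fun X => ?_
        by_cases hX : listed (ofBlock X) J ∈ A
        · have hX' : (fun c => X (e c)) ∈ A := by rwa [← hlist]
          simp only [H]
          rw [Set.indicator_of_mem hX', Set.indicator_of_mem
            (by exact hX : X ∈ {X : Fin (d ^ 2 + 1) → Fin d → ℝ | listed (ofBlock X) J ∈ A}),
            subsetVolume, if_pos hcard, det_gram_eq_prod_mul_det_sq _ _ hcard]
          rfl
        · have hX' : (fun c => X (e c)) ∉ A := by rwa [← hlist]
          simp only [H]
          rw [Set.indicator_of_notMem hX', Set.indicator_of_notMem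
            (by exact hX : X ∉ {X : Fin (d ^ 2 + 1) → Fin d → ℝ | listed (ofBlock X) J ∈ A})]
    _ = ∫⁻ Y, H Y ∂(Measure.pi fun _ => leverageLaw S D) :=
        (measurePreserving_pi_comp_injective _ he).lintegral_comp hHm
    _ = ∫⁻ Y, (∏ c, ENNReal.ofReal (Y c ⬝ᵥ (S⁻¹.mulVec (Y c)) / T)) * H Y
          ∂(Measure.pi fun _ => D) := by
        have hsf : SigmaFinite (D.withDensity fun x =>
            ENNReal.ofReal (x ⬝ᵥ (S⁻¹.mulVec x) / T)) :=
          inferInstanceAs (SigmaFinite (leverageLaw S D))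
        have hpi := Measure.pi_withDensity (ι := Fin d) D (measurable_leverage_density S T)
        rw [show leverageLaw S D = D.withDensity fun x =>
          ENNReal.ofReal (x ⬝ᵥ (S⁻¹.mulVec x) / T) from rfl, hpi,
          lintegral_withDensity_eq_lintegral_mul (f := fun Y : Fin d → Fin d → ℝ =>
            ∏ c, ENNReal.ofReal (Y c ⬝ᵥ (S⁻¹.mulVec (Y c)) / T)) _
            (Finset.measurable_prod _ fun c _ =>
              (measurable_leverage_density S T).comp (measurable_pi_apply c)) hHm]
        rfl
    _ = ∫⁻ Y, ENNReal.ofReal (((d * T) ^ d * S.det)⁻¹) * A.indicator volumeWeight Y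
          ∂(Measure.pi fun _ => D) := by
        refine lintegral_congr fun Y => ?_
        by_cases hY : Y ∈ A
        · simp only [H, Set.indicator_of_mem hY]
          exact prod_density_mul_weighted_volume hd hS hTpos Y
        · simp only [H, Set.indicator_of_notMem hY, mul_zero]
    _ = _ := by
        rw [lintegral_const_mul _ (measurable_volumeWeight.indicator hA), lintegral_indicator hA,
          withDensity_apply _ hA]

/-- On the event of acceptance, the output of a round has the unnormalized volume-rescaled law, up
to a constant factor. -/
theorem roundLaw_acceptSet_inter_preimage (hd : 1 ≤ d) (hS : S.PosDef) (D : Measure (Fin d → ℝ))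
    [IsProbabilityMeasure D] [IsProbabilityMeasure (leverageLaw S D)]
    {A : Set (Fin d → Fin d → ℝ)} (hA : MeasurableSet A) :
    roundLaw (leverageLaw S D) (acceptSet S ∩ roundOutput S ⁻¹' A) =
      ((d ^ 2).choose d : ENNReal) *
      ENNReal.ofReal (((d * (secondMoment D * S⁻¹).trace) ^ d * S.det)⁻¹) *
        (Measure.pi fun _ => D).withDensity volumeWeight A := by
  have hE : MeasurableSet (acceptSet S ∩ roundOutput S ⁻¹' A) :=
    (measurableSet_acceptSet S).inter (measurable_roundOutput S hA)
  have hsplit : acceptSet S ∩ roundOutput S ⁻¹' A = ⋃ J ∈ (Finset.range (d ^ 2)).powerset,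
      acceptSet S ∩ roundOutput S ⁻¹' A ∩ {z | roundSelection S z = J} := by
    ext z
    simp only [Set.mem_iUnion, Finset.mem_powerset, exists_prop]
    exact ⟨fun h => ⟨_, roundSelection_subset S z, h, rfl⟩, fun ⟨_, _, h, _⟩ => h⟩
  rw [hsplit, measure_biUnion_finset]
  · rw [← Finset.sum_subset (fun J hJ => Finset.mem_powerset.2
      (Finset.mem_powersetCard.1 hJ).1 : Finset.powersetCard d (Finset.range (d ^ 2)) ⊆ _)]
    · rw [Finset.sum_congr rfl fun J hJ => roundLaw_acceptSet_inter_of_card hd hS D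
        (Finset.mem_powersetCard.1 hJ).1 (Finset.mem_powersetCard.1 hJ).2 hA, Finset.sum_const,
        Finset.card_powersetCard, Finset.card_range, nsmul_eq_mul, mul_assoc]
    · intro J hJ hJ'
      have hcard : J.card ≠ d := fun h =>
        hJ' (Finset.mem_powersetCard.2 ⟨Finset.mem_powerset.1 hJ, h⟩)
      rw [roundLaw_acceptSet_inter_roundSelection hS _ (Finset.mem_powerset.1 hJ) hA]
      simp [subsetVolume, hcard]
  · intro J _ J' _ hne
    refine Set.disjoint_left.2 ?_
    rintro z ⟨-, h⟩ ⟨-, h'⟩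
    exact hne (h.symm.trans h')
  · exact fun J _ => hE.inter (measurableSet_roundSelection_eq S J)

/-- With `Σ` the second moment matrix and `T = tr (Σ S⁻¹)`, the acceptance probability is
`d² (d² - 1) ⋯ (d² - d + 1) det Σ / ((d T) ^ d det S)`. -/
theorem quarter_le_roundLaw_acceptSet (hd : 1 ≤ d) (hS : S.PosDef) {D : Measure (Fin d → ℝ)}
    [IsProbabilityMeasure D] [IsProbabilityMeasure (leverageLaw S D)]
    (hD : ∀ i j, Integrable (fun x : Fin d → ℝ => x i * x j) D) {ε : ℝ} (hε : 2 * d * ε ^ 2 = 1)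
    (hM : (secondMoment D).PosDef) (h1 : (S - (1 - ε) • secondMoment D).PosSemidef)
    (h2 : ((1 + ε) • secondMoment D - S).PosSemidef) :
    ENNReal.ofReal (1 / 4) ≤ roundLaw (leverageLaw S D) (acceptSet S) := by
  have h := roundLaw_acceptSet_inter_preimage hd hS D MeasurableSet.univ
  rw [Set.preimage_univ, Set.inter_univ, withDensity_apply _ MeasurableSet.univ,
    Measure.restrict_univ, lintegral_volumeWeight hD] at h
  set T := (secondMoment D * S⁻¹).trace with hT
  have hTpos : 0 < T := leverage_trace_pos hS D
  have hd0 : (0 : ℝ) < d := by exact_mod_cast hd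
  have hSd := hS.det_pos
  have hMd := hM.det_pos
  rw [h, ← ENNReal.ofReal_natCast, ← ENNReal.ofReal_mul (by positivity),
    ← ENNReal.ofReal_mul (by positivity)]
  refine ENNReal.ofReal_le_ofReal ?_
  have hA := half_pow_trace_le_det hd hε hS hM h1 h2
  have hB := half_le_descFactorial hd
  rw [Matrix.det_mul, Matrix.det_nonsing_inv, Ring.inverse_eq_inv'] at hA
  rw [Nat.descFactorial_eq_factorial_mul_choose, Nat.cast_mul] at hB
  have hAB := mul_le_mul hB hA (by positivity) (by positivity)
  have hpow : ((d : ℝ) ^ 2) ^ d * (T / d) ^ d = (d * T) ^ d := by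
    rw [← mul_pow]; congr 1; field_simp
  have hAB' : 1 / 4 * (d * T) ^ d ≤
      (d.factorial * (d ^ 2).choose d : ℝ) * ((secondMoment D).det * S.det⁻¹) := by
    rw [← hpow]
    linarith
  calc (1 / 4 : ℝ) = 1 / 4 * (d * T) ^ d * ((d * T) ^ d)⁻¹ := by field_simp
    _ ≤ (d.factorial * (d ^ 2).choose d : ℝ) * ((secondMoment D).det * S.det⁻¹) *
        ((d * T) ^ d)⁻¹ := by gcongr
    _ = _ := by rw [mul_inv]; ring

end OneRound

/-! ### Repetition until acceptance -/

section Repetition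

variable {α : Type*}

/-- The index of the first term of the sequence `z` in the set `E`; zero if there is none. -/
noncomputable def firstEntry (E : Set α) (z : ℕ → α) : ℕ := sInf {n | z n ∈ E}

theorem firstEntry_mem {E : Set α} {z : ℕ → α} (h : ∃ n, z n ∈ E) : z (firstEntry E z) ∈ E :=
  Nat.sInf_mem h

theorem notMem_of_lt_firstEntry {E : Set α} {z : ℕ → α} {m : ℕ} (h : m < firstEntry E z) :
    z m ∉ E := Nat.notMem_of_lt_sInf h

theorem firstEntry_eq {E : Set α} {z : ℕ → α} {n : ℕ} (h : ∀ m < n, z m ∉ E) (hn : z n ∈ E) :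
    firstEntry E z = n := by
  refine le_antisymm (Nat.sInf_le hn) (not_lt.1 fun hlt => ?_)
  exact h _ hlt (firstEntry_mem ⟨n, hn⟩)

variable [MeasurableSpace α]

theorem measurable_firstEntry {E : Set α} (hE : MeasurableSet E) : Measurable (firstEntry E) := by
  have h1 : ∀ n, MeasurableSet {z : ℕ → α | z n ∈ E} := fun n => measurable_pi_apply n hE
  refine measurable_of_Iio fun n => ?_
  have : firstEntry E ⁻¹' Set.Iio n =
      {z | ∃ m < n, z m ∈ E} ∪ ({z | ∀ m, z m ∉ E} ∩ {_z | 0 < n}) := by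
    ext z
    simp only [Set.mem_preimage, Set.mem_Iio, Set.mem_union, Set.mem_inter_iff, Set.mem_ofPred_eq]
    constructor
    · intro h
      by_cases hz : ∃ m, z m ∈ E
      · exact Or.inl ⟨_, h, firstEntry_mem hz⟩
      · exact Or.inr ⟨by simpa using hz, (Nat.zero_le _).trans_lt h⟩
    · rintro (⟨m, hm, hmE⟩ | ⟨h, hn⟩)
      · exact (Nat.sInf_le hmE).trans_lt hm
      · have : {m | z m ∈ E} = ∅ := Set.eq_empty_of_forall_notMem h
        rwa [firstEntry, this, Nat.sInf_empty]
  rw [this]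
  refine MeasurableSet.union ?_ (MeasurableSet.inter ?_ (MeasurableSet.const _))
  · have : {z : ℕ → α | ∃ m < n, z m ∈ E} = ⋃ m, ⋃ (_ : m < n), {z | z m ∈ E} := by
      ext z; simp
    rw [this]
    exact MeasurableSet.iUnion fun m => MeasurableSet.iUnion fun _ => h1 m
  · have : {z : ℕ → α | ∀ m, z m ∉ E} = ⋂ m, {z | z m ∈ E}ᶜ := by ext z; simp
    rw [this]
    exact MeasurableSet.iInter fun m => (h1 m).compl

theorem measurable_apply_firstEntry {E : Set α} (hE : MeasurableSet E) :
    Measurable fun z : ℕ → α => z (firstEntry E z) := by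
  have h : Measurable fun p : ℕ × (ℕ → α) => p.2 p.1 :=
    measurable_from_prod_countable_right fun n => measurable_pi_apply n
  exact h.comp ((measurable_firstEntry hE).prodMk measurable_id)

variable {ν : Measure α} [IsProbabilityMeasure ν]

theorem infinitePi_notMem_and_mem {E B : Set α} (hE : MeasurableSet E) (hB : MeasurableSet B)
    (n : ℕ) : (Measure.infinitePi fun _ : ℕ => ν) {z | (∀ m < n, z m ∉ E) ∧ z n ∈ B} =
      ν Eᶜ ^ n * ν B := by
  have h : {z : ℕ → α | (∀ m < n, z m ∉ E) ∧ z n ∈ B} =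
      Set.pi (Finset.range (n + 1)) fun m => if m < n then Eᶜ else B := by
    ext z
    simp only [Set.mem_ofPred_eq, Set.mem_pi, Finset.coe_range, Set.mem_Iio, Nat.lt_succ_iff_lt_or_eq]
    constructor
    · rintro ⟨h1, h2⟩ m (hm | rfl)
      · simpa [hm] using h1 m hm
      · simpa using h2
    · intro h
      refine ⟨fun m hm => ?_, by simpa using h n (Or.inr rfl)⟩
      simpa [hm] using h m (Or.inl hm)
  rw [h, Measure.infinitePi_pi, Finset.prod_range_succ, Finset.prod_congr rfl fun m hm => by
    rw [if_pos (Finset.mem_range.1 hm)], Finset.prod_const, Finset.card_range, if_neg (lt_irrefl n)]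
  intro m _
  split_ifs
  exacts [hE.compl, hB]

theorem infinitePi_forall_lt_notMem {E : Set α} (hE : MeasurableSet E) (n : ℕ) :
    (Measure.infinitePi fun _ : ℕ => ν) {z | ∀ m < n, z m ∉ E} = ν Eᶜ ^ n := by
  simpa using infinitePi_notMem_and_mem (ν := ν) hE MeasurableSet.univ n

theorem ae_exists_mem {E : Set α} (hE : MeasurableSet E) (h0 : ν E ≠ 0) :
    ∀ᵐ z ∂(Measure.infinitePi fun _ : ℕ => ν), ∃ n, z n ∈ E := by
  have hlt : ν Eᶜ < 1 := by
    rw [prob_compl_eq_one_sub hE]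
    exact ENNReal.sub_lt_self ENNReal.one_ne_top one_ne_zero h0
  rw [ae_iff]
  refine le_antisymm (ge_of_tendsto' (ENNReal.tendsto_pow_atTop_nhds_zero_of_lt_one hlt)
    fun n => ?_) zero_le
  rw [← infinitePi_forall_lt_notMem hE n]
  refine measure_mono fun z hz m _ hm => hz ⟨m, hm⟩

/-- In a sequence of independent variables with law `ν`, the first term in `E` has the law `ν`
conditioned on `E`. -/
theorem hasLaw_apply_firstEntry {E : Set α} (hE : MeasurableSet E) (h0 : ν E ≠ 0) :
    HasLaw (fun z : ℕ → α => z (firstEntry E z)) ν[|E] (Measure.infinitePi fun _ : ℕ => ν) := by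
  refine ⟨(measurable_apply_firstEntry hE).aemeasurable, Measure.ext fun A hA => ?_⟩
  rw [Measure.map_apply (measurable_apply_firstEntry hE) hA, cond_apply hE]
  have h : (fun z : ℕ → α => z (firstEntry E z)) ⁻¹' A
      =ᵐ[Measure.infinitePi fun _ : ℕ => ν] ⋃ n, {z | (∀ m < n, z m ∉ E) ∧ z n ∈ E ∩ A} := by
    filter_upwards [ae_exists_mem hE h0] with z hz
    refine propext ⟨fun h => Set.mem_iUnion.2
      ⟨firstEntry E z, fun m hm => notMem_of_lt_firstEntry hm, firstEntry_mem hz, h⟩, fun h => ?_⟩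
    obtain ⟨n, hn, hE', hA'⟩ := Set.mem_iUnion.1 h
    have := firstEntry_eq hn hE'
    change z (firstEntry E z) ∈ A
    rwa [this]
  have hm : ∀ n, MeasurableSet {z : ℕ → α | (∀ m < n, z m ∉ E) ∧ z n ∈ E ∩ A} := by
    intro n
    have : {z : ℕ → α | (∀ m < n, z m ∉ E) ∧ z n ∈ E ∩ A} =
        (⋂ m, ⋂ (_ : m < n), {z | z m ∈ E}ᶜ) ∩ {z | z n ∈ E ∩ A} := by ext z; simp
    rw [this]
    exact (MeasurableSet.iInter fun m => MeasurableSet.iInter fun _ =>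
      (measurable_pi_apply m hE).compl).inter (measurable_pi_apply n (hE.inter hA))
  rw [measure_congr h, measure_iUnion _ hm]
  · simp_rw [infinitePi_notMem_and_mem hE (hE.inter hA)]
    rw [ENNReal.tsum_mul_right, ENNReal.tsum_geometric, prob_compl_eq_one_sub hE,
      ENNReal.sub_sub_cancel ENNReal.one_ne_top prob_le_one]
  · intro n n' hne
    refine Set.disjoint_left.2 ?_
    rintro z ⟨h1, h2⟩ ⟨h1', h2'⟩
    exact hne ((firstEntry_eq h1 h2.1).symm.trans (firstEntry_eq h1' h2'.1))

end Repetition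

/-! ### Independent blocks -/

/-- Consecutive blocks of `d ^ 2 + 1` inputs are independent and distributed as the inputs of one
round. -/
theorem hasLaw_blocks {d : ℕ} {Ω : Type*} [MeasurableSpace Ω] {P : Measure Ω}
    {L : Measure (Fin d → ℝ)} [IsProbabilityMeasure L] {xs : ℕ → Ω → Fin d → ℝ} {us : ℕ → Ω → ℝ}
    (hindep : iIndepFun (fun n ω => (xs n ω, us n ω)) P)
    (hlaw : ∀ n, HasLaw (fun ω => (xs n ω, us n ω)) (L.prod uniformLaw) P) :
    HasLaw (fun ω (n : ℕ) => ((fun j : Fin (d ^ 2 + 1) => xs (n * (d ^ 2 + 1) + j) ω,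
      fun j : Fin (d ^ 2 + 1) => us (n * (d ^ 2 + 1) + j) ω) : RoundInput d))
      (Measure.infinitePi fun _ : ℕ => roundLaw L) P := by
  have h0 : HasLaw (fun ω n => (xs n ω, us n ω))
      (Measure.infinitePi fun _ : ℕ => L.prod uniformLaw) P :=
    hindep.hasLaw_infinitePi hlaw (aemeasurable_pi_iff.2 fun n => (hlaw n).aemeasurable)
  have hinj : Function.Injective fun p : ℕ × Fin (d ^ 2 + 1) => p.1 * (d ^ 2 + 1) + (p.2 : ℕ) :=
    (Nat.divModEquiv (d ^ 2 + 1)).symm.injective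
  have h1 : MeasurePreserving (fun (a : ℕ → (Fin d → ℝ) × ℝ) (p : ℕ × Fin (d ^ 2 + 1)) =>
      a (p.1 * (d ^ 2 + 1) + p.2)) (Measure.infinitePi fun _ : ℕ => L.prod uniformLaw)
      (Measure.infinitePi fun _ : ℕ × Fin (d ^ 2 + 1) => L.prod uniformLaw) :=
    ⟨by fun_prop, Measure.map_infinitePi_infinitePi_of_inj (P := fun _ => L.prod uniformLaw) hinj⟩
  have h2 : MeasurePreserving (MeasurableEquiv.curry ℕ (Fin (d ^ 2 + 1)) ((Fin d → ℝ) × ℝ))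
      (Measure.infinitePi fun _ : ℕ × Fin (d ^ 2 + 1) => L.prod uniformLaw)
      (Measure.infinitePi fun _ : ℕ => Measure.pi fun _ : Fin (d ^ 2 + 1) => L.prod uniformLaw) := by
    refine ⟨(MeasurableEquiv.curry _ _ _).measurable, ?_⟩
    rw [Measure.infinitePi_map_curry (fun (_ : ℕ) (_ : Fin (d ^ 2 + 1)) => L.prod uniformLaw)]
    simp_rw [Measure.infinitePi_eq_pi]
  have h3 : MeasurePreserving (fun (a : ℕ → Fin (d ^ 2 + 1) → (Fin d → ℝ) × ℝ) (n : ℕ) =>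
      MeasurableEquiv.arrowProdEquivProdArrow (Fin d → ℝ) ℝ (Fin (d ^ 2 + 1)) (a n))
      (Measure.infinitePi fun _ : ℕ => Measure.pi fun _ : Fin (d ^ 2 + 1) => L.prod uniformLaw)
      (Measure.infinitePi fun _ : ℕ => roundLaw L) := by
    refine ⟨measurable_pi_lambda _ fun n =>
      (MeasurableEquiv.measurable _).comp (measurable_pi_apply n), ?_⟩
    rw [Measure.infinitePi_map_pi _ fun _ => MeasurableEquiv.measurable _]
    congr 1
    funext n
    exact (measurePreserving_arrowProdEquivProdArrow (Fin d → ℝ) ℝ (Fin (d ^ 2 + 1))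
      (fun _ => L) (fun _ => uniformLaw)).map_eq
  exact (h3.comp (h2.comp h1)).comp_hasLaw h0

/-! ### The law of the output and the number of rounds -/

section Sampler

open RealRAM

variable {d : ℕ} {S : Matrix (Fin d) (Fin d) ℝ}

/-- The output of an accepted round follows volume-rescaled sampling. -/
theorem map_roundOutput_cond_acceptSet (hd : 1 ≤ d) (hS : S.PosDef) {D : Measure (Fin d → ℝ)}
    [IsProbabilityMeasure D] [IsProbabilityMeasure (leverageLaw S D)]
    (h0 : roundLaw (leverageLaw S D) (acceptSet S) ≠ 0) :
    ((roundLaw (leverageLaw S D))[|acceptSet S]).map (roundOutput S) = volumeRescaled d D := by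
  set c : ENNReal := ((d ^ 2).choose d : ENNReal) *
    ENNReal.ofReal (((d * (secondMoment D * S⁻¹).trace) ^ d * S.det)⁻¹) with hc
  have hA : ∀ A, MeasurableSet A → roundLaw (leverageLaw S D) (acceptSet S ∩ roundOutput S ⁻¹' A) =
      c * (Measure.pi fun _ => D).withDensity volumeWeight A := fun A hA =>
    roundLaw_acceptSet_inter_preimage hd hS D hA
  have huniv := hA _ MeasurableSet.univ
  rw [Set.preimage_univ, Set.inter_univ, withDensity_apply _ MeasurableSet.univ,
    Measure.restrict_univ] at huniv
  have hc0 : c ≠ 0 := fun h => h0 (by rw [huniv, h, zero_mul])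
  have hct : c ≠ ⊤ := ENNReal.mul_ne_top (ENNReal.natCast_ne_top _) ENNReal.ofReal_ne_top
  refine Measure.ext fun A hAm => ?_
  rw [Measure.map_apply (measurable_roundOutput S) hAm, cond_apply (measurableSet_acceptSet S),
    hA A hAm, huniv, volumeRescaled, Measure.smul_apply, smul_eq_mul,
    ENNReal.mul_inv (Or.inl hc0) (Or.inl hct), mul_mul_mul_comm, ENNReal.inv_mul_cancel hc0 hct,
    one_mul]

theorem isProbabilityMeasure_of_prod_uniformLaw {L : Measure (Fin d → ℝ)} [SFinite L]
    (h : IsProbabilityMeasure (L.prod uniformLaw)) : IsProbabilityMeasure L := by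
  have h1 := h.measure_univ
  rw [← Set.univ_prod_univ, Measure.prod_prod, measure_univ (μ := uniformLaw), mul_one] at h1
  exact ⟨h1⟩

theorem ae_ne_zero_leverageLaw (S : Matrix (Fin d) (Fin d) ℝ) (D : Measure (Fin d → ℝ)) :
    ∀ᵐ x ∂(leverageLaw S D), x ≠ 0 := by
  rw [leverageLaw, ae_withDensity_iff (measurable_leverage_density S _)]
  refine Filter.Eventually.of_forall fun x hx h => hx ?_
  simp [h]

theorem ae_uniformLaw : ∀ᵐ u ∂uniformLaw, 0 ≤ u ∧ u < 1 := by
  have h1 : ∀ᵐ u : ℝ ∂uniformLaw, u ∈ Set.Icc (0 : ℝ) 1 := ae_restrict_mem measurableSet_Icc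
  have h2 : ∀ᵐ u : ℝ ∂uniformLaw, u ≠ 1 := ae_restrict_of_ae (Measure.ae_ne volume 1)
  filter_upwards [h1, h2] with u hu hne
  exact ⟨hu.1, lt_of_le_of_ne hu.2 hne⟩

/-- The execution of the sampler on inputs whose rounds are not all rejected: it returns the output
of the first accepted round. -/
theorem exec_volumeSampler_firstEntry (hd : 1 ≤ d) (hS : S.PosDef) {x : ℕ → Fin d → ℝ} {u : ℕ → ℝ}
    (hx : ∀ n, x n ≠ 0) (hu : ∀ n, 0 ≤ u n ∧ u n < 1) {z : ℕ → RoundInput d}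
    (hz : ∀ n, z n = (fun j : Fin (d ^ 2 + 1) => x (n * (d ^ 2 + 1) + j),
      fun j : Fin (d ^ 2 + 1) => u (n * (d ^ 2 + 1) + j)))
    (hE : ∃ n, z n ∈ acceptSet S) :
    ∃ s, Exec x u .volumeSampler (initState S) s ∧
      s.samples = (firstEntry (acceptSet S) z + 1) * (d ^ 2 + 1) ∧
      s.time ≤ (firstEntry (acceptSet S) z + 1) * (1400 * d ^ 4) ∧
      s.output d = roundOutput S (z (firstEntry (acceptSet S) z)) := by
  have hb : ∀ n, batch d x n = ofBlock (z n).1 ∧ batch d u n = ofBlock (z n).2 := fun n => by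
    rw [hz]; exact ⟨rfl, rfl⟩
  have hiff : ∀ n, Accepts S⁻¹ S.det (batch d x n) (batch d u n) ↔ z n ∈ acceptSet S := fun n => by
    rw [(hb n).1, (hb n).2]; rfl
  have hacc := (hiff _).2 (firstEntry_mem hE)
  obtain ⟨s, h1, h2, h3, h4⟩ := exec_volumeSampler hd hS hx (fun n => (hu n).1)
    (fun n => (hu n).2) (fun n hn => mt (hiff n).1 (notMem_of_lt_firstEntry hn)) hacc
  refine ⟨s, h1, h2, h3, ?_⟩
  have hdet : candidateDet S⁻¹ (batch d x (firstEntry (acceptSet S) z)) ≠ 0 :=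
    ((mul_nonneg (hu _).1 hS.det_pos.le).trans_lt hacc).ne'
  rw [h4.output_eq (card_candidateSelection hS.inv.posSemidef (fun n => (hu _).1)
    (fun n => (hu _).2) hdet), (hb _).1, (hb _).2]
  rfl

/-- A number of rounds that suffices with probability at least `1 - δ` if each of them is accepted
with probability at least `1 / 4`. -/
theorem exists_number_of_rounds {δ : ℝ} (h0 : 0 < δ) (h1 : δ < 1) :
    ∃ n : ℕ, (3 / 4 : ℝ) ^ n ≤ δ ∧ (n : ℝ) ≤ 5 * max 1 (Real.log (1 / δ)) := by
  have hlog : 0 ≤ Real.log (1 / δ) := Real.log_nonneg (by rw [le_div_iff₀ h0]; linarith)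
  refine ⟨⌈4 * Real.log (1 / δ)⌉₊, ?_, ?_⟩
  · have h34 : (3 / 4 : ℝ) ≤ Real.exp (-(1 / 4)) := by
      have := Real.add_one_le_exp (-(1 / 4) : ℝ)
      linarith
    calc (3 / 4 : ℝ) ^ ⌈4 * Real.log (1 / δ)⌉₊
        ≤ Real.exp (-(1 / 4)) ^ ⌈4 * Real.log (1 / δ)⌉₊ := by gcongr
      _ = Real.exp (⌈4 * Real.log (1 / δ)⌉₊ * -(1 / 4)) := (Real.exp_nat_mul _ _).symm
      _ ≤ Real.exp (-Real.log (1 / δ)) := by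
          refine Real.exp_le_exp.2 ?_
          have := Nat.le_ceil (4 * Real.log (1 / δ))
          linarith
      _ = δ := by rw [one_div, Real.log_inv, neg_neg, Real.exp_log h0]
  · have h2 := (Nat.ceil_lt_add_one (a := 4 * Real.log (1 / δ)) (by positivity)).le
    have h3 := le_max_left 1 (Real.log (1 / δ))
    have h4 := le_max_right 1 (Real.log (1 / δ))
    linarith

theorem measurableSet_exists_lt_mem {α : Type*} [MeasurableSpace α] {E : Set α}
    (hE : MeasurableSet E) (n : ℕ) : MeasurableSet {z : ℕ → α | ∃ m < n, z m ∈ E} := by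
  have : {z : ℕ → α | ∃ m < n, z m ∈ E} = ⋃ m, ⋃ (_ : m < n), {z | z m ∈ E} := by ext z; simp
  rw [this]
  exact MeasurableSet.iUnion fun m => MeasurableSet.iUnion fun _ => measurable_pi_apply m hE

theorem infinitePi_exists_lt_mem {α : Type*} [MeasurableSpace α] {ν : Measure α}
    [IsProbabilityMeasure ν] {E : Set α} (hE : MeasurableSet E)
    (h : ENNReal.ofReal (1 / 4) ≤ ν E) {δ : ℝ} {n : ℕ} (hn : (3 / 4 : ℝ) ^ n ≤ δ) :
    ENNReal.ofReal (1 - δ) ≤ (Measure.infinitePi fun _ : ℕ => ν) {z | ∃ m < n, z m ∈ E} := by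
  have hcompl : {z : ℕ → α | ∀ m < n, z m ∉ E} = {z | ∃ m < n, z m ∈ E}ᶜ := by ext z; simp
  have hδ : ν Eᶜ ^ n ≤ ENNReal.ofReal δ := by
    calc ν Eᶜ ^ n ≤ ENNReal.ofReal (3 / 4) ^ n := by
          gcongr
          rw [prob_compl_eq_one_sub hE]
          calc 1 - ν E ≤ 1 - ENNReal.ofReal (1 / 4) := tsub_le_tsub_left h 1
            _ = ENNReal.ofReal (3 / 4) := by
                rw [← ENNReal.ofReal_one, ← ENNReal.ofReal_sub _ (by norm_num)]; norm_num
      _ = ENNReal.ofReal ((3 / 4) ^ n) := (ENNReal.ofReal_pow (by norm_num) n).symm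
      _ ≤ ENNReal.ofReal δ := ENNReal.ofReal_le_ofReal hn
  have hsum := prob_add_prob_compl (μ := Measure.infinitePi fun _ : ℕ => ν)
    (measurableSet_exists_lt_mem hE n)
  rw [← hcompl, infinitePi_forall_lt_notMem hE] at hsum
  rw [ENNReal.ofReal_sub _ ((by positivity : (0 : ℝ) ≤ (3 / 4) ^ n).trans hn), ENNReal.ofReal_one,
    ← hsum]
  exact tsub_le_iff_right.2 (by gcongr)

end Sampler

theorem mainTheorem11 :
    ∃ (prog : RealRAM.Cmd) (C : ℝ), 0 < C ∧
      ∀ (d : ℕ), 1 ≤ d →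
      ∀ (D : Measure (Fin d → ℝ)), IsProbabilityMeasure D →
      (∀ i j, Integrable (fun x : Fin d → ℝ => x i * x j) D) →
      (secondMoment D).rank = d →
      ∀ (S : Matrix (Fin d) (Fin d) ℝ) (ε : ℝ), ε = 1 / √(2 * (d : ℝ)) →
      (S - (1 - ε) • secondMoment D).PosSemidef →
      ((1 + ε) • secondMoment D - S).PosSemidef →
      ∀ (Ω : Type*) (_ : MeasurableSpace Ω) (P : Measure Ω), IsProbabilityMeasure P →
      ∀ (xs : ℕ → Ω → Fin d → ℝ) (us : ℕ → Ω → ℝ),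
      iIndepFun (fun n ω => (xs n ω, us n ω)) P →
      (∀ n, HasLaw (fun ω => (xs n ω, us n ω))
        ((leverageLaw S D).prod (volume.restrict (Set.Icc (0 : ℝ) 1))) P) →
      ∃ final : Ω → RealRAM.State,
        (∀ᵐ ω ∂P, RealRAM.Exec (fun n => xs n ω) (fun n => us n ω) prog
          (RealRAM.initState S) (final ω)) ∧
        HasLaw (fun ω => (final ω).output d) (volumeRescaled d D) P ∧
        ∀ δ : ℝ, 0 < δ → δ < 1 →
          ENNReal.ofReal (1 - δ) ≤
            P {ω | ((final ω).samples : ℝ) ≤ C * (d : ℝ) ^ 2 * max 1 (Real.log (1 / δ)) ∧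
              ((final ω).time : ℝ) ≤ C * (d : ℝ) ^ 4 * max 1 (Real.log (1 / δ))} := by
  -- Five times the logarithmic factor bounds the number of rounds, and a round takes at most
  -- `1400 * d ^ 4` units of time.
  refine ⟨.volumeSampler, 7000, by norm_num, ?_⟩
  intro d hd D _ hD hrank S ε hε hlo hhi Ω _ P _ xs us hindep hlaw
  have hd1 : (1 : ℝ) ≤ d := by exact_mod_cast hd
  have hε0 : 2 * d * ε ^ 2 = 1 := by
    rw [hε, div_pow, Real.sq_sqrt (by positivity)]
    field_simp
  have hε1 : ε < 1 := by
    rw [hε, div_lt_one (by positivity)]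
    exact Real.lt_sqrt_of_sq_lt (by linarith)
  have hM : (secondMoment D).PosDef := posDef_secondMoment hD hrank
  have hS : S.PosDef := by
    have := (hM.smul (sub_pos.2 hε1)).add_posSemidef hlo
    rwa [add_sub_cancel] at this
  have hsf : SFinite (leverageLaw S D) := by unfold leverageLaw; infer_instance
  have hL : IsProbabilityMeasure (leverageLaw S D) :=
    isProbabilityMeasure_of_prod_uniformLaw ((hlaw 0).isProbabilityMeasure_iff.1 inferInstance)
  have hquarter := quarter_le_roundLaw_acceptSet hd hS hD hε0 hM hlo hhi
  have hE := measurableSet_acceptSet S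
  have hE0 : roundLaw (leverageLaw S D) (acceptSet S) ≠ 0 := fun h => by
    rw [h, nonpos_iff_eq_zero, ENNReal.ofReal_eq_zero] at hquarter
    norm_num at hquarter
  let Z : Ω → ℕ → RoundInput d := fun ω n =>
    (fun j => xs (n * (d ^ 2 + 1) + j) ω, fun j => us (n * (d ^ 2 + 1) + j) ω)
  have hZ : HasLaw Z (Measure.infinitePi fun _ : ℕ => roundLaw (leverageLaw S D)) P :=
    hasLaw_blocks hindep hlaw
  have hinput : ∀ᵐ ω ∂P, ∀ n, xs n ω ≠ 0 ∧ 0 ≤ us n ω ∧ us n ω < 1 := by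
    refine ae_all_iff.2 fun n => ae_of_ae_map (p := fun z => z.1 ≠ 0 ∧ 0 ≤ z.2 ∧ z.2 < 1)
      (hlaw n).aemeasurable ?_
    rw [(hlaw n).map_eq]
    have h1 := Measure.quasiMeasurePreserving_fst (μ := leverageLaw S D) (ν := uniformLaw)
    have h2 := Measure.quasiMeasurePreserving_snd (μ := leverageLaw S D) (ν := uniformLaw)
    exact (h1.ae (ae_ne_zero_leverageLaw S D)).and (h2.ae ae_uniformLaw)
  have hentry : ∀ᵐ ω ∂P, ∃ n, Z ω n ∈ acceptSet S :=
    ae_of_ae_map hZ.aemeasurable (by rw [hZ.map_eq]; exact ae_exists_mem hE hE0)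
  classical
  -- The final state is arbitrary on the null event that the program does not terminate.
  let final : Ω → RealRAM.State := fun ω =>
    if h : ∃ s, RealRAM.Exec (fun n => xs n ω) (fun n => us n ω) .volumeSampler (RealRAM.initState S) s
    then h.choose else RealRAM.initState S
  have hfinal : ∀ᵐ ω ∂P,
      RealRAM.Exec (fun n => xs n ω) (fun n => us n ω) .volumeSampler (RealRAM.initState S) (final ω) ∧
      (final ω).samples = (firstEntry (acceptSet S) (Z ω) + 1) * (d ^ 2 + 1) ∧
      (final ω).time ≤ (firstEntry (acceptSet S) (Z ω) + 1) * (1400 * d ^ 4) ∧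
      (final ω).output d = roundOutput S (Z ω (firstEntry (acceptSet S) (Z ω))) := by
    filter_upwards [hinput, hentry] with ω hω hE'
    obtain ⟨s, hs, hQ⟩ := exec_volumeSampler_firstEntry hd hS (fun n => (hω n).1)
      (fun n => (hω n).2) (fun n => rfl) hE'
    have hex : ∃ s, RealRAM.Exec (fun n => xs n ω) (fun n => us n ω) .volumeSampler (RealRAM.initState S) s :=
      ⟨s, hs⟩
    have hfs : final ω = s := by
      simp only [final, dif_pos hex]
      exact hex.choose_spec.unique hs
    rw [hfs]
    exact ⟨hs, hQ⟩
  refine ⟨final, hfinal.mono fun ω h => h.1, ?_, fun δ hδ0 hδ1 => ?_⟩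
  · have h1 := (hasLaw_apply_firstEntry hE hE0).comp hZ
    have h2 : HasLaw (roundOutput S) (volumeRescaled d D)
        ((roundLaw (leverageLaw S D))[|acceptSet S]) :=
      ⟨(measurable_roundOutput S).aemeasurable, map_roundOutput_cond_acceptSet hd hS hE0⟩
    exact (h2.comp h1).congr (hfinal.mono fun ω h => h.2.2.2)
  · obtain ⟨n, hn, hn'⟩ := exists_number_of_rounds hδ0 hδ1
    refine (infinitePi_exists_lt_mem hE hquarter hn).trans ?_
    rw [← hZ.map_eq, Measure.map_apply_of_aemeasurable hZ.aemeasurable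
      (measurableSet_exists_lt_mem hE n)]
    refine measure_mono_ae ?_
    filter_upwards [hfinal] with ω hω ⟨m, hm, hmE⟩
    have hR : firstEntry (acceptSet S) (Z ω) + 1 ≤ n :=
      Nat.succ_le_of_lt ((Nat.sInf_le hmE).trans_lt hm)
    have hR' : ((firstEntry (acceptSet S) (Z ω) : ℝ) + 1) ≤ 5 * max 1 (Real.log (1 / δ)) :=
      le_trans (by exact_mod_cast hR) hn'
    have hmax : 0 ≤ max 1 (Real.log (1 / δ)) := zero_le_one.trans (le_max_left _ _)
    refine ⟨?_, ?_⟩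
    · rw [hω.2.1]
      push_cast
      calc ((firstEntry (acceptSet S) (Z ω) : ℝ) + 1) * ((d : ℝ) ^ 2 + 1)
          ≤ 5 * max 1 (Real.log (1 / δ)) * (d ^ 2 + d ^ 2) := by
            gcongr
            exact one_le_pow₀ hd1
        _ = 10 * d ^ 2 * max 1 (Real.log (1 / δ)) := by ring
        _ ≤ _ := by gcongr; norm_num
    · calc ((final ω).time : ℝ)
          ≤ ((firstEntry (acceptSet S) (Z ω) : ℝ) + 1) * (1400 * d ^ 4) := by
            exact_mod_cast hω.2.2.1
        _ ≤ 5 * max 1 (Real.log (1 / δ)) * (1400 * d ^ 4) := by gcongr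
        _ = _ := by ring
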